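/- Let $d\ge 2$ be a constant integer and let $\tau\in(0,1]$ be a fixed real number. Consider $n$ points in $\mathbb R^d$, each of which has a color. A color $c$ dominates a box $Q=\prod_{j=1}^d[a_j,b_j]$ if $Q$ contains at least one of the points and at least a $\tau$-fraction of the points in $Q$ have color $c$. There is a static data structure that uses $O(n\log^d n)$ space and, for every query box $Q$, reports all colors that dominate $Q$ in $O(\log^{d-1}n\,(\log\log n)^2)$ worst-case time, where the constants in the bounds depend only on $d$ and $\tau$. The model of computation is a unit-cost RAM with integer words of $\Theta(w)$ bits, where $w\ge 1$ is any word-size parameter such that $n\le 2^w$ and every color is an integer in $[0,2^w)$; point coordinates are real numbers, each of which occupies one memory cell and is accessed only by comparisons. The query algorithm depends only on $d$ and $\tau$, and space is counted in memory cells, including the working memory of queries. The bounds do not depend on $w$. -/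

import Mathlib

open Filter Asymptotics

namespace ColorRange

/-! ### Colored points and dominating colors -/

/-- Indices of the points of the family `P` that lie in the closed box `[a, b] = ∏ⱼ [aⱼ, bⱼ]`
(which is empty if `aⱼ > bⱼ` for some `j`). -/
noncomputable def pointsIn {n d : ℕ} (P : Fin n → Fin d → ℝ) (a b : Fin d → ℝ) :
    Finset (Fin n) :=
  open Classical in Finset.univ.filter fun i => P i ∈ Set.Icc a b

/-- Indices of the points of color `c` in the box `[a, b]`. -/
noncomputable def colorIn {n d : ℕ} (P : Fin n → Fin d → ℝ) (col : Fin n → ℕ)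
    (a b : Fin d → ℝ) (c : ℕ) : Finset (Fin n) :=
  (pointsIn P a b).filter fun i => col i = c

/-- The color `c` dominates the box `[a, b]`: the box contains points, and at least a
`τ`-fraction of the points in it have color `c`. -/
def Dominates {n d : ℕ} (τ : ℝ) (P : Fin n → Fin d → ℝ) (col : Fin n → ℕ)
    (a b : Fin d → ℝ) (c : ℕ) : Prop :=
  (pointsIn P a b).Nonempty ∧
    τ * ((pointsIn P a b).card : ℝ) ≤ ((colorIn P col a b c).card : ℝ)

/-! ### Query programs: a word RAM that accesses coordinates only by comparisons

The machine has words of `W` bits, a read-only table of words, a read-only table of real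
coordinates, a bounded writable working memory of words, the two corners of the query box as
read-only inputs, and a write-only output list. Every elementary operation costs one step. -/

/-- Arithmetic operations on words. -/
inductive Op
  | add | sub | mul | div | mod

/-- Word-valued expressions. -/
inductive Expr
  /-- a constant of the program -/
  | lit (c : ℕ)
  /-- the cell of the static word table at the address given by the value of `e` -/
  | word (e : Expr)
  /-- the cell of the working memory at the address given by the value of `e` -/
  | work (e : Expr)
  /-- an arithmetic operation -/
  | op (o : Op) (e₁ e₂ : Expr)

/-- Coordinate-valued expressions for queries in dimension `d`. -/
inductive KeyExpr (d : ℕ)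
  /-- the lower end `aⱼ` of the query -/
  | lo (j : Fin d)
  /-- the upper end `bⱼ` of the query -/
  | hi (j : Fin d)
  /-- the cell of the static coordinate table at the address given by the value of `e` -/
  | cell (e : Expr)

/-- Conditions: comparisons of words, comparisons of coordinates, Boolean combinations. -/
inductive Test (d : ℕ)
  | lt (e₁ e₂ : Expr)
  | keyLt (x y : KeyExpr d)
  | neg (b : Test d)
  | conj (b₁ b₂ : Test d)

/-- Query programs for dimension `d`. -/
inductive Cmd (d : ℕ)
  /-- do nothing -/
  | skip
  /-- write the value of `val` to the working-memory cell whose address is the value of `addr` -/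
  | store (addr val : Expr)
  /-- report the value of `e` -/
  | emit (e : Expr)
  | seq (c₁ c₂ : Cmd d)
  | ite (b : Test d) (c₁ c₂ : Cmd d)
  | loop (b : Test d) (c : Cmd d)

/-- A static data structure: a table of words, a table of coordinates, and the number of cells
of working memory that are reserved for its queries. -/
structure Store where
  words : List ℕ
  coords : List ℝ
  workCells : ℕ

/-- The space of a data structure, in cells. The working memory is counted too. -/
def Store.space (D : Store) : ℕ := D.words.length + D.coords.length + D.workCells

/-- Changing memory of a run: the working memory and the list of values reported so far. -/
structure State where
  mem : ℕ → ℕ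
  out : List ℕ

/-- Value of an arithmetic operation on words of `W` bits: addition and multiplication are
modulo `2 ^ W`, subtraction is truncated at `0`, division is rounded down. -/
def Op.eval (W : ℕ) : Op → ℕ → ℕ → ℕ
  | .add, x, y => (x + y) % 2 ^ W
  | .sub, x, y => x - y
  | .mul, x, y => (x * y) % 2 ^ W
  | .div, x, y => x / y
  | .mod, x, y => x % y

/-- Value of a word expression. -/
def Expr.eval (W : ℕ) (D : Store) (mem : ℕ → ℕ) : Expr → ℕ
  | .lit c => c % 2 ^ W
  | .word e => D.words.getD (e.eval W D mem) 0
  | .work e => mem (e.eval W D mem)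
  | .op o e₁ e₂ => o.eval W (e₁.eval W D mem) (e₂.eval W D mem)

/-- Number of steps for the evaluation of a word expression. -/
def Expr.cost : Expr → ℕ
  | .lit _ => 1
  | .word e => e.cost + 1
  | .work e => e.cost + 1
  | .op _ e₁ e₂ => e₁.cost + e₂.cost + 1

/-- Value of a coordinate expression, for the query box `[a, b]`. -/
noncomputable def KeyExpr.eval {d : ℕ} (W : ℕ) (D : Store) (a b : Fin d → ℝ) (mem : ℕ → ℕ) :
    KeyExpr d → ℝ
  | .lo j => a j
  | .hi j => b j
  | .cell e => D.coords.getD (e.eval W D mem) 0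

/-- Number of steps for the evaluation of a coordinate expression. -/
def KeyExpr.cost {d : ℕ} : KeyExpr d → ℕ
  | .lo _ => 1
  | .hi _ => 1
  | .cell e => e.cost + 1

/-- Truth of a condition. -/
def Test.Holds {d : ℕ} (W : ℕ) (D : Store) (a b : Fin d → ℝ) (mem : ℕ → ℕ) : Test d → Prop
  | .lt e₁ e₂ => e₁.eval W D mem < e₂.eval W D mem
  | .keyLt x y => x.eval W D a b mem < y.eval W D a b mem
  | .neg t => ¬ t.Holds W D a b mem
  | .conj t₁ t₂ => t₁.Holds W D a b mem ∧ t₂.Holds W D a b mem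

/-- Number of steps for the evaluation of a condition. -/
def Test.cost {d : ℕ} : Test d → ℕ
  | .lt e₁ e₂ => e₁.cost + e₂.cost + 1
  | .keyLt x y => x.cost + y.cost + 1
  | .neg t => t.cost + 1
  | .conj t₁ t₂ => t₁.cost + t₂.cost + 1

/-- `Exec W D a b c s t s'`: on a machine with words of `W` bits and the data structure `D`, the
program `c`, queried with the box `[a, b]` and started in the state `s`, halts in the state `s'`
after exactly `t` steps. A write outside the reserved working memory is not possible. -/
inductive Exec {d : ℕ} (W : ℕ) (D : Store) (a b : Fin d → ℝ) :
    Cmd d → State → ℕ → State → Prop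
  | skip (s : State) : Exec W D a b .skip s 1 s
  | store (addr val : Expr) (s : State) (h : addr.eval W D s.mem < D.workCells) :
      Exec W D a b (.store addr val) s (addr.cost + val.cost + 1)
        ⟨Function.update s.mem (addr.eval W D s.mem) (val.eval W D s.mem), s.out⟩
  | emit (e : Expr) (s : State) :
      Exec W D a b (.emit e) s (e.cost + 1) ⟨s.mem, e.eval W D s.mem :: s.out⟩
  | seq {c₁ c₂ : Cmd d} {s s₁ s₂ : State} {t₁ t₂ : ℕ}
      (h₁ : Exec W D a b c₁ s t₁ s₁) (h₂ : Exec W D a b c₂ s₁ t₂ s₂) :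
      Exec W D a b (.seq c₁ c₂) s (t₁ + t₂) s₂
  | iteTrue {β : Test d} {c₁ c₂ : Cmd d} {s s₁ : State} {t : ℕ}
      (hβ : β.Holds W D a b s.mem) (h : Exec W D a b c₁ s t s₁) :
      Exec W D a b (.ite β c₁ c₂) s (β.cost + t + 1) s₁
  | iteFalse {β : Test d} {c₁ c₂ : Cmd d} {s s₁ : State} {t : ℕ}
      (hβ : ¬ β.Holds W D a b s.mem) (h : Exec W D a b c₂ s t s₁) :
      Exec W D a b (.ite β c₁ c₂) s (β.cost + t + 1) s₁
  | loopDone {β : Test d} {c : Cmd d} {s : State} (hβ : ¬ β.Holds W D a b s.mem) :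
      Exec W D a b (.loop β c) s (β.cost + 1) s
  | loopStep {β : Test d} {c : Cmd d} {s s₁ s₂ : State} {t₁ t₂ : ℕ}
      (hβ : β.Holds W D a b s.mem) (h₁ : Exec W D a b c s t₁ s₁)
      (h₂ : Exec W D a b (.loop β c) s₁ t₂ s₂) :
      Exec W D a b (.loop β c) s (β.cost + 1 + t₁ + t₂) s₂

/-- The program `prog`, run with the data structure `D` on words of `W` bits, answers every
domination query on the colored points `(P, col)` within `T` steps: it reports each color that
dominates the query box exactly once, and nothing else. The initial contents of the working
memory are arbitrary words (so that queries can be repeated), and the output starts empty. -/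
def AnswersQueries {n d : ℕ} (prog : Cmd d) (W : ℕ) (D : Store) (τ : ℝ)
    (P : Fin n → Fin d → ℝ) (col : Fin n → ℕ) (T : ℕ) : Prop :=
  ∀ (a b : Fin d → ℝ) (mem : ℕ → ℕ), (∀ i, mem i < 2 ^ W) →
    ∃ (t : ℕ) (s : State), Exec W D a b prog ⟨mem, []⟩ t s ∧ t ≤ T ∧
      s.out.Nodup ∧ ∀ c : ℕ, c ∈ s.out ↔ Dominates τ P col a b c

end ColorRange

/-! The query gathers a small set of candidate colors in a range tree of all points and then counts
each candidate exactly in a range tree of its own color class.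

The tree. A node is an aligned block of positions in a permutation `ord X t`, where `t` lists the
heights chosen so far. Sorting each aligned block of length `2 ^ h` by the next coordinate turns
`ord X t` into `ord X (h :: t)`, so nodes with equal height lists share one table. Restricting a
whole block by the next coordinate leaves an interval of the next order (`slab_cons`). An interval
splits into O(log n) aligned blocks along the paths to its two ends (`walkSet_union`). After `d - 1`
rounds the query is a disjoint union of O(log^(d-1) n) intervals of orders in which no constraint is
left. The interval ends in the next order are found by binary search once per walk, and fractional
cascading then carries them down in constant time per step (`leftRank_sub`, `rankLo_step`,
`rankLo_right`). Hence the last coordinate costs no further logarithm.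

Candidates. Two windows of length `2 ^ g`, with `g = log₂ y`, cover a final interval of length `y`.
For every such window the tables list the colors with at least a `1/κ` share of it; there are at
most `κ` of them. A color listed for neither window has fewer than `2y/κ` points in the interval.
Listed colors gain weight `y`. So the weight `v` owed to a color satisfies `κ * count ≤ κ * v + 2 *
|S|`, where `S` is the set of points seen, while the total weight handed out is `2κ|S|`. The weights
live in `m` slots under the space-saving rule: a color without a slot takes over a slot of least
weight and keeps that weight. This preserves the certificates `Covers` (`IsUpdate.covers`,
`IsUpdate.covers_add`). If `κτ ≥ 4`, a dominating color is owed `v ≥ 2|S|/κ`; were it in no slot,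
all `m > κ²` slots would weigh at least `v`, more than the total (`HeavyInv.exists_slot`).

Verification. There are `m = O(1)` candidates. Each is counted by one more traversal and compared
with a tabulated `⌈τ * c⌉₊`, where `c` is the number of points in the box (`run_reports`,
`reported_iff`).

Bounds. A tree on `N` points has O(log^(d-1) n) height lists, O(log n) fields for each and `N + 1`
positions for each field. The color classes are disjoint, so all trees together take O(n log^d n)
cells. The time obtained is O(log^(d-1) n); the factor `(log log n)²` only weakens it. -/

namespace ColorRange

/-! ### Time-bounded program logic -/

section Logic

variable {d : ℕ} {W : ℕ} {D : Store} {a b : Fin d → ℝ}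

/-- From the state `s`, the program `c` halts within `T` steps in a state satisfying `Q`. -/
def Run (W : ℕ) (D : Store) (a b : Fin d → ℝ) (c : Cmd d) (s : State) (T : ℕ)
    (Q : State → Prop) : Prop :=
  ∃ t s', Exec W D a b c s t s' ∧ t ≤ T ∧ Q s'

theorem Run.mono {c : Cmd d} {s : State} {T T' : ℕ} {Q Q' : State → Prop}
    (h : Run W D a b c s T Q) (hT : T ≤ T') (hQ : ∀ s', Q s' → Q' s') :
    Run W D a b c s T' Q' := by
  obtain ⟨t, s', h1, h2, h3⟩ := h
  exact ⟨t, s', h1, h2.trans hT, hQ _ h3⟩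

theorem Run.seq {c₁ c₂ : Cmd d} {s : State} {T₁ T₂ : ℕ} {Q₁ Q : State → Prop}
    (h₁ : Run W D a b c₁ s T₁ Q₁) (h₂ : ∀ s', Q₁ s' → Run W D a b c₂ s' T₂ Q) :
    Run W D a b (.seq c₁ c₂) s (T₁ + T₂) Q := by
  obtain ⟨t, s', h1, h2, h3⟩ := h₁
  obtain ⟨t', s'', h1', h2', h3'⟩ := h₂ s' h3
  exact ⟨_, _, .seq h1 h1', add_le_add h2 h2', h3'⟩

theorem Run.skip {s : State} {Q : State → Prop} (h : Q s) : Run W D a b .skip s 1 Q :=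
  ⟨_, _, .skip s, le_rfl, h⟩

theorem Run.ite {β : Test d} {c₁ c₂ : Cmd d} {s : State} {T : ℕ} {Q : State → Prop}
    (h₁ : β.Holds W D a b s.mem → Run W D a b c₁ s T Q)
    (h₂ : ¬ β.Holds W D a b s.mem → Run W D a b c₂ s T Q) :
    Run W D a b (.ite β c₁ c₂) s (β.cost + T + 1) Q := by
  by_cases hβ : β.Holds W D a b s.mem
  · obtain ⟨t, s', h1, h2, h3⟩ := h₁ hβ
    exact ⟨_, _, .iteTrue hβ h1, by omega, h3⟩
  · obtain ⟨t, s', h1, h2, h3⟩ := h₂ hβ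
    exact ⟨_, _, .iteFalse hβ h1, by omega, h3⟩

/-- The index of the invariant is fuel: each pass lowers it by one and at zero the test must fail,
which bounds the number of passes. The loop may also stop early. -/
theorem Run.loop {β : Test d} {c : Cmd d} {T : ℕ} {Q : State → Prop} (I : ℕ → State → Prop)
    (hdone : ∀ n s, I n s → ¬ β.Holds W D a b s.mem → Q s)
    (hpos : ∀ s, I 0 s → ¬ β.Holds W D a b s.mem)
    (hstep : ∀ n s, I (n + 1) s → β.Holds W D a b s.mem → Run W D a b c s T (I n))
    (n : ℕ) (s : State) (h : I n s) :
    Run W D a b (.loop β c) s (n * (β.cost + 1 + T) + β.cost + 1) Q := by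
  induction n generalizing s with
  | zero => exact ⟨_, _, .loopDone (hpos s h), by omega, hdone _ _ h (hpos s h)⟩
  | succ n ih =>
    by_cases hβ : β.Holds W D a b s.mem
    · obtain ⟨t, s', h1, h2, h3⟩ := hstep n s h hβ
      obtain ⟨t', s'', h1', h2', h3'⟩ := ih s' h3
      refine ⟨_, _, .loopStep hβ h1 h1', ?_, h3'⟩
      rw [Nat.succ_mul]; omega
    · exact ⟨_, _, .loopDone hβ, by omega, hdone _ _ h hβ⟩

/-- Weakest precondition of a loop-free program. -/
def wp (W : ℕ) (D : Store) (a b : Fin d → ℝ) : Cmd d → (State → Prop) → State → Prop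
  | .skip, Q, s => Q s
  | .store addr val, Q, s => addr.eval W D s.mem < D.workCells ∧
      Q ⟨Function.update s.mem (addr.eval W D s.mem) (val.eval W D s.mem), s.out⟩
  | .emit e, Q, s => Q ⟨s.mem, e.eval W D s.mem :: s.out⟩
  | .seq c₁ c₂, Q, s => wp W D a b c₁ (wp W D a b c₂ Q) s
  | .ite β c₁ c₂, Q, s => (β.Holds W D a b s.mem → wp W D a b c₁ Q s) ∧
      (¬ β.Holds W D a b s.mem → wp W D a b c₂ Q s)
  | .loop _ _, _, _ => False

/-- Worst-case number of steps of a loop-free program. -/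
def Cmd.cost : Cmd d → ℕ
  | .skip => 1
  | .store addr val => addr.cost + val.cost + 1
  | .emit e => e.cost + 1
  | .seq c₁ c₂ => c₁.cost + c₂.cost
  | .ite β c₁ c₂ => β.cost + max c₁.cost c₂.cost + 1
  | .loop β _ => β.cost + 1

/-- The precondition of a loop is `False`, so straight-line code gets its time bound from the syntax
alone and the value of `Cmd.cost` at loops is irrelevant. -/
theorem Run.of_wp {c : Cmd d} {s : State} {Q : State → Prop} (h : wp W D a b c Q s) :
    Run W D a b c s c.cost Q := by
  induction c generalizing s Q with
  | skip => exact ⟨_, _, .skip s, le_rfl, h⟩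
  | store addr val => exact ⟨_, _, .store addr val s h.1, le_rfl, h.2⟩
  | emit e => exact ⟨_, _, .emit e s, le_rfl, h⟩
  | seq c₁ c₂ ih₁ ih₂ => exact (ih₁ h).seq fun s' h' => ih₂ h'
  | ite β c₁ c₂ ih₁ ih₂ =>
    exact Run.ite (fun hβ => (ih₁ (h.1 hβ)).mono (le_max_left _ _) fun _ => id)
      fun hβ => (ih₂ (h.2 hβ)).mono (le_max_right _ _) fun _ => id
  | loop β c ih => exact h.elim

theorem wp.mono {c : Cmd d} {s : State} {Q Q' : State → Prop} (h : wp W D a b c Q s)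
    (hQ : ∀ s', Q s' → Q' s') : wp W D a b c Q' s := by
  induction c generalizing s Q Q' with
  | skip => exact hQ _ h
  | store addr val => exact ⟨h.1, hQ _ h.2⟩
  | emit e => exact hQ _ h
  | seq c₁ c₂ ih₁ ih₂ => exact ih₁ h fun s' h' => ih₂ h' hQ
  | ite β c₁ c₂ ih₁ ih₂ => exact ⟨fun hβ => ih₁ (h.1 hβ) hQ, fun hβ => ih₂ (h.2 hβ) hQ⟩
  | loop β c ih => exact h

/-! ### Notation for programs -/

instance : Add Expr := ⟨.op .add⟩
instance : Sub Expr := ⟨.op .sub⟩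
instance : Mul Expr := ⟨.op .mul⟩
instance : Div Expr := ⟨.op .div⟩

/-- The contents of the working-memory cell `x`. -/
def var (x : ℕ) : Expr := .work (.lit x)

/-- Assignment to the working-memory cell `x`. -/
def assign (x : ℕ) (e : Expr) : Cmd d := .store (.lit x) e

/-- Sequential composition of a list of programs. -/
def block : List (Cmd d) → Cmd d
  | [] => .skip
  | c :: cs => .seq c (block cs)

theorem eval_lit {mem : ℕ → ℕ} {c : ℕ} : (Expr.lit c).eval W D mem = c % 2 ^ W := rfl

theorem eval_var {mem : ℕ → ℕ} {x : ℕ} (h : x < 2 ^ W) : (var x).eval W D mem = mem x := by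
  simp [var, Expr.eval, Nat.mod_eq_of_lt h]

theorem eval_add {mem : ℕ → ℕ} {e₁ e₂ : Expr} :
    (e₁ + e₂).eval W D mem = (e₁.eval W D mem + e₂.eval W D mem) % 2 ^ W := rfl

theorem eval_sub {mem : ℕ → ℕ} {e₁ e₂ : Expr} :
    (e₁ - e₂).eval W D mem = e₁.eval W D mem - e₂.eval W D mem := rfl

theorem eval_mul {mem : ℕ → ℕ} {e₁ e₂ : Expr} :
    (e₁ * e₂).eval W D mem = (e₁.eval W D mem * e₂.eval W D mem) % 2 ^ W := rfl

theorem eval_div {mem : ℕ → ℕ} {e₁ e₂ : Expr} :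
    (e₁ / e₂).eval W D mem = e₁.eval W D mem / e₂.eval W D mem := rfl

@[simp] theorem cost_lit {c : ℕ} : (Expr.lit c).cost = 1 := rfl

@[simp] theorem cost_var {x : ℕ} : (var x).cost = 2 := rfl

@[simp] theorem cost_add {e₁ e₂ : Expr} : (e₁ + e₂).cost = e₁.cost + e₂.cost + 1 := rfl

@[simp] theorem cost_sub {e₁ e₂ : Expr} : (e₁ - e₂).cost = e₁.cost + e₂.cost + 1 := rfl

@[simp] theorem cost_mul {e₁ e₂ : Expr} : (e₁ * e₂).cost = e₁.cost + e₂.cost + 1 := rfl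

@[simp] theorem cost_div {e₁ e₂ : Expr} : (e₁ / e₂).cost = e₁.cost + e₂.cost + 1 := rfl

@[simp] theorem cost_assign {x : ℕ} {e : Expr} : (assign x e : Cmd d).cost = e.cost + 2 := by
  simp only [assign, Cmd.cost, Expr.cost]
  omega

theorem eval_word {mem : ℕ → ℕ} {e : Expr} :
    (Expr.word e).eval W D mem = D.words.getD (e.eval W D mem) 0 := rfl

theorem eval_work {mem : ℕ → ℕ} {e : Expr} :
    (Expr.work e).eval W D mem = mem (e.eval W D mem) := rfl

theorem wp_assign {x : ℕ} {e : Expr} {s : State} {Q : State → Prop} (v : ℕ) (hx : x < 2 ^ W)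
    (hw : x < D.workCells) (hv : e.eval W D s.mem = v)
    (h : Q ⟨Function.update s.mem x v, s.out⟩) :
    wp W D a b (assign x e) Q s := by
  simp only [assign, wp, Expr.eval, Nat.mod_eq_of_lt hx, hv]
  exact ⟨hw, h⟩

theorem wp_cons {c : Cmd d} {cs : List (Cmd d)} {s : State} {Q : State → Prop}
    (h : wp W D a b c (wp W D a b (block cs) Q) s) : wp W D a b (block (c :: cs)) Q s := h

end Logic

end ColorRange

namespace ColorRange

/-! ### Blockwise sorting -/

section Sorting

open Classical in
/-- Number of indices in `[u, u + w)` that satisfy `g`. -/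
noncomputable def countIn {N : ℕ} (g : Fin N → Prop) (u w : ℕ) : ℕ :=
  (Finset.univ.filter fun i : Fin N => u ≤ i ∧ (i : ℕ) < u + w ∧ g i).card

theorem card_fin_Ico {N : ℕ} (u v : ℕ) (hv : v ≤ N) :
    (Finset.univ.filter fun i : Fin N => u ≤ i ∧ (i : ℕ) < v).card = v - u := by
  rw [← Nat.card_Ico u v]
  refine Finset.card_bij (fun i _ => (i : ℕ)) ?_ ?_ ?_
  · intro i hi
    simpa using hi
  · intro i _ j _ h
    exact Fin.ext h
  · intro x hx
    rw [Finset.mem_Ico] at hx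
    exact ⟨⟨x, by omega⟩, by simpa using hx, rfl⟩

theorem countIn_eq_of_iff {N : ℕ} {g : Fin N → Prop} {u w x : ℕ} (hx : u ≤ x) (hxw : x ≤ u + w)
    (hxN : x ≤ N) (h : ∀ i : Fin N, u ≤ i → (i : ℕ) < u + w → (g i ↔ (i : ℕ) < x)) :
    u + countIn g u w = x := by
  classical
  have : countIn g u w = x - u := by
    rw [← card_fin_Ico u x hxN, countIn]
    congr 1
    ext i
    simp only [Finset.mem_filter, Finset.mem_univ, true_and]
    constructor
    · rintro ⟨h1, h2, h3⟩
      exact ⟨h1, (h i h1 h2).1 h3⟩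
    · rintro ⟨h1, h2⟩
      exact ⟨h1, by omega, (h i h1 (by omega)).2 h2⟩
  omega

theorem countIn_le {N : ℕ} (g : Fin N → Prop) (u w : ℕ) (hu : u ≤ N) :
    u + countIn g u w ≤ min (u + w) N := by
  classical
  have : countIn g u w ≤ min (u + w) N - u := by
    rw [← card_fin_Ico u (min (u + w) N) (min_le_right _ _), countIn]
    refine Finset.card_le_card fun i => ?_
    simp only [Finset.mem_filter, Finset.mem_univ, true_and]
    rintro ⟨h1, h2, -⟩
    exact ⟨h1, lt_min h2 i.2⟩
  omega

/-- A predicate that is downward closed in a window holds exactly on an initial segment, whose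
length is then its count. This identifies ranks with results of binary search. -/
theorem lt_countIn_iff {N : ℕ} {g : Fin N → Prop} {u w : ℕ}
    (hg : ∀ i j : Fin N, u ≤ i → i ≤ j → (j : ℕ) < u + w → g j → g i)
    (i : Fin N) (h1 : u ≤ i) (h2 : (i : ℕ) < u + w) : g i ↔ (i : ℕ) < u + countIn g u w := by
  classical
  constructor
  · intro hgi
    have : (i : ℕ) + 1 - u ≤ countIn g u w := by
      rw [← card_fin_Ico u (i + 1) i.2, countIn]
      refine Finset.card_le_card fun j => ?_
      simp only [Finset.mem_filter, Finset.mem_univ, true_and]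
      rintro ⟨h3, h4⟩
      exact ⟨h3, by omega, hg j i h3 (Fin.le_def.2 (by omega)) h2 hgi⟩
    omega
  · intro hlt
    by_contra hgi
    have : countIn g u w ≤ (i : ℕ) - u := by
      rw [← card_fin_Ico u i i.2.le, countIn]
      refine Finset.card_le_card fun j => ?_
      simp only [Finset.mem_filter, Finset.mem_univ, true_and]
      rintro ⟨h3, h4, h5⟩
      refine ⟨h3, ?_⟩
      by_contra h6
      exact hgi (hg i j h1 (Fin.le_def.2 (by omega)) h4 h5)
    omega

/-- The permutation that sorts every aligned block of length `2 ^ h` by the key `f`. -/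
noncomputable def blockSort {N : ℕ} (h : ℕ) (f : Fin N → ℝ) : Equiv.Perm (Fin N) :=
  Tuple.sort fun i : Fin N => toLex ((i : ℕ) / 2 ^ h, f i)

theorem blockSort_div {N : ℕ} (h : ℕ) (f : Fin N → ℝ) (i : Fin N) :
    (blockSort h f i : ℕ) / 2 ^ h = (i : ℕ) / 2 ^ h := by
  have h1 : Monotone ((fun i : Fin N => (i : ℕ) / 2 ^ h) ∘ blockSort h f) := by
    intro i j hij
    have := Tuple.monotone_sort (fun i : Fin N => toLex ((i : ℕ) / 2 ^ h, f i)) hij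
    simp only [Function.comp, Prod.Lex.toLex_le_toLex] at this
    rcases this with h2 | h2
    · exact h2.le
    · exact h2.1.le
  have h2 : Monotone ((fun i : Fin N => (i : ℕ) / 2 ^ h) ∘ Equiv.refl (Fin N)) := by
    intro i j hij
    exact Nat.div_le_div_right hij
  -- The block number is monotone along the sorting permutation and along the identity; two monotone
  -- rearrangements of one tuple coincide.
  exact congrFun (Tuple.unique_monotone h1 h2) i

theorem blockSort_mono {N : ℕ} (h : ℕ) (f : Fin N → ℝ) {i j : Fin N} (hij : i ≤ j)
    (hd : (i : ℕ) / 2 ^ h = (j : ℕ) / 2 ^ h) : f (blockSort h f i) ≤ f (blockSort h f j) := by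
  have := Tuple.monotone_sort (fun i : Fin N => toLex ((i : ℕ) / 2 ^ h, f i)) hij
  simp only [Function.comp, Prod.Lex.toLex_le_toLex] at this
  have hi := blockSort_div h f i
  have hj := blockSort_div h f j
  unfold blockSort at hi hj ⊢
  rcases this with h2 | h2
  · omega
  · exact h2.2

theorem mem_block_iff {h u x : ℕ} (hu : 2 ^ h ∣ u) :
    (u ≤ x ∧ x < u + 2 ^ h) ↔ x / 2 ^ h = u / 2 ^ h := by
  obtain ⟨c, rfl⟩ := hu
  have hp : 0 < 2 ^ h := by positivity
  rw [Nat.mul_div_cancel_left _ hp]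
  constructor
  · rintro ⟨h1, h2⟩
    refine Nat.div_eq_of_lt_le (by rwa [mul_comm]) ?_
    rwa [add_one_mul, mul_comm]
  · rintro rfl
    have := Nat.div_add_mod x (2 ^ h)
    have := Nat.mod_lt x hp
    omega

theorem blockSort_mem_block {N : ℕ} {h u : ℕ} (f : Fin N → ℝ) (hu : 2 ^ h ∣ u) (i : Fin N) :
    (u ≤ (blockSort h f i : ℕ) ∧ (blockSort h f i : ℕ) < u + 2 ^ h) ↔
      (u ≤ (i : ℕ) ∧ (i : ℕ) < u + 2 ^ h) := by
  rw [mem_block_iff hu, mem_block_iff hu, blockSort_div]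

/-- The sorting permutation maps each aligned block onto itself, so counts over whole blocks do not
see it. -/
theorem countIn_blockSort {N : ℕ} {h u : ℕ} (f : Fin N → ℝ) (hu : 2 ^ h ∣ u)
    (g : Fin N → Prop) :
    countIn (fun i => g (blockSort h f i)) u (2 ^ h) = countIn g u (2 ^ h) := by
  classical
  unfold countIn
  refine Finset.card_bij (fun i _ => blockSort h f i) ?_ ?_ ?_
  · intro i hi
    simp only [Finset.mem_filter, Finset.mem_univ, true_and, ← and_assoc] at hi ⊢
    exact ⟨(blockSort_mem_block f hu i).2 hi.1, hi.2⟩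
  · intro i _ j _ hij
    exact (blockSort h f).injective hij
  · intro j hj
    obtain ⟨i, rfl⟩ := (blockSort h f).surjective j
    simp only [Finset.mem_filter, Finset.mem_univ, true_and, ← and_assoc] at hj
    exact ⟨i, by simpa only [Finset.mem_filter, Finset.mem_univ, true_and, ← and_assoc] using
      ⟨(blockSort_mem_block f hu i).1 hj.1, hj.2⟩, rfl⟩

/-- Among the first `x` elements in blockwise sorted order, the number of those that come from
the left half of their block. -/
noncomputable def leftRank {N : ℕ} (h : ℕ) (f : Fin N → ℝ) (x : ℕ) : ℕ :=
  (Finset.univ.filter fun i : Fin N =>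
    (i : ℕ) < x ∧ (blockSort h f i : ℕ) / 2 ^ (h - 1) % 2 = 0).card

theorem leftRank_le {N : ℕ} (h : ℕ) (f : Fin N → ℝ) (x : ℕ) : leftRank h f x ≤ N := by
  exact (Finset.card_filter_le _ _).trans (by simp)

theorem half_iff {h u x : ℕ} (hu : 2 ^ (h + 1) ∣ u) (h1 : u ≤ x) (h2 : x < u + 2 ^ (h + 1)) :
    x / 2 ^ h % 2 = 0 ↔ x < u + 2 ^ h := by
  obtain ⟨c, rfl⟩ := hu
  obtain ⟨y, rfl⟩ := Nat.exists_eq_add_of_le h1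
  have hp : 0 < 2 ^ h := by positivity
  have e : 2 ^ (h + 1) * c = 2 ^ h * (2 * c) := by ring
  rw [pow_succ] at h2
  rw [e] at *
  generalize 2 ^ h = q at *
  rw [add_comm (q * (2 * c)) y, Nat.add_mul_div_left _ _ hp, Nat.add_mul_mod_self_left]
  rcases Nat.lt_or_ge y q with h3 | h3
  · rw [Nat.div_eq_of_lt h3]; simp; omega
  · have h4 : 1 ≤ y / q := (Nat.le_div_iff_mul_le hp).2 (by omega)
    have h5 : y / q < 2 := (Nat.div_lt_iff_lt_mul hp).2 (by omega)
    have : y / q = 1 := by omega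
    rw [this]; simp; omega

/-- Fractional cascading. When `g` cuts off the positions `[u, x)` of the sorted block, the entries
there that come from the left half are precisely the elements of the left half satisfying `g`. Two
table lookups therefore turn a rank in a block into a rank in its left child. -/
theorem leftRank_sub {N : ℕ} {h u x : ℕ} (f : Fin N → ℝ) (hu : 2 ^ (h + 1) ∣ u)
    (g : Fin N → Prop) (hx : u ≤ x) (hxw : x ≤ u + 2 ^ (h + 1))
    (hg : ∀ i : Fin N, u ≤ i → (i : ℕ) < u + 2 ^ (h + 1) →
      (g (blockSort (h + 1) f i) ↔ (i : ℕ) < x)) :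
    leftRank (h + 1) f x - leftRank (h + 1) f u = countIn g u (2 ^ h) := by
  classical
  have h1 : leftRank (h + 1) f x = leftRank (h + 1) f u + (Finset.univ.filter fun i : Fin N =>
      u ≤ (i : ℕ) ∧ (i : ℕ) < x ∧ (blockSort (h + 1) f i : ℕ) / 2 ^ h % 2 = 0).card := by
    unfold leftRank
    rw [← Finset.card_union_of_disjoint]
    · congr 1
      ext i
      simp only [Finset.mem_filter, Finset.mem_univ, true_and, Finset.mem_union,
        Nat.add_sub_cancel]
      constructor
      · rintro ⟨h1, h2⟩
        rcases Nat.lt_or_ge i u with h3 | h3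
        · exact .inl ⟨h3, h2⟩
        · exact .inr ⟨h3, h1, h2⟩
      · rintro (⟨h1, h2⟩ | ⟨h1, h2, h3⟩)
        · exact ⟨by omega, h2⟩
        · exact ⟨h2, h3⟩
    · rw [Finset.disjoint_filter]
      rintro i - ⟨h1, -⟩ ⟨h2, -⟩
      omega
  rw [h1, Nat.add_sub_cancel_left, countIn]
  refine Finset.card_bij (fun i _ => blockSort (h + 1) f i) ?_ ?_ ?_
  · intro i hi
    simp only [Finset.mem_filter, Finset.mem_univ, true_and] at hi ⊢
    have h2 := (blockSort_mem_block f hu i).2 ⟨hi.1, by omega⟩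
    exact ⟨h2.1, (half_iff hu h2.1 h2.2).1 hi.2.2, (hg i hi.1 (by omega)).2 hi.2.1⟩
  · intro i _ j _ hij
    exact (blockSort (h + 1) f).injective hij
  · intro j hj
    obtain ⟨i, rfl⟩ := (blockSort (h + 1) f).surjective j
    simp only [Finset.mem_filter, Finset.mem_univ, true_and] at hj
    have h3 : (blockSort (h + 1) f i : ℕ) < u + 2 ^ (h + 1) := by
      have := hj.2.1
      rw [pow_succ]; omega
    have h2 := (blockSort_mem_block f hu i).1 ⟨hj.1, h3⟩
    refine ⟨i, ?_, rfl⟩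
    simp only [Finset.mem_filter, Finset.mem_univ, true_and]
    exact ⟨h2.1, (hg i h2.1 h2.2).1 hj.2.2, (half_iff hu hj.1 h3).2 hj.2.1⟩

theorem countIn_add {N : ℕ} (g : Fin N → Prop) (u w v : ℕ) :
    countIn g u (w + v) = countIn g u w + countIn g (u + w) v := by
  classical
  unfold countIn
  rw [← Finset.card_union_of_disjoint]
  · congr 1
    ext i
    simp only [Finset.mem_filter, Finset.mem_univ, true_and, Finset.mem_union]
    constructor
    · rintro ⟨h1, h2, h3⟩
      rcases Nat.lt_or_ge i (u + w) with h4 | h4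
      · exact .inl ⟨h1, h4, h3⟩
      · exact .inr ⟨h4, by omega, h3⟩
    · rintro (⟨h1, h2, h3⟩ | ⟨h1, h2, h3⟩)
      · exact ⟨h1, by omega, h3⟩
      · exact ⟨by omega, by omega, h3⟩
  · rw [Finset.disjoint_filter]
    rintro i - ⟨h1, h2, -⟩ ⟨h3, -⟩
    omega

end Sorting

/-! ### The multilevel orders of a range tree -/

section Orders

variable {N : ℕ} (X : Fin N → ℕ → ℝ)

/-- The order of the points on the list of levels `t`. -/
noncomputable def ord : List ℕ → Equiv.Perm (Fin N)
  | [] => Tuple.sort fun i => X i 0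
  | h :: t => (blockSort h fun i => X (ord t i) (t.length + 1)).trans (ord t)

/-- The key by which the blocks of the order `ord X t` are to be sorted. -/
noncomputable def key (t : List ℕ) (i : Fin N) : ℝ := X (ord X t i) (t.length + 1)

theorem ord_cons (h : ℕ) (t : List ℕ) (i : Fin N) :
    ord X (h :: t) i = ord X t (blockSort h (key X t) i) := rfl

theorem ord_cons_symm (h : ℕ) (t : List ℕ) (k : Fin N) :
    blockSort h (key X t) ((ord X (h :: t)).symm k) = (ord X t).symm k := by
  rw [← (ord X t).injective.eq_iff, ← ord_cons, Equiv.apply_symm_apply, Equiv.apply_symm_apply]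

variable (d : ℕ) (A B : ℕ → ℝ)

open Classical in
/-- The points with position in `I` for the order `ord X t` whose coordinates of index greater
than the length of `t` lie between `A` and `B`. -/
noncomputable def slab (t : List ℕ) (I : Set ℕ) : Finset (Fin N) :=
  Finset.univ.filter fun k => (((ord X t).symm k : Fin N) : ℕ) ∈ I ∧
    ∀ j, t.length < j → j < d → A j ≤ X k j ∧ X k j ≤ B j

variable {X d A B}

theorem mem_slab {t : List ℕ} {I : Set ℕ} {k : Fin N} :
    k ∈ slab X d A B t I ↔ (((ord X t).symm k : Fin N) : ℕ) ∈ I ∧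
      ∀ j, t.length < j → j < d → A j ≤ X k j ∧ X k j ≤ B j := by
  simp [slab]

theorem slab_union (t : List ℕ) (I J : Set ℕ) [DecidableEq (Fin N)] :
    slab X d A B t (I ∪ J) = slab X d A B t I ∪ slab X d A B t J := by
  ext k
  simp only [Finset.mem_union, mem_slab, Set.mem_union]
  tauto

theorem slab_mono (t : List ℕ) {I J : Set ℕ} (h : I ⊆ J) :
    slab X d A B t I ⊆ slab X d A B t J := by
  intro k
  simp only [mem_slab]
  exact fun h' => ⟨h h'.1, h'.2⟩

theorem slab_disjoint (t : List ℕ) {I J : Set ℕ} (h : Disjoint I J) :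
    Disjoint (slab X d A B t I) (slab X d A B t J) := by
  rw [Finset.disjoint_left]
  intro k
  simp only [mem_slab]
  exact fun h1 h2 => Set.disjoint_left.1 h h1.1 h2.1

theorem slab_empty (t : List ℕ) : slab X d A B t ∅ = ∅ := by
  ext k; simp [mem_slab]

/-- Within one block the sorted keys increase, so the condition cuts off a prefix. The count is
taken before sorting, which makes it comparable between a block and its halves. -/
theorem key_cons_lt_iff (h : ℕ) (t : List ℕ) {u : ℕ} (hu : 2 ^ h ∣ u) (α : ℝ) (i : Fin N)
    (h1 : u ≤ i) (h2 : (i : ℕ) < u + 2 ^ h) :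
    key X t (blockSort h (key X t) i) < α ↔
      (i : ℕ) < u + countIn (fun i => key X t i < α) u (2 ^ h) := by
  rw [← countIn_blockSort (key X t) hu]
  refine lt_countIn_iff (g := fun i => key X t (blockSort h (key X t) i) < α) ?_ i h1 h2
  intro i j h3 h4 h5 h6
  refine lt_of_le_of_lt (blockSort_mono h (key X t) h4 ?_) h6
  rw [(mem_block_iff hu).1 ⟨h3, lt_of_le_of_lt h4 h5⟩, (mem_block_iff hu).1 ⟨h3.trans h4, h5⟩]

theorem key_cons_le_iff (h : ℕ) (t : List ℕ) {u : ℕ} (hu : 2 ^ h ∣ u) (α : ℝ) (i : Fin N)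
    (h1 : u ≤ i) (h2 : (i : ℕ) < u + 2 ^ h) :
    key X t (blockSort h (key X t) i) ≤ α ↔
      (i : ℕ) < u + countIn (fun i => key X t i ≤ α) u (2 ^ h) := by
  rw [← countIn_blockSort (key X t) hu]
  refine lt_countIn_iff (g := fun i => key X t (blockSort h (key X t) i) ≤ α) ?_ i h1 h2
  intro i j h3 h4 h5 h6
  refine le_trans (blockSort_mono h (key X t) h4 ?_) h6
  rw [(mem_block_iff hu).1 ⟨h3, lt_of_le_of_lt h4 h5⟩, (mem_block_iff hu).1 ⟨h3.trans h4, h5⟩]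

/-- First position of the block at `u` whose key is at least `A`. -/
noncomputable def rankLo (X : Fin N → ℕ → ℝ) (A : ℕ → ℝ) (t : List ℕ) (u h : ℕ) : ℕ :=
  u + countIn (fun i => key X t i < A (t.length + 1)) u (2 ^ h)

/-- First position of the block at `u` whose key is greater than `B`. -/
noncomputable def rankHi (X : Fin N → ℕ → ℝ) (B : ℕ → ℝ) (t : List ℕ) (u h : ℕ) : ℕ :=
  u + countIn (fun i => key X t i ≤ B (t.length + 1)) u (2 ^ h)

/-- The recursion of range trees: in the resorted block, the constraint on coordinate `t.length + 1`
becomes an interval of positions, and one fewer coordinate remains to be checked. -/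
theorem slab_cons (h : ℕ) (t : List ℕ) {u : ℕ} (hu : 2 ^ h ∣ u) (hd : t.length + 1 < d) :
    slab X d A B (h :: t) (Set.Ico (rankLo X A t u h) (rankHi X B t u h)) =
      slab X d A B t (Set.Ico u (u + 2 ^ h)) := by
  ext k
  have h0 := ord_cons_symm X h t k
  set i := (ord X (h :: t)).symm k with hi
  have hk : ord X t (blockSort h (key X t) i) = k := by rw [h0, Equiv.apply_symm_apply]
  have hkey : key X t (blockSort h (key X t) i) = X k (t.length + 1) := by rw [key, hk]
  simp only [mem_slab, Set.mem_Ico, ← hi, ← h0, List.length_cons]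
  rw [blockSort_mem_block _ hu]
  -- Separates the coordinate by which the block is now sorted from the later ones.
  have e : (∀ j, t.length < j → j < d → A j ≤ X k j ∧ X k j ≤ B j) ↔
      (A (t.length + 1) ≤ X k (t.length + 1) ∧ X k (t.length + 1) ≤ B (t.length + 1)) ∧
      ∀ j, t.length + 1 < j → j < d → A j ≤ X k j ∧ X k j ≤ B j := by
    constructor
    · exact fun h => ⟨h _ (by omega) hd, fun j h1 h2 => h j (by omega) h2⟩
    · rintro ⟨h1, h2⟩ j h3 h4
      rcases Nat.lt_or_ge (t.length + 1) j with h5 | h5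
      · exact h2 j h5 h4
      · obtain rfl : j = t.length + 1 := by omega
        exact h1
  rw [e, ← and_assoc]
  refine and_congr ?_ Iff.rfl
  constructor
  · rintro ⟨h1, h2⟩
    have hb : u ≤ i ∧ (i : ℕ) < u + 2 ^ h := by
      refine ⟨(Nat.le_add_right _ _).trans h1, h2.trans_le ?_⟩
      rcases Nat.lt_or_ge N u with h3 | h3
      · have := i.2
        have := (Nat.le_add_right _ _).trans h1
        omega
      · exact (countIn_le _ _ _ h3).trans (min_le_left _ _)
    refine ⟨hb, ?_, ?_⟩
    · rw [← hkey, ← not_lt, key_cons_lt_iff h t hu _ i hb.1 hb.2]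
      exact not_lt.2 h1
    · rw [← hkey, key_cons_le_iff h t hu _ i hb.1 hb.2]
      exact h2
  · rintro ⟨hb, h1, h2⟩
    rw [← hkey, ← not_lt, key_cons_lt_iff h t hu _ i hb.1 hb.2] at h1
    rw [← hkey, key_cons_le_iff h t hu _ i hb.1 hb.2] at h2
    exact ⟨not_lt.1 h1, h2⟩

theorem root_lt_iff (α : ℝ) (h : ℕ) (i : Fin N) (h2 : (i : ℕ) < 2 ^ h) :
    X (ord X [] i) 0 < α ↔
      (i : ℕ) < countIn (fun i => X (ord X [] i) 0 < α) 0 (2 ^ h) := by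
  have := lt_countIn_iff (g := fun i => X (ord X [] i) 0 < α) (u := 0) (w := 2 ^ h)
    (fun i j _ h4 _ h6 => (Tuple.monotone_sort (fun i => X i 0) h4).trans_lt h6) i (Nat.zero_le _)
    (by omega)
  simpa using this

theorem root_le_iff (α : ℝ) (h : ℕ) (i : Fin N) (h2 : (i : ℕ) < 2 ^ h) :
    X (ord X [] i) 0 ≤ α ↔
      (i : ℕ) < countIn (fun i => X (ord X [] i) 0 ≤ α) 0 (2 ^ h) := by
  have := lt_countIn_iff (g := fun i => X (ord X [] i) 0 ≤ α) (u := 0) (w := 2 ^ h)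
    (fun i j _ h4 _ h6 => (Tuple.monotone_sort (fun i => X i 0) h4).trans h6) i (Nat.zero_le _)
    (by omega)
  simpa using this

/-- Base of the recursion: `ord X []` is sorted by coordinate 0 and a single block of length `2 ^ h`
contains all positions. -/
theorem mem_slab_root (h : ℕ) (hN : N ≤ 2 ^ h) (hd : 0 < d) (k : Fin N) :
    k ∈ slab X d A B [] (Set.Ico (countIn (fun i => X (ord X [] i) 0 < A 0) 0 (2 ^ h))
      (countIn (fun i => X (ord X [] i) 0 ≤ B 0) 0 (2 ^ h))) ↔
      ∀ j < d, A j ≤ X k j ∧ X k j ≤ B j := by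
  have hi := ((ord X []).symm k).2.trans_le hN
  rw [mem_slab, Set.mem_Ico, ← root_le_iff _ h _ hi, ← not_lt, ← root_lt_iff _ h _ hi, not_lt,
    Equiv.apply_symm_apply]
  constructor
  · rintro ⟨h1, h2⟩ j hj
    rcases Nat.eq_zero_or_pos j with rfl | h3
    · exact h1
    · exact h2 j h3 hj
  · exact fun h => ⟨h 0 hd, fun j _ hj => h j hj⟩

theorem rankLo_step (t : List ℕ) {u h : ℕ} (hu : 2 ^ (h + 1) ∣ u) (huN : u ≤ N) :
    u + (leftRank (h + 1) (key X t) (rankLo X A t u (h + 1)) - leftRank (h + 1) (key X t) u) =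
      rankLo X A t u h := by
  rw [leftRank_sub (key X t) hu (fun i => key X t i < A (t.length + 1))]
  · rfl
  · exact Nat.le_add_right _ _
  · exact (countIn_le _ _ _ huN).trans (min_le_left _ _)
  · intro i h1 h2
    exact key_cons_lt_iff _ t hu _ i h1 h2

theorem rankHi_step (t : List ℕ) {u h : ℕ} (hu : 2 ^ (h + 1) ∣ u) (huN : u ≤ N) :
    u + (leftRank (h + 1) (key X t) (rankHi X B t u (h + 1)) - leftRank (h + 1) (key X t) u) =
      rankHi X B t u h := by
  rw [leftRank_sub (key X t) hu (fun i => key X t i ≤ B (t.length + 1))]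
  · rfl
  · exact Nat.le_add_right _ _
  · exact (countIn_le _ _ _ huN).trans (min_le_left _ _)
  · intro i h1 h2
    exact key_cons_le_iff _ t hu _ i h1 h2

/-- Counts over the two halves add up to the count over the block, so the right child needs no table
of its own. -/
theorem rankLo_right (t : List ℕ) (u h : ℕ) :
    rankLo X A t (u + 2 ^ h) h = u + 2 ^ h + rankLo X A t u (h + 1) - rankLo X A t u h := by
  have := countIn_add (fun i => key X t i < A (t.length + 1)) u (2 ^ h) (2 ^ h)
  rw [← two_mul, ← pow_succ'] at this
  have hp : 0 < 2 ^ h := by positivity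
  unfold rankLo
  generalize 2 ^ h = q at *
  omega

theorem rankHi_right (t : List ℕ) (u h : ℕ) :
    rankHi X B t (u + 2 ^ h) h = u + 2 ^ h + rankHi X B t u (h + 1) - rankHi X B t u h := by
  have := countIn_add (fun i => key X t i ≤ B (t.length + 1)) u (2 ^ h) (2 ^ h)
  rw [← two_mul, ← pow_succ'] at this
  have hp : 0 < 2 ^ h := by positivity
  unfold rankHi
  generalize 2 ^ h = q at *
  omega

end Orders

/-! ### Decomposition of an interval into dyadic blocks -/

section Dyadic

/-- The positions covered by the walk from the block `[u, u + 2 ^ h)` to the position `x`: the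
siblings of the path that lie strictly between `l` and `r - 1`, and `x` itself. -/
def walkSet (l r x : ℕ) : ℕ → ℕ → Set ℕ
  | u, 0 => Set.Ico u (u + 1)
  | u, h + 1 =>
    if x < u + 2 ^ h then
      (if l < u + 2 ^ h ∧ u + 2 ^ h + 2 ^ h < r then Set.Ico (u + 2 ^ h) (u + 2 ^ h + 2 ^ h)
        else ∅) ∪ walkSet l r x u h
    else
      (if l < u ∧ u + 2 ^ h < r then Set.Ico u (u + 2 ^ h) else ∅) ∪
        walkSet l r x (u + 2 ^ h) h

/-- The position that separates the paths to `l` and `r - 1`. -/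
def separator (l r : ℕ) : ℕ → ℕ → ℕ
  | u, 0 => u + 1
  | u, h + 1 =>
    if r ≤ u + 2 ^ h then separator l r u h
    else if u + 2 ^ h ≤ l then separator l r (u + 2 ^ h) h
    else u + 2 ^ h

theorem walkSet_subset (l r x : ℕ) (u h : ℕ) : walkSet l r x u h ⊆ Set.Ico u (u + 2 ^ h) := by
  induction h generalizing u with
  | zero => simp [walkSet]
  | succ h ih =>
    intro y hy
    have h1 := @ih u y
    have h2 := @ih (u + 2 ^ h) y
    rw [pow_succ]
    simp only [Set.mem_Ico] at h1 h2 ⊢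
    simp only [walkSet] at hy
    have hp : 0 < 2 ^ h := by positivity
    split_ifs at hy <;> rcases hy with hy | hy <;> try simp only [Set.mem_Ico] at hy
    all_goals first
      | exact hy.elim
      | (have := h1 hy; omega)
      | (have := h2 hy; omega)
      | omega

/-- Below the separating node every right sibling lies strictly inside the interval, and these
siblings fill the gap up to the separator. The case of `r` beyond the block is included because the
induction enters halves that end before `r`. -/
theorem walkSet_left (l r : ℕ) (hlr : l < r) (u h : ℕ) (h1 : u ≤ l) (h2 : l < u + 2 ^ h) :
    walkSet l r l u h = Set.Ico l (if r ≤ u + 2 ^ h then separator l r u h else u + 2 ^ h) := by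
  induction h generalizing u with
  | zero =>
    obtain rfl : u = l := by simp at h2; omega
    simp [walkSet, separator]
  | succ h ih =>
    have e : 2 ^ (h + 1) = 2 ^ h + 2 ^ h := by ring
    rw [e] at h2 ⊢
    have hp : 0 < 2 ^ h := by positivity
    simp only [walkSet, separator]
    rcases Nat.lt_or_ge l (u + 2 ^ h) with h3 | h3
    · rw [if_pos h3, ih u h1 h3]
      ext y
      split_ifs <;> simp <;> omega
    · rw [if_neg (by omega), ih _ h3 (by omega), if_neg (show ¬(l < u ∧ u + 2 ^ h < r) by omega),
        Set.empty_union, ← add_assoc]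
      split_ifs
      · omega
      · rfl
      · rfl

/-- Mirror image of `walkSet_left`: here the induction needs blocks that begin after `l`, which the
walk fills from their start. -/
theorem walkSet_right (l r : ℕ) (hlr : l + 1 < r) (u h : ℕ) (h1 : u < r)
    (h2 : r ≤ u + 2 ^ h) (hl : l < u + 2 ^ h) :
    walkSet l r (r - 1) u h = Set.Ico (if l < u then u else separator l r u h) r := by
  induction h generalizing u with
  | zero =>
    obtain rfl : r = u + 1 := by simp at h2; omega
    have : l < u := by simpa using hlr
    simp [walkSet, this]
  | succ h ih =>
    have e : 2 ^ (h + 1) = 2 ^ h + 2 ^ h := by ring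
    rw [e] at h2 hl
    have hp : 0 < 2 ^ h := by positivity
    simp only [walkSet, separator]
    rcases Nat.lt_or_ge (u + 2 ^ h) r with h3 | h3
    · rw [if_neg (by omega), ih (u + 2 ^ h) h3 (by omega) (by omega)]
      ext y
      split_ifs <;> simp <;> omega
    · rw [if_pos (by omega), ih _ h1 h3 (by omega), if_neg (by omega), Set.empty_union, if_pos h3]

theorem separator_bounds (l r : ℕ) (hlr : l + 1 < r) (u h : ℕ) (h1 : u ≤ l)
    (h2 : r ≤ u + 2 ^ h) : l < separator l r u h ∧ separator l r u h < r := by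
  induction h generalizing u with
  | zero => simp at h2; omega
  | succ h ih =>
    have e : 2 ^ (h + 1) = 2 ^ h + 2 ^ h := by ring
    rw [e] at h2
    simp only [separator]
    split_ifs with h3 h4
    · exact ih u h1 h3
    · exact ih _ h4 (by omega)
    · omega

/-- For an interval of length one both ends have the same path, so a single walk must suffice; the
separator is then `l + 1`. -/
theorem walkSet_left_single (l u h : ℕ) (h1 : u ≤ l) (h2 : l < u + 2 ^ h) :
    walkSet l (l + 1) l u h = Set.Ico l (l + 1) := by
  rw [walkSet_left l (l + 1) (by omega) u h h1 h2, if_pos (by omega)]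
  congr 1
  induction h generalizing u with
  | zero => simp at h2; simp [separator]; omega
  | succ h ih =>
    have e : 2 ^ (h + 1) = 2 ^ h + 2 ^ h := by ring
    rw [e] at h2
    simp only [separator]
    split_ifs with h3 h4
    · exact ih u h1 (by omega)
    · exact ih _ h4 (by omega)
    · omega

/-- The two walks meet exactly at the separator. Disjointness is what allows counts and weights to
be added without correction. -/
theorem walkSet_union (l r : ℕ) (hlr : l + 1 < r) (u h : ℕ) (h1 : u ≤ l)
    (h2 : r ≤ u + 2 ^ h) :
    walkSet l r l u h ∪ walkSet l r (r - 1) u h = Set.Ico l r ∧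
      Disjoint (walkSet l r l u h) (walkSet l r (r - 1) u h) := by
  have h3 := separator_bounds l r hlr u h h1 h2
  rw [walkSet_left l r (by omega) u h h1 (by omega), if_pos h2,
    walkSet_right l r hlr u h (by omega) h2 (by omega), if_neg (by omega)]
  refine ⟨Set.Ico_union_Ico_eq_Ico h3.1.le h3.2.le, ?_⟩
  rw [Set.disjoint_left]
  intro y
  simp only [Set.mem_Ico]
  omega

end Dyadic

end ColorRange

namespace ColorRange

/-! ### Range trees as word tables -/

/-- Code of a list of levels. -/
def code (K : ℕ) : List ℕ → ℕ
  | [] => 0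
  | h :: t => code K t * K + h + 1

theorem code_lt {K : ℕ} {t : List ℕ} (ht : ∀ h ∈ t, h < K) {j : ℕ} (hj : t.length ≤ j) :
    code K t < (K + 1) ^ j := by
  -- The summand 1 makes the induction close: `code` writes the heights as digits from 1 to `K`.
  have : code K t + 1 ≤ (K + 1) ^ t.length := by
    clear hj
    induction t with
    | nil => simp [code]
    | cons h t ih =>
      have h1 := ih fun x hx => ht x (List.mem_cons_of_mem _ hx)
      have h2 := ht h List.mem_cons_self
      rw [code, List.length_cons, pow_succ]
      nlinarith
  exact lt_of_lt_of_le this (Nat.pow_le_pow_right (by omega) hj)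

open Classical in
/-- Number of points of color `c` with position in `[x, x + w)` in the order `ord X t`. -/
noncomputable def windowCount {N : ℕ} (X : Fin N → ℕ → ℝ) (C : Fin N → ℕ) (t : List ℕ)
    (x w c : ℕ) : ℕ :=
  countIn (fun i => C (ord X t i) = c) x w

open Classical in
/-- The colors with at least `2 ^ g / κ` points among the `2 ^ g` positions from `x` on. -/
noncomputable def heavyColors {N : ℕ} (κ : ℕ) (X : Fin N → ℕ → ℝ) (C : Fin N → ℕ) (t : List ℕ)
    (g x : ℕ) : Finset ℕ :=
  (Finset.univ.image C).filter fun c => 2 ^ g ≤ κ * windowCount X C t x (2 ^ g) c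

/-- Contents of the tables of a range tree. -/
noncomputable def fieldVal {N : ℕ} (κ : ℕ) (X : Fin N → ℕ → ℝ) (idx C : Fin N → ℕ) (t : List ℕ)
    (f x : ℕ) : ℕ :=
  match f with
  | 0 => if h : x < N then idx (ord X t ⟨x, h⟩) else 0
  | 1 => match t with
    | [] => 0
    | h :: t => leftRank h (key X t) x
  | 2 => Nat.log 2 x
  | 3 => 2 ^ Nat.log 2 x
  | f + 4 => (heavyColors κ X C t (f / κ) x).toList.getD (f % κ) 0

/-- The store `D` contains at the address `B` the tables of the range tree for the points `X`
with names `idx` and colors `C`. -/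
structure IsTree (d W : ℕ) (D : Store) (κ K : ℕ) {N : ℕ} (B : ℕ) (X : Fin N → ℕ → ℝ)
    (idx C : Fin N → ℕ) : Prop where
  field : ∀ t f x, (∀ h ∈ t, h < K) → t.length < d → f < 4 + κ * K → x ≤ N →
    D.words.getD (B + ((code K t * (4 + κ * K) + f) * (N + 1) + x)) 0 = fieldVal κ X idx C t f x
  bound : B + (K + 1) ^ (d - 1) * (4 + κ * K) * (N + 1) < 2 ^ W
  coord : ∀ k j, j < d → idx k * d + j < 2 ^ W ∧ D.coords.getD (idx k * d + j) 0 = X k j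
  pos : 0 < K
  le : N ≤ 2 ^ (K - 1)
  size : N + 2 ^ K < 2 ^ W

/-- The cell at position `x` of the table `f` for the node code `e`. -/
def fieldExpr (κ : ℕ) (e f x : Expr) : Expr :=
  .word (var 0 + ((e * (.lit 4 + .lit κ * var 2) + f) * (var 1 + .lit 1) + x))

/-- The tree registers. -/
def TreeRegs (mem : ℕ → ℕ) (B N K : ℕ) : Prop := mem 0 = B ∧ mem 1 = N ∧ mem 2 = K

section

variable {d W : ℕ} {D : Store} {κ K N B : ℕ} {X : Fin N → ℕ → ℝ} {idx C : Fin N → ℕ}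

theorem IsTree.code_lt (h : IsTree d W D κ K B X idx C) {t : List ℕ} (ht : ∀ h ∈ t, h < K)
    (hd : t.length < d) : code K t < 2 ^ W := by
  have h1 := ColorRange.code_lt ht (Nat.le_sub_one_of_lt hd)
  have h2 := h.bound
  have : (K + 1) ^ (d - 1) * 1 * 1 ≤ (K + 1) ^ (d - 1) * (4 + κ * K) * (N + 1) := by
    gcongr <;> omega
  omega

/-- The only issue is overflow: every intermediate value of the address computation is bounded by
the end of the tree's table, hence is below `2 ^ W`. -/
theorem eval_field (h : IsTree d W D κ K B X idx C) {mem : ℕ → ℕ} (hm : TreeRegs mem B N K)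
    (hκ : κ + 8 < 2 ^ W) {e f x : Expr} {t : List ℕ} {fv xv : ℕ}
    (he : e.eval W D mem = code K t) (hf : f.eval W D mem = fv) (hx : x.eval W D mem = xv)
    (ht : ∀ h ∈ t, h < K) (hd : t.length < d) (hfv : fv < 4 + κ * K) (hxv : xv ≤ N) :
    (fieldExpr κ e f x).eval W D mem = fieldVal κ X idx C t fv xv := by
  rw [← h.field t fv xv ht hd hfv hxv]
  have h1 := ColorRange.code_lt ht (Nat.le_sub_one_of_lt hd)
  have h2 := h.bound
  have h3 : (code K t + 1) * (4 + κ * K) * (N + 1) ≤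
      (K + 1) ^ (d - 1) * (4 + κ * K) * (N + 1) := by gcongr; omega
  have h4 : 1 * (4 + κ * K) * 1 ≤ (code K t + 1) * (4 + κ * K) * (N + 1) := by
    gcongr <;> omega
  have h5 : (code K t * (4 + κ * K) + fv) * (N + 1) + xv <
      (code K t + 1) * (4 + κ * K) * (N + 1) := by
    have : (code K t * (4 + κ * K) + fv + 1) * (N + 1) ≤
        (code K t + 1) * (4 + κ * K) * (N + 1) := by
      gcongr; rw [add_one_mul]; omega
    rw [add_one_mul] at this
    omega
  have h6 : (code K t * (4 + κ * K) + fv) * 1 ≤ (code K t * (4 + κ * K) + fv) * (N + 1) := by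
    gcongr; omega
  have h7 := h.size
  have h8 := Nat.two_pow_pos K
  obtain ⟨hm0, hm1, hm2⟩ := hm
  rw [fieldExpr, eval_word]
  congr 1
  simp (disch := omega) only [eval_add, eval_mul, eval_lit, eval_var, he, hf, hx, hm0, hm1, hm2,
    Nat.mod_eq_of_lt]

end

end ColorRange

namespace ColorRange

/-! ### Binary search -/

section Search

variable {d : ℕ}

/-- Binary search: the first position from `mem (o + 1)` on, before `mem (o + 1) + mem (o + 2)`
and before the end of the order, for which the test fails. -/
def search (o dst : ℕ) (test : Test d) : Cmd d :=
  .seq (block [assign dst (var (o + 1)),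
      .ite (.lt (var (o + 1) + var (o + 2)) (var 1))
        (assign (o + 12) (var (o + 1) + var (o + 2))) (assign (o + 12) (var 1))])
    (.loop (.lt (var dst) (var (o + 12)))
      (block [assign (o + 13) ((var dst + var (o + 12)) / .lit 2),
        .ite test (assign dst (var (o + 13) + .lit 1)) (assign (o + 12) (var (o + 13)))]))

variable {W : ℕ} {D : Store} {a b : Fin d → ℝ} {N : ℕ}

theorem run_search {o dst u w k : ℕ} {test : Test d} {g : Fin N → Prop} {s : State}
    (ho : 3 ≤ o) (hd1 : o + 2 < dst) (hd2 : dst < o + 12)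
    (hoW : o + 32 ≤ 2 ^ W) (hoD : o + 32 ≤ D.workCells)
    (hN : s.mem 1 = N) (hu : s.mem (o + 1) = u) (hw : s.mem (o + 2) = w)
    (huN : u ≤ N) (huw : N + u + w + 2 < 2 ^ W) (hwk : w < 2 ^ k)
    (hg : ∀ i j : Fin N, u ≤ i → i ≤ j → (j : ℕ) < u + w → g j → g i)
    (htest : ∀ m : ℕ → ℕ, (∀ x, x ≠ dst → x ≠ o + 12 → x ≠ o + 13 → m x = s.mem x) →
      ∀ i : Fin N, u ≤ i → (i : ℕ) < u + w → m (o + 13) = i → (test.Holds W D a b m ↔ g i)) :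
    Run W D a b (search o dst test) s (k * (test.cost + 28) + 28) (fun s' =>
      s'.out = s.out ∧ (∀ x, x ≠ dst → x ≠ o + 12 → x ≠ o + 13 → s'.mem x = s.mem x) ∧
        s'.mem dst = u + countIn g u w) := by
  -- Everything before `lo` satisfies `g`, nothing from `hi` on does, and the gap is below `2 ^ n`.
  -- Thus `n` is the number of halvings still allowed, and at `n = 0` the gap is empty.
  let I : ℕ → State → Prop := fun n s' =>
    s'.out = s.out ∧ (∀ x, x ≠ dst → x ≠ o + 12 → x ≠ o + 13 → s'.mem x = s.mem x) ∧
      ∃ lo hi, s'.mem dst = lo ∧ s'.mem (o + 12) = hi ∧ u ≤ lo ∧ lo ≤ hi ∧ hi ≤ min (u + w) N ∧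
        hi - lo < 2 ^ n ∧ ∀ i : Fin N, u ≤ i → (i : ℕ) < u + w →
          ((i : ℕ) < lo → g i) ∧ (hi ≤ i → ¬ g i)
  have hinit : Run W D a b (block [assign dst (var (o + 1)),
      .ite (.lt (var (o + 1) + var (o + 2)) (var 1))
        (assign (o + 12) (var (o + 1) + var (o + 2))) (assign (o + 12) (var 1))]) s 22 (I k) := by
    refine (Run.of_wp (Q := I k) ?_).mono (T' := 22) (by simp [Cmd.cost, block, Test.cost]) fun _ => id
    have h1 : (var (o + 1) + var (o + 2)).eval W D (Function.update s.mem dst u) = u + w := by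
      simp (disch := omega) only [eval_add, eval_var, Function.update_of_ne, hu, hw,
        Nat.mod_eq_of_lt]
    have h2 : (var 1).eval W D (Function.update s.mem dst u) = N := by
      simp (disch := omega) only [eval_var, Function.update_of_ne, hN]
    have key : ∀ hi, hi = min (u + w) N →
        I k ⟨Function.update (Function.update s.mem dst u) (o + 12) hi, s.out⟩ := by
      intro hi hhi
      refine ⟨rfl, ?_, u, hi, ?_, ?_, le_rfl, by omega, by omega, by omega, ?_⟩
      · intro x h1 h2 _
        simp only [Function.update_of_ne h1, Function.update_of_ne h2]
      · simp (disch := omega) only [Function.update_of_ne, Function.update_self]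
      · simp only [Function.update_self]
      · intro i h1 h2
        have := i.2
        omega
    refine wp_cons (wp_assign u (by omega) (by omega) ?_ ?_)
    · rw [eval_var (by omega), hu]
    refine wp_cons ⟨fun h => ?_, fun h => ?_⟩
    · simp only [Test.Holds, h1, h2] at h
      exact wp_assign (u + w) (by omega) (by omega) h1 (key _ (by omega))
    · simp only [Test.Holds, h1, h2] at h
      exact wp_assign N (by omega) (by omega) h2 (key _ (by omega))
  have hc : ∀ m, (Test.lt (var dst) (var (o + 12)) : Test d).Holds W D a b m ↔
      m dst < m (o + 12) := by
    intro m
    simp only [Test.Holds, eval_var (show dst < 2 ^ W by omega),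
      eval_var (show o + 12 < 2 ^ W by omega)]
  refine (hinit.seq (T₂ := k * (test.cost + 28) + 6) ?_).mono (by omega) fun _ => id
  intro s₁ hs₁
  refine (Run.loop (T := test.cost + 22) I ?_ ?_ ?_ k s₁ hs₁).mono ?_ fun _ => id
  · rintro n s' ⟨h1, h2, lo, hi, h3, h4, h5, h6, h7, h8, h9⟩ hβ
    rw [hc] at hβ
    refine ⟨h1, h2, ?_⟩
    obtain rfl : hi = lo := by omega
    rw [h3]
    refine (countIn_eq_of_iff h5 (by omega) (by omega) fun i h10 h11 => ?_).symm
    have := h9 i h10 h11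
    constructor
    · intro hgi
      by_contra hlt
      exact this.2 (by omega) hgi
    · exact this.1
  · rintro s' ⟨h1, h2, lo, hi, h3, h4, h5, h6, h7, h8, h9⟩
    rw [hc]
    simp at h8
    omega
  · rintro n s' ⟨h1, h2, lo, hi, h3, h4, h5, h6, h7, h8, h9⟩ hβ
    rw [hc] at hβ
    have hlt : lo < hi := by omega
    let i : Fin N := ⟨(lo + hi) / 2, by omega⟩
    have hi1 : (i : ℕ) = (lo + hi) / 2 := rfl
    refine (Run.of_wp (Q := I n) ?_).mono ?_ fun _ => id
    · refine wp_cons (wp_assign i (by omega) (by omega) ?_ ?_)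
      · simp (disch := omega) only [eval_div, eval_add, eval_var, eval_lit, h3, h4,
          Nat.mod_eq_of_lt, hi1]
      have ht := htest (Function.update s'.mem (o + 13) i) (by
        intro x h10 h11 h12
        rw [Function.update_of_ne h12, h2 x h10 h11 h12]) i (by omega) (by omega)
        (by rw [Function.update_self])
      rw [pow_succ] at h8
      refine wp_cons ⟨fun h => ?_, fun h => ?_⟩
      · have hgi := ht.1 h
        refine wp_assign (i + 1) (by omega) (by omega) ?_ ?_
        · simp (disch := omega) only [eval_add, eval_var, eval_lit, Function.update_self,
            Nat.mod_eq_of_lt]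
        refine ⟨h1, ?_, i + 1, hi, ?_, ?_, by omega, by omega, h7, by omega, ?_⟩
        · intro x h10 h11 h12
          simp only [Function.update_of_ne h10, Function.update_of_ne h12, h2 x h10 h11 h12]
        · simp only [Function.update_self]
        · simp (disch := omega) only [Function.update_of_ne, h4]
        · intro j h10 h11
          refine ⟨fun h12 => hg j i h10 (Fin.le_def.2 (by omega)) (by omega) hgi, (h9 j h10 h11).2⟩
      · have hgi : ¬ g i := fun hgi => h (ht.2 hgi)
        refine wp_assign i (by omega) (by omega) ?_ ?_
        · simp (disch := omega) only [eval_var, Function.update_self]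
        refine ⟨h1, ?_, lo, i, ?_, ?_, by omega, by omega, by omega, by omega, ?_⟩
        · intro x h10 h11 h12
          simp only [Function.update_of_ne h11, Function.update_of_ne h12, h2 x h10 h11 h12]
        · simp (disch := omega) only [Function.update_of_ne, h3]
        · simp only [Function.update_self]
        · intro j h10 h11
          refine ⟨(h9 j h10 h11).1, fun h12 hgj => hgi (hg i j ?_ ?_ h11 hgj)⟩
          · omega
          · exact Fin.le_def.2 h12
    · simp [Cmd.cost, block]
      omega
  · simp only [Test.cost, var, Expr.cost]
    ring_nf
    omega

end Search

end ColorRange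

namespace ColorRange

/-! ### Walks in a range tree -/

/-- The extension of a vector to all indices. -/
def extend {d : ℕ} (a : Fin d → ℝ) (j : ℕ) : ℝ := if h : j < d then a ⟨j, h⟩ else 0

section Programs

variable {d : ℕ}

/-- The lower end of the query in the coordinate `j`. -/
def lowKey (j : ℕ) : KeyExpr d := if h : j < d then .lo ⟨j, h⟩ else .cell (.lit 0)

/-- The upper end of the query in the coordinate `j`. -/
def highKey (j : ℕ) : KeyExpr d := if h : j < d then .hi ⟨j, h⟩ else .cell (.lit 0)

/-- The coordinate `j` of the point at position `x` of the node `e`. -/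
def cellKey (κ : ℕ) (e x : Expr) (j : ℕ) : KeyExpr d :=
  .cell (fieldExpr κ e (.lit 0) x * .lit d + .lit j)

/-- The code of the current node of a walk in its reordered form. -/
def childCode (o : ℕ) : Expr := var o * var 2 + var (o + 9) + .lit 1

/-- Whether the probed point lies below the query. -/
def testLow (κ : ℕ) (e : Expr) (o j : ℕ) : Test d :=
  .keyLt (cellKey κ e (var (o + 13)) j) (lowKey j)

/-- Whether the probed point does not lie above the query. -/
def testHigh (κ : ℕ) (e : Expr) (o j : ℕ) : Test d :=
  .neg (.keyLt (highKey j) (cellKey κ e (var (o + 13)) j))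

/-- Start of a walk at the top block of a node. -/
def walkInit (κ o j : ℕ) : Cmd d :=
  .seq (block [assign (o + 7) (var (o + 1)), assign (o + 8) (var (o + 2)),
      assign (o + 9) (var (o + 3))])
    (.seq (search o (o + 10) (testLow κ (childCode o) o j))
      (search o (o + 11) (testHigh κ (childCode o) o j)))

/-- One step of a walk: descend to the half that contains the target, and note the other one. -/
def descend (κ o : ℕ) : Cmd d :=
  block [assign (o + 8) (var (o + 8) / .lit 2),
    assign (o + 17) (var (o + 7) + (fieldExpr κ (childCode o) (.lit 1) (var (o + 10)) -
      fieldExpr κ (childCode o) (.lit 1) (var (o + 7)))),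
    assign (o + 18) (var (o + 7) + (fieldExpr κ (childCode o) (.lit 1) (var (o + 11)) -
      fieldExpr κ (childCode o) (.lit 1) (var (o + 7)))),
    assign (o + 19) (var (o + 7) + var (o + 8) + var (o + 10) - var (o + 17)),
    assign (o + 20) (var (o + 7) + var (o + 8) + var (o + 11) - var (o + 18)),
    assign (o + 9) (var (o + 9) - .lit 1),
    .ite (.lt (var (o + 6)) (var (o + 7) + var (o + 8)))
      (block [assign (o + 14) (var (o + 7) + var (o + 8)), assign (o + 15) (var (o + 19)),
        assign (o + 16) (var (o + 20)), assign (o + 10) (var (o + 17)),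
        assign (o + 11) (var (o + 18))])
      (block [assign (o + 14) (var (o + 7)), assign (o + 15) (var (o + 17)),
        assign (o + 16) (var (o + 18)), assign (o + 10) (var (o + 19)),
        assign (o + 11) (var (o + 20)), assign (o + 7) (var (o + 7) + var (o + 8))])]

/-- Pass the noted block to the next stage. -/
def passBlock (o : ℕ) : Cmd d :=
  block [assign (o + 32) (childCode o), assign (o + 33) (var (o + 14)),
    assign (o + 34) (var (o + 8)), assign (o + 35) (var (o + 9)),
    assign (o + 36) (var (o + 15)), assign (o + 37) (var (o + 16))]

/-- Run `body` on the blocks that the walk to the target discovers. -/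
def walk (κ o j : ℕ) (body : Cmd d) : Cmd d :=
  .seq (walkInit κ o j) (.seq
    (.loop (.lt (.lit 0) (var (o + 9))) (.seq (descend κ o)
      (.ite (.conj (.lt (var (o + 4)) (var (o + 14)))
          (.lt (var (o + 14) + var (o + 8)) (var (o + 5))))
        (.seq (passBlock o) body) .skip)))
    (.seq (block [assign (o + 14) (var (o + 7)), assign (o + 15) (var (o + 10)),
      assign (o + 16) (var (o + 11))]) (.seq (passBlock o) body)))

/-- Decompose the interval of a node into blocks for the next stage. -/
def stage (κ o j : ℕ) (body : Cmd d) : Cmd d :=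
  .ite (.lt (var (o + 4)) (var (o + 5)))
    (.seq (block [assign (o + 6) (var (o + 4))]) (.seq (walk κ o j body)
      (.ite (.lt (var (o + 4) + .lit 1) (var (o + 5)))
        (.seq (block [assign (o + 6) (var (o + 5) - .lit 1)]) (walk κ o j body)) .skip))) .skip

end Programs

/-! ### Interfaces between the stages, and the start of a walk. -/

section Specs

variable {d W : ℕ} {D : Store} {a b : Fin d → ℝ} {κ K N B base : ℕ} {X : Fin N → ℕ → ℝ}
  {idx C : Fin N → ℕ}

/-- The setting of a traversal of a range tree. -/
structure Setting (W : ℕ) (D : Store) (a b : Fin d → ℝ) (κ K B base : ℕ) (X : Fin N → ℕ → ℝ)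
    (idx C : Fin N → ℕ) : Prop where
  tree : IsTree d W D κ K B X idx C
  hκ : κ + 8 < 2 ^ W
  hd : d < 2 ^ W
  hbase : 3 ≤ base
  hW : base + 32 * (d + 1) ≤ 2 ^ W
  hD : base + 32 * (d + 1) ≤ D.workCells
  size : 4 * N + 4 * 2 ^ K < 2 ^ W

/-- The registers of a stage that describe its node and its interval. -/
structure NodeRegs (mem : ℕ → ℕ) (o K : ℕ) (t : List ℕ) (u h l r : ℕ) : Prop where
  e : mem o = code K t
  u : mem (o + 1) = u
  w : mem (o + 2) = 2 ^ h
  h : mem (o + 3) = h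
  l : mem (o + 4) = l
  r : mem (o + 5) = r

/-- Nodes and intervals that occur. -/
structure NodeValid (N K : ℕ) (t : List ℕ) (u h l r : ℕ) : Prop where
  levels : ∀ x ∈ t, x < K
  dvd : 2 ^ h ∣ u
  h_lt : h < K
  u_le : u ≤ N
  u_le_l : u ≤ l
  l_le : l ≤ N
  r_le : r ≤ N
  r_le' : r ≤ u + 2 ^ h

/-- Accumulators for a traversal: statements about the memory below `base` and the output. -/
structure IsAccumulator (base B N K : ℕ) (Inv : Finset (Fin N) → State → Prop) : Prop where
  regs : ∀ S s, Inv S s → TreeRegs s.mem B N K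
  stable : ∀ S s s', Inv S s → s'.out = s.out → (∀ x < base, s'.mem x = s.mem x) → Inv S s'

/-- The program `body` adds the points of an interval of a node on `j` levels. -/
def BodySpec (W : ℕ) (D : Store) (a b : Fin d → ℝ) (K base : ℕ) (X : Fin N → ℕ → ℝ)
    (Inv : Finset (Fin N) → State → Prop) (body : Cmd d) (j o T : ℕ) : Prop :=
  ∀ t u h l r S s, t.length = j → NodeValid N K t u h l r → NodeRegs s.mem o K t u h l r →
    Inv S s → Disjoint S (slab X d (extend a) (extend b) t (Set.Ico l r)) →
    Run W D a b body s T fun s' =>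
      Inv (S ∪ slab X d (extend a) (extend b) t (Set.Ico l r)) s' ∧
        ∀ x, base ≤ x → x < o → s'.mem x = s.mem x

theorem eval_lowKey {mem : ℕ → ℕ} {j : ℕ} (hj : j < d) :
    (lowKey j : KeyExpr d).eval W D a b mem = extend a j := by
  simp [lowKey, extend, hj, KeyExpr.eval]

theorem eval_highKey {mem : ℕ → ℕ} {j : ℕ} (hj : j < d) :
    (highKey j : KeyExpr d).eval W D a b mem = extend b j := by
  simp [highKey, extend, hj, KeyExpr.eval]

theorem eval_cellKey (E : Setting W D a b κ K B base X idx C) {mem : ℕ → ℕ}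
    (hm : TreeRegs mem B N K) {e x : Expr} {t : List ℕ} {i : Fin N} {j : ℕ}
    (he : e.eval W D mem = code K t) (hx : x.eval W D mem = i)
    (ht : ∀ h ∈ t, h < K) (hd : t.length < d) (hj : j < d) :
    (cellKey κ e x j : KeyExpr d).eval W D a b mem = X (ord X t i) j := by
  have h1 := E.tree.coord (ord X t i) j hj
  have h2 := eval_field E.tree hm E.hκ he (f := .lit 0) (fv := 0)
    (by rw [eval_lit, Nat.zero_mod]) hx ht hd (by omega) i.2.le
  have h3 : fieldVal κ X idx C t 0 i = idx (ord X t i) := by simp [fieldVal]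
  rw [← h1.2, cellKey, KeyExpr.eval]
  have := E.hd
  simp (disch := omega) only [eval_add, eval_mul, eval_lit, h2, h3, Nat.mod_eq_of_lt]

theorem eval_childCode (E : Setting W D a b κ K B base X idx C) {mem : ℕ → ℕ}
    {o h : ℕ} {t : List ℕ} (ho : o + 32 ≤ 2 ^ W) (hm : mem 2 = K) (h1 : mem o = code K t)
    (h2 : mem (o + 9) = h)
    (ht : ∀ x ∈ h :: t, x < K) (hd : t.length + 1 < d) :
    (childCode o).eval W D mem = code K (h :: t) := by
  have h3 := E.tree.code_lt ht hd
  rw [code] at h3 ⊢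
  simp (disch := omega) only [childCode, eval_add, eval_mul, eval_var, eval_lit, hm, h1, h2,
    Nat.mod_eq_of_lt]

/-- Two binary searches in the resorted top block give its ranks. They cost O(K) once per walk, no
more than the walk itself; lower blocks get their ranks by cascading. -/
theorem run_walkInit (E : Setting W D a b κ K B base X idx C) {o u h l r : ℕ} {t : List ℕ}
    {s : State} (ho : base ≤ o) (ho' : o + 64 ≤ base + 32 * (d + 1))
    (hv : NodeValid N K t u h l r) (hr : NodeRegs s.mem o K t u h l r)
    (hm : TreeRegs s.mem B N K) (hd : t.length + 1 < d) :
    Run W D a b (walkInit κ o (t.length + 1)) s (K * 140 + 100) fun s' =>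
      s'.out = s.out ∧ (∀ x, x ≤ o + 6 ∨ o + 14 ≤ x → s'.mem x = s.mem x) ∧
        s'.mem (o + 7) = u ∧ s'.mem (o + 8) = 2 ^ h ∧ s'.mem (o + 9) = h ∧
        s'.mem (o + 10) = rankLo X (extend a) t u h ∧
        s'.mem (o + 11) = rankHi X (extend b) t u h := by
  have hbase := E.hbase
  have hW := E.hW
  have hD := E.hD
  have hsize := E.size
  have hhK : 2 ^ h ≤ 2 ^ K := Nat.pow_le_pow_right (by omega) hv.h_lt.le
  have hhK' : 2 ^ h < 2 ^ K := Nat.pow_lt_pow_right (by omega) hv.h_lt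
  have huN := hv.u_le
  have hlev : ∀ x ∈ h :: t, x < K := by
    intro x hx
    rcases List.mem_cons.1 hx with rfl | hx
    · exact hv.h_lt
    · exact hv.levels x hx
  obtain ⟨hm0, hm1, hm2⟩ := hm
  refine (Run.seq (T₁ := 13) (Q₁ := fun s' => s'.out = s.out ∧
    (∀ x, x ≤ o + 6 ∨ o + 10 ≤ x → s'.mem x = s.mem x) ∧
    s'.mem (o + 7) = u ∧ s'.mem (o + 8) = 2 ^ h ∧ s'.mem (o + 9) = h) ?_
    (T₂ := K * 140 + 86) ?_).mono (by omega) fun _ => id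
  · refine (Run.of_wp ?_).mono (by simp [Cmd.cost, block]) fun _ => id
    refine wp_cons (wp_assign u (by omega) (by omega) ?_ ?_)
    · rw [eval_var (by omega), hr.u]
    refine wp_cons (wp_assign (2 ^ h) (by omega) (by omega) ?_ ?_)
    · simp (disch := omega) only [eval_var, Function.update_of_ne, hr.w]
    refine wp_cons (wp_assign h (by omega) (by omega) ?_ ?_)
    · simp (disch := omega) only [eval_var, Function.update_of_ne, hr.h]
    refine ⟨rfl, fun x hx => ?_, ?_, ?_, ?_⟩ <;>
      simp (disch := omega) only [Function.update_of_ne, Function.update_self]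
  rintro s₁ ⟨h1, h2, h3, h4, h5⟩
  refine (Run.seq (run_search (N := N) (u := u) (w := 2 ^ h) (k := K)
    (g := fun i => key X t (blockSort h (key X t) i) < extend a (t.length + 1)) (by omega)
    (by omega) (by omega) (by omega) (by omega) ?_ ?_ ?_ huN (by omega) hhK' ?_ ?_)
    (T₂ := K * 70 + 28) ?_).mono (T' := K * 140 + 86) ?_ fun _ => id
  · rw [h2 _ (by omega), hm1]
  · rw [h2 _ (by omega), hr.u]
  · rw [h2 _ (by omega), hr.w]
  · intro i j h6 h7 h8 h9
    refine lt_of_le_of_lt (blockSort_mono h (key X t) h7 ?_) h9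
    rw [(mem_block_iff hv.dvd).1 ⟨h6, lt_of_le_of_lt h7 h8⟩,
      (mem_block_iff hv.dvd).1 ⟨h6.trans h7, h8⟩]
  · intro m hm i h6 h7 h8
    have e : ∀ x, x ≤ o + 6 → m x = s.mem x := fun x hx => by
      rw [hm x (by omega) (by omega) (by omega), h2 x (by omega)]
    have hc := eval_childCode E (mem := m) (o := o) (h := h) (t := t) (by omega)
      (by rw [e _ (by omega), hm2]) (by rw [e _ (by omega), hr.e])
      (by rw [hm _ (by omega) (by omega) (by omega), h5]) hlev hd
    have hx : (var (o + 13)).eval W D m = i := by rw [eval_var (by omega), h8]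
    rw [testLow, Test.Holds, eval_lowKey hd, eval_cellKey E ⟨by rw [e _ (by omega), hm0],
      by rw [e _ (by omega), hm1], by rw [e _ (by omega), hm2]⟩ hc hx hlev hd hd]
    rfl
  · rintro s₂ ⟨h6, h7, h8⟩
    refine (run_search (N := N) (u := u) (w := 2 ^ h) (k := K)
      (g := fun i => key X t (blockSort h (key X t) i) ≤ extend b (t.length + 1)) (by omega)
      (by omega) (by omega) (by omega) (by omega) ?_ ?_ ?_ huN (by omega) hhK' ?_ ?_).mono ?_ ?_
    · rw [h7 _ (by omega) (by omega) (by omega), h2 _ (by omega), hm1]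
    · rw [h7 _ (by omega) (by omega) (by omega), h2 _ (by omega), hr.u]
    · rw [h7 _ (by omega) (by omega) (by omega), h2 _ (by omega), hr.w]
    · intro i j h6 h7 h8 h9
      refine le_trans (blockSort_mono h (key X t) h7 ?_) h9
      rw [(mem_block_iff hv.dvd).1 ⟨h6, lt_of_le_of_lt h7 h8⟩,
        (mem_block_iff hv.dvd).1 ⟨h6.trans h7, h8⟩]
    · intro m hm i h9 h10 h11
      have e : ∀ x, x ≤ o + 6 → m x = s.mem x := fun x hx => by
        rw [hm x (by omega) (by omega) (by omega), h7 x (by omega) (by omega) (by omega),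
          h2 x (by omega)]
      have hc := eval_childCode E (mem := m) (o := o) (h := h) (t := t) (by omega)
        (by rw [e _ (by omega), hm2]) (by rw [e _ (by omega), hr.e])
        (by rw [hm _ (by omega) (by omega) (by omega), h7 _ (by omega) (by omega) (by omega),
          h5]) hlev hd
      have hx : (var (o + 13)).eval W D m = i := by rw [eval_var (by omega), h11]
      rw [testHigh, Test.Holds, Test.Holds, eval_highKey hd,
        eval_cellKey E ⟨by rw [e _ (by omega), hm0],
        by rw [e _ (by omega), hm1], by rw [e _ (by omega), hm2]⟩ hc hx hlev hd hd, not_lt]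
      rfl
    · have : (testHigh κ (childCode o) o (t.length + 1) : Test d).cost ≤ 42 := by
        simp [testHigh, Test.cost, KeyExpr.cost, cellKey, highKey, hd, fieldExpr, childCode,
          Expr.cost]
      nlinarith
    · rintro s₃ ⟨h9, h10, h11⟩
      refine ⟨by rw [h9, h6, h1], fun x hx => ?_, ?_, ?_, ?_, ?_, ?_⟩
      · rw [h10 x (by omega) (by omega) (by omega), h7 x (by omega) (by omega) (by omega),
          h2 x (by omega)]
      · rw [h10 _ (by omega) (by omega) (by omega), h7 _ (by omega) (by omega) (by omega), h3]
      · rw [h10 _ (by omega) (by omega) (by omega), h7 _ (by omega) (by omega) (by omega), h4]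
      · rw [h10 _ (by omega) (by omega) (by omega), h7 _ (by omega) (by omega) (by omega), h5]
      · rw [h10 _ (by omega) (by omega) (by omega), h8,
          countIn_blockSort (key X t) hv.dvd (fun i => key X t i < extend a (t.length + 1))]
        rfl
      · rw [h11, countIn_blockSort (key X t) hv.dvd (fun i => key X t i ≤ extend b (t.length + 1))]
        rfl
  · have : (testLow κ (childCode o) o (t.length + 1) : Test d).cost ≤ 42 := by
      simp [testLow, Test.cost, KeyExpr.cost, cellKey, lowKey, hd, fieldExpr, childCode,
        Expr.cost]
    nlinarith

end Specs

end ColorRange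

namespace ColorRange

/-! ### One step of a walk, and the transfer of a block to the next coordinate. -/

section Specs

variable {d W : ℕ} {D : Store} {a b : Fin d → ℝ} {κ K N B base : ℕ} {X : Fin N → ℕ → ℝ}
  {idx C : Fin N → ℕ}

/-- The local variables of a walk. -/
structure WalkRegs (a b : Fin d → ℝ) (X : Fin N → ℕ → ℝ) (mem : ℕ → ℕ) (o : ℕ) (t : List ℕ)
    (u h : ℕ) : Prop where
  start : mem (o + 7) = u
  width : mem (o + 8) = 2 ^ h
  height : mem (o + 9) = h
  lo : mem (o + 10) = rankLo X (extend a) t u h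
  hi : mem (o + 11) = rankHi X (extend b) t u h

/-- The block noted for the next stage. -/
structure NoteRegs (a b : Fin d → ℝ) (X : Fin N → ℕ → ℝ) (mem : ℕ → ℕ) (o : ℕ) (t : List ℕ)
    (u h : ℕ) : Prop where
  start : mem (o + 14) = u
  width : mem (o + 8) = 2 ^ h
  height : mem (o + 9) = h
  lo : mem (o + 15) = rankLo X (extend a) t u h
  hi : mem (o + 16) = rankHi X (extend b) t u h

/-- Ranks of the left half come from `rankLo_step` and `rankHi_step`, those of the right half by
subtraction. Both halves are kept: one continues the walk, the other is its sibling and may belong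
to the decomposition. -/
theorem run_descend (E : Setting W D a b κ K B base X idx C) {o u n x : ℕ} {t : List ℕ}
    {s : State} (ho' : o + 64 ≤ base + 32 * (d + 1))
    (hm : TreeRegs s.mem B N K) (hd : t.length + 1 < d) (hlev : ∀ y ∈ t, y < K)
    (he : s.mem o = code K t) (hx : s.mem (o + 6) = x) (hxN : x < N) (hux : u ≤ x)
    (hn : n + 1 < K) (hdvd : 2 ^ (n + 1) ∣ u) (hr : WalkRegs a b X s.mem o t u (n + 1)) :
    Run W D a b (descend κ o) s 300 fun s' =>
      s'.out = s.out ∧ (∀ y, y ≤ o + 6 ∨ o + 21 ≤ y → s'.mem y = s.mem y) ∧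
        ∃ v z, (x < u + 2 ^ n ∧ v = u ∧ z = u + 2 ^ n ∨ u + 2 ^ n ≤ x ∧ v = u + 2 ^ n ∧ z = u) ∧
          WalkRegs a b X s'.mem o t v n ∧ NoteRegs a b X s'.mem o t z n := by
  have hbase := E.hbase
  have hW := E.hW
  have hD := E.hD
  have hsize := E.size
  have hnK : 2 ^ (n + 1) ≤ 2 ^ K := Nat.pow_le_pow_right (by omega) hn.le
  have huN : u ≤ N := by omega
  have hlev' : ∀ x ∈ (n + 1) :: t, x < K := by
    intro x hx
    rcases List.mem_cons.1 hx with rfl | hx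
    · exact hn
    · exact hlev x hx
  obtain ⟨hm0, hm1, hm2⟩ := hm
  have hG : ∀ (m : ℕ → ℕ) (y v : ℕ), (∀ x ≤ o + 6, m x = s.mem x) → m (o + 9) = n + 1 →
      y < 2 ^ W → m y = v → v ≤ N → (fieldExpr κ (childCode o) (.lit 1) (var y)).eval W D m =
        leftRank (n + 1) (key X t) v := by
    intro m y v h1 h2 h3 h4 h5
    have hc := eval_childCode E (mem := m) (o := o) (h := n + 1) (t := t) (by omega)
      (by rw [h1 _ (by omega), hm2]) (by rw [h1 _ (by omega), he]) h2 hlev' hd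
    rw [eval_field E.tree (t := (n + 1) :: t) (fv := 1) (xv := v) ⟨by rw [h1 _ (by omega), hm0],
      by rw [h1 _ (by omega), hm1], by rw [h1 _ (by omega), hm2]⟩ E.hκ hc ?_ ?_ hlev' hd
      (by omega) h5]
    · rfl
    · rw [eval_lit, Nat.mod_eq_of_lt (by omega)]
    · rw [eval_var h3, h4]
  have hlo1 : rankLo X (extend a) t u (n + 1) ≤ N := (countIn_le _ _ _ huN).trans (min_le_right _ _)
  have hhi1 : rankHi X (extend b) t u (n + 1) ≤ N := (countIn_le _ _ _ huN).trans (min_le_right _ _)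
  have hlo2 : rankLo X (extend a) t u n ≤ N := (countIn_le _ _ _ huN).trans (min_le_right _ _)
  have hhi2 : rankHi X (extend b) t u n ≤ N := (countIn_le _ _ _ huN).trans (min_le_right _ _)
  have hstepLo := rankLo_step (A := extend a) (X := X) t hdvd huN
  have hstepHi := rankHi_step (B := extend b) (X := X) t hdvd huN
  have hrLo := rankLo_right (X := X) (A := extend a) t u n
  have hrHi := rankHi_right (X := X) (B := extend b) t u n
  obtain ⟨hr7, hr8, hr9, hr10, hr11⟩ := hr
  have e2 : 2 ^ (n + 1) = 2 ^ n * 2 := pow_succ 2 n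
  generalize hp1 : rankLo X (extend a) t u (n + 1) = p1 at *
  generalize hq1 : rankHi X (extend b) t u (n + 1) = q1 at *
  generalize hp2 : rankLo X (extend a) t u n = p2 at *
  generalize hq2 : rankHi X (extend b) t u n = q2 at *
  generalize hp3 : rankLo X (extend a) t (u + 2 ^ n) n = p3 at *
  generalize hq3 : rankHi X (extend b) t (u + 2 ^ n) n = q3 at *
  refine (Run.of_wp ?_).mono (by simp [descend, Cmd.cost, block, fieldExpr, Expr.cost, childCode,
    Test.cost]) fun _ => id
  refine wp_cons (wp_assign (2 ^ n) (by omega) (by omega) ?_ ?_)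
  · simp (disch := omega) only [eval_div, eval_var, eval_lit, hr8, Nat.mod_eq_of_lt]
    omega
  refine wp_cons (wp_assign p2 (by omega) (by omega) ?_ ?_)
  · rw [eval_add, eval_sub, hG _ (o + 10) p1, hG _ (o + 7) u, eval_var (by omega)]
    · simp (disch := omega) only [Function.update_of_ne, hr7, hstepLo, Nat.mod_eq_of_lt]
    any_goals omega
    all_goals simp +contextual (disch := omega) only [Function.update_of_ne, hr7, hr9, hr10,
      implies_true]
  refine wp_cons (wp_assign q2 (by omega) (by omega) ?_ ?_)
  · rw [eval_add, eval_sub, hG _ (o + 11) q1, hG _ (o + 7) u, eval_var (by omega)]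
    · simp (disch := omega) only [Function.update_of_ne, hr7, hstepHi, Nat.mod_eq_of_lt]
    any_goals omega
    all_goals simp +contextual (disch := omega) only [Function.update_of_ne, hr7, hr9, hr11,
      implies_true]
  refine wp_cons (wp_assign p3 (by omega) (by omega) ?_ ?_)
  · simp (disch := omega) only [eval_add, eval_sub, eval_var, Function.update_of_ne,
      Function.update_self, hr7, hr10, Nat.mod_eq_of_lt]
    omega
  refine wp_cons (wp_assign q3 (by omega) (by omega) ?_ ?_)
  · simp (disch := omega) only [eval_add, eval_sub, eval_var, Function.update_of_ne,
      Function.update_self, hr7, hr11, Nat.mod_eq_of_lt]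
    omega
  refine wp_cons (wp_assign n (by omega) (by omega) ?_ ?_)
  · simp (disch := omega) only [eval_sub, eval_var, eval_lit, Function.update_of_ne, hr9,
      Nat.mod_eq_of_lt]
    omega
  refine wp_cons ⟨fun h => ?_, fun h => ?_⟩ <;> rw [Test.Holds] at h <;>
    simp (disch := omega) only [eval_add, eval_var, Function.update_of_ne,
      Function.update_self, hr7, hx, Nat.mod_eq_of_lt] at h
  · refine wp_cons (wp_assign (u + 2 ^ n) (by omega) (by omega) ?_ ?_)
    · simp (disch := omega) only [eval_add, eval_var, Function.update_of_ne,
        Function.update_self, hr7, Nat.mod_eq_of_lt]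
    refine wp_cons (wp_assign p3 (by omega) (by omega) ?_ ?_)
    · simp (disch := omega) only [eval_var, Function.update_of_ne, Function.update_self]
    refine wp_cons (wp_assign q3 (by omega) (by omega) ?_ ?_)
    · simp (disch := omega) only [eval_var, Function.update_of_ne, Function.update_self]
    refine wp_cons (wp_assign p2 (by omega) (by omega) ?_ ?_)
    · simp (disch := omega) only [eval_var, Function.update_of_ne, Function.update_self]
    refine wp_cons (wp_assign q2 (by omega) (by omega) ?_ ?_)
    · simp (disch := omega) only [eval_var, Function.update_of_ne, Function.update_self]
    refine ⟨rfl, fun y hy => ?_, u, u + 2 ^ n, .inl ⟨h, rfl, rfl⟩, ⟨?_, ?_, ?_, ?_, ?_⟩,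
      ⟨?_, ?_, ?_, ?_, ?_⟩⟩ <;>
      simp (disch := omega) only [Function.update_of_ne, Function.update_self, hr7, hp2, hq2,
        hp3, hq3]
  · refine wp_cons (wp_assign u (by omega) (by omega) ?_ ?_)
    · simp (disch := omega) only [eval_var, Function.update_of_ne, hr7]
    refine wp_cons (wp_assign p2 (by omega) (by omega) ?_ ?_)
    · simp (disch := omega) only [eval_var, Function.update_of_ne, Function.update_self]
    refine wp_cons (wp_assign q2 (by omega) (by omega) ?_ ?_)
    · simp (disch := omega) only [eval_var, Function.update_of_ne, Function.update_self]
    refine wp_cons (wp_assign p3 (by omega) (by omega) ?_ ?_)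
    · simp (disch := omega) only [eval_var, Function.update_of_ne, Function.update_self]
    refine wp_cons (wp_assign q3 (by omega) (by omega) ?_ ?_)
    · simp (disch := omega) only [eval_var, Function.update_of_ne, Function.update_self]
    refine wp_cons (wp_assign (u + 2 ^ n) (by omega) (by omega) ?_ ?_)
    · simp (disch := omega) only [eval_add, eval_var, Function.update_of_ne,
        Function.update_self, hr7, Nat.mod_eq_of_lt]
    refine ⟨rfl, fun y hy => ?_, u + 2 ^ n, u, .inr ⟨not_lt.1 h, rfl, rfl⟩, ⟨?_, ?_, ?_, ?_, ?_⟩,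
      ⟨?_, ?_, ?_, ?_, ?_⟩⟩ <;>
      simp (disch := omega) only [Function.update_of_ne, Function.update_self, hp2, hq2,
        hp3, hq3]

/-- Handing a block over to the next stage, whose specification is `hbody`. -/
theorem run_pass (E : Setting W D a b κ K B base X idx C) {Inv : Finset (Fin N) → State → Prop}
    (hInv : IsAccumulator base B N K Inv) {body : Cmd d} {o z n T : ℕ} {t : List ℕ}
    {s : State} {S : Finset (Fin N)} (ho : base ≤ o) (ho' : o + 64 ≤ base + 32 * (d + 1))
    (hbody : BodySpec W D a b K base X Inv body (t.length + 1) (o + 32) T)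
    (hd : t.length + 1 < d) (hlev : ∀ y ∈ t, y < K)
    (he : s.mem o = code K t) (hzN : z ≤ N) (hn : n < K) (hdvd : 2 ^ n ∣ z)
    (hr : NoteRegs a b X s.mem o t z n) (hS : Inv S s)
    (hdisj : Disjoint S (slab X d (extend a) (extend b) t (Set.Ico z (z + 2 ^ n)))) :
    Run W D a b (.seq (passBlock o) body) s (T + 60) fun s' =>
      Inv (S ∪ slab X d (extend a) (extend b) t (Set.Ico z (z + 2 ^ n))) s' ∧
        ∀ x, base ≤ x → x < o + 32 → s'.mem x = s.mem x := by
  have hbase := E.hbase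
  have hW := E.hW
  have hD := E.hD
  have hlev' : ∀ x ∈ n :: t, x < K := by
    intro x hx
    rcases List.mem_cons.1 hx with rfl | hx
    · exact hn
    · exact hlev x hx
  obtain ⟨hm0, hm1, hm2⟩ := hInv.regs _ _ hS
  -- The block on the levels `t` becomes an interval on the levels `n :: t`, which is the form that
  -- `hbody` accepts.
  rw [← slab_cons n t hdvd hd] at hdisj ⊢
  have hlo : rankLo X (extend a) t z n ≤ min (z + 2 ^ n) N := countIn_le _ _ _ hzN
  have hhi : rankHi X (extend b) t z n ≤ min (z + 2 ^ n) N := countIn_le _ _ _ hzN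
  refine (Run.seq (T₁ := 60) (Q₁ := fun s' => s'.out = s.out ∧
    (∀ x, x < o + 32 → s'.mem x = s.mem x) ∧ NodeRegs s'.mem (o + 32) K (n :: t) z n
      (rankLo X (extend a) t z n) (rankHi X (extend b) t z n)) ?_ ?_).mono
      (Nat.add_comm _ _).le fun _ => id
  · refine (Run.of_wp ?_).mono (by simp [passBlock, Cmd.cost, block, childCode]) fun _ => id
    refine wp_cons (wp_assign (code K (n :: t)) (by omega) (by omega) ?_ ?_)
    · exact eval_childCode E (by omega) hm2 he hr.height hlev' hd
    refine wp_cons (wp_assign z (by omega) (by omega) ?_ ?_)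
    · simp (disch := omega) only [eval_var, Function.update_of_ne, hr.start]
    refine wp_cons (wp_assign (2 ^ n) (by omega) (by omega) ?_ ?_)
    · simp (disch := omega) only [eval_var, Function.update_of_ne, hr.width]
    refine wp_cons (wp_assign n (by omega) (by omega) ?_ ?_)
    · simp (disch := omega) only [eval_var, Function.update_of_ne, hr.height]
    refine wp_cons (wp_assign (rankLo X (extend a) t z n) (by omega) (by omega) ?_ ?_)
    · simp (disch := omega) only [eval_var, Function.update_of_ne, hr.lo]
    refine wp_cons (wp_assign (rankHi X (extend b) t z n) (by omega) (by omega) ?_ ?_)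
    · simp (disch := omega) only [eval_var, Function.update_of_ne, hr.hi]
    refine ⟨rfl, fun y hy => ?_, ⟨?_, ?_, ?_, ?_, ?_, ?_⟩⟩ <;>
      simp (disch := omega) only [Function.update_of_ne, Function.update_self]
  · rintro s' ⟨h1, h2, h3⟩
    refine (hbody (n :: t) z n (rankLo X (extend a) t z n) (rankHi X (extend b) t z n) S s' rfl ⟨hlev', hdvd, hn, hzN, Nat.le_add_right _ _,
      (by omega), (by omega), (by omega)⟩ h3 ?_ hdisj).mono le_rfl ?_
    · exact hInv.stable _ _ _ hS h1 fun x hx => h2 x (by omega)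
    · rintro s'' ⟨h4, h5⟩
      exact ⟨h4, fun x h6 h7 => by rw [h5 x h6 h7, h2 x h7]⟩

end Specs

end ColorRange

namespace ColorRange

/-! ### Whole walks, and the decomposition of an interval by one stage. -/

section Specs

variable {d W : ℕ} {D : Store} {a b : Fin d → ℝ} {κ K N B base : ℕ} {X : Fin N → ℕ → ℝ}
  {idx C : Fin N → ℕ}

theorem walkSet_succ {l r x u v z n : ℕ}
    (h : x < u + 2 ^ n ∧ v = u ∧ z = u + 2 ^ n ∨ u + 2 ^ n ≤ x ∧ v = u + 2 ^ n ∧ z = u) :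
    walkSet l r x u (n + 1) =
      (if l < z ∧ z + 2 ^ n < r then Set.Ico z (z + 2 ^ n) else ∅) ∪ walkSet l r x v n := by
  rcases h with ⟨h, rfl, rfl⟩ | ⟨h, rfl, rfl⟩
  · rw [walkSet, if_pos h]
  · rw [walkSet, if_neg (not_lt.2 h)]

/-- At most `K` siblings and the final single position are handed to `body`, each at cost `T` plus a
constant. This gives one factor `K + 1` per stage. -/
theorem run_walk (E : Setting W D a b κ K B base X idx C) {Inv : Finset (Fin N) → State → Prop}
    (hInv : IsAccumulator base B N K Inv) {body : Cmd d} {o u h l r x T : ℕ} {t : List ℕ}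
    {s : State} {S : Finset (Fin N)} (ho : base ≤ o) (ho' : o + 64 ≤ base + 32 * (d + 1))
    (hbody : BodySpec W D a b K base X Inv body (t.length + 1) (o + 32) T)
    (hd : t.length + 1 < d) (hv : NodeValid N K t u h l r) (hr : NodeRegs s.mem o K t u h l r)
    (hx : s.mem (o + 6) = x) (hux : u ≤ x) (hxu : x < u + 2 ^ h) (hxN : x < N) (hS : Inv S s)
    (hdisj : Disjoint S (slab X d (extend a) (extend b) t (walkSet l r x u h))) :
    Run W D a b (walk κ o (t.length + 1) body) s ((K + 1) * (T + 600)) fun s' =>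
      Inv (S ∪ slab X d (extend a) (extend b) t (walkSet l r x u h)) s' ∧
        ∀ y, base ≤ y → y ≤ o + 6 → s'.mem y = s.mem y := by
  have hbase := E.hbase
  have hW := E.hW
  have hD := E.hD
  have hsize := E.size
  -- The points accumulated so far and those still ahead of the walk are disjoint and have a
  -- constant union.
  let I : ℕ → State → Prop := fun n s' => ∃ v S', WalkRegs a b X s'.mem o t v n ∧
    (∀ y, base ≤ y → y ≤ o + 6 → s'.mem y = s.mem y) ∧ Inv S' s' ∧
    Disjoint S' (slab X d (extend a) (extend b) t (walkSet l r x v n)) ∧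
    S' ∪ slab X d (extend a) (extend b) t (walkSet l r x v n) =
      S ∪ slab X d (extend a) (extend b) t (walkSet l r x u h) ∧
    2 ^ n ∣ v ∧ n < K ∧ v ≤ x ∧ x < v + 2 ^ n
  have hloop : ∀ s₁, I h s₁ → Run W D a b
      (.loop (.lt (.lit 0) (var (o + 9))) (.seq (descend κ o)
        (.ite (.conj (.lt (var (o + 4)) (var (o + 14)))
            (.lt (var (o + 14) + var (o + 8)) (var (o + 5))))
          (.seq (passBlock o) body) .skip))) s₁ (K * (T + 400) + 10) (I 0) := by
    intro s₁ hs₁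
    have hc : ∀ m, (Test.lt (.lit 0) (var (o + 9)) : Test d).Holds W D a b m ↔ 0 < m (o + 9) := by
      intro m
      simp only [Test.Holds, eval_var (show o + 9 < 2 ^ W by omega), eval_lit, Nat.zero_mod]
    refine (Run.loop (T := T + 390) I ?_ ?_ ?_ h s₁ hs₁).mono ?_ fun _ => id
    · intro n s' hI hβ
      obtain ⟨v, S', hreg, h1⟩ := hI
      rw [hc, hreg.height] at hβ
      obtain rfl : n = 0 := by omega
      exact ⟨v, S', hreg, h1⟩
    · rintro s' ⟨v, S', hreg, h1⟩
      rw [hc, hreg.height]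
      omega
    · rintro n s' ⟨v, S', hreg, h1, h2, h3, h4, h5, h6, h7, h8⟩ -
      refine (Run.seq (run_descend E ho' (hInv.regs _ _ h2) hd hv.levels
        (by rw [h1 _ (by omega) (by omega), hr.e]) (by rw [h1 _ (by omega) (by omega), hx])
        hxN h7 h6 h5 hreg) (T₂ := T + 90) ?_).mono (by omega) fun _ => id
      rintro s₂ ⟨g1, g2, v', z, g3, g4, g5⟩
      have hS₂ : Inv S' s₂ := hInv.stable _ _ _ h2 g1 fun y hy => g2 y (by omega)
      have e2 : 2 ^ (n + 1) = 2 ^ n * 2 := pow_succ 2 n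
      have hdn : 2 ^ n ∣ v := (pow_dvd_pow 2 (Nat.le_succ n)).trans h5
      have hdv : 2 ^ n ∣ v' := by
        rcases g3 with ⟨-, rfl, -⟩ | ⟨-, rfl, -⟩
        · exact hdn
        · exact dvd_add hdn dvd_rfl
      have hdz : 2 ^ n ∣ z := by
        rcases g3 with ⟨-, -, rfl⟩ | ⟨-, -, rfl⟩
        · exact dvd_add hdn dvd_rfl
        · exact hdn
      have hnK : 2 ^ (n + 1) ≤ 2 ^ K := Nat.pow_le_pow_right (by omega) h6.le
      have hw := walkSet_succ (l := l) (r := r) g3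
      rw [hw] at h3 h4
      have hcond : (Test.conj (.lt (var (o + 4)) (var (o + 14)))
            (.lt (var (o + 14) + var (o + 8)) (var (o + 5))) : Test d).Holds W D a b s₂.mem ↔
          l < z ∧ z + 2 ^ n < r := by
        have e4 : s₂.mem (o + 4) = l := by
          rw [g2 _ (by omega), h1 _ (by omega) (by omega), hr.l]
        have e5 : s₂.mem (o + 5) = r := by
          rw [g2 _ (by omega), h1 _ (by omega) (by omega), hr.r]
        simp (disch := omega) only [Test.Holds, eval_var, eval_add, e4, e5, g5.start, g5.width,
          Nat.mod_eq_of_lt]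
      refine (Run.ite (T := T + 60) (fun hβ => ?_) (fun hβ => ?_)).mono (by simp [Test.cost]; omega)
        fun _ => id
      · rw [hcond] at hβ
        rw [if_pos hβ, slab_union] at h4
        rw [if_pos hβ] at h3
        have hr' := hv.r_le
        refine (run_pass E hInv ho ho' hbody hd hv.levels
          (by rw [g2 _ (by omega), h1 _ (by omega) (by omega), hr.e]) (by omega) (by omega) hdz
          g5 hS₂ (h3.mono_right (slab_mono _ Set.subset_union_left))).mono le_rfl ?_
        rintro s₃ ⟨k1, k2⟩
        refine ⟨v', _, ⟨?_, ?_, ?_, ?_, ?_⟩, ?_, k1, ?_, ?_, hdv, by omega, by omega, by omega⟩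
        · rw [k2 _ (by omega) (by omega), g4.start]
        · rw [k2 _ (by omega) (by omega), g4.width]
        · rw [k2 _ (by omega) (by omega), g4.height]
        · rw [k2 _ (by omega) (by omega), g4.lo]
        · rw [k2 _ (by omega) (by omega), g4.hi]
        · intro y hy hy'
          rw [k2 _ hy (by omega), g2 _ (by omega), h1 _ hy hy']
        · rw [Finset.disjoint_union_left]
          refine ⟨h3.mono_right (slab_mono _ Set.subset_union_right), slab_disjoint _ ?_⟩
          refine Set.disjoint_of_subset_right (walkSet_subset l r x v' n) ?_
          rw [Set.disjoint_left]
          intro y hy hy'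
          rw [Set.mem_Ico] at hy hy'
          omega
        · rw [Finset.union_assoc, h4]
      · rw [hcond] at hβ
        rw [if_neg hβ, Set.empty_union] at h3 h4
        refine (Run.skip ?_).mono (by omega) fun _ => id
        refine ⟨v', S', g4, ?_, hS₂, h3, h4, hdv, by omega, by omega, by omega⟩
        intro y hy hy'
        rw [g2 _ (by omega), h1 _ hy hy']
    · simp only [Test.cost, cost_lit, cost_var]
      have := Nat.mul_le_mul_right (1 + 2 + 1 + 1 + (T + 390)) hv.h_lt.le
      nlinarith
  refine (Run.seq (run_walkInit E ho ho' hv hr (hInv.regs _ _ hS) hd)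
    (T₂ := K * (T + 400) + 10 + (T + 90)) ?_).mono (by nlinarith) fun _ => id
  rintro s₁ ⟨g1, g2, g3, g4, g5, g6, g7⟩
  refine (hloop s₁ ⟨u, S, ⟨g3, g4, g5, g6, g7⟩, fun y hy hy' => g2 y (by omega),
    hInv.stable _ _ _ hS g1 fun y hy => g2 y (by omega), hdisj, rfl, hv.dvd, hv.h_lt, hux,
    hxu⟩).seq ?_
  rintro s₂ ⟨v, S', hreg, h1, h2, h3, h4, h5, h6, h7, h8⟩
  refine (Run.seq (T₁ := 15) (Q₁ := fun s' => s'.out = s₂.out ∧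
    (∀ y, y ≤ o + 6 → s'.mem y = s₂.mem y) ∧ NoteRegs a b X s'.mem o t v 0) ?_
    (T₂ := T + 60) ?_).mono (by omega) fun _ => id
  · refine (Run.of_wp ?_).mono (by simp [Cmd.cost, block]) fun _ => id
    obtain ⟨k1, k2, k3, k4, k5⟩ := hreg
    refine wp_cons (wp_assign v (by omega) (by omega) ?_ ?_)
    · rw [eval_var (by omega), k1]
    refine wp_cons (wp_assign (rankLo X (extend a) t v 0) (by omega) (by omega) ?_ ?_)
    · simp (disch := omega) only [eval_var, Function.update_of_ne, k4]
    refine wp_cons (wp_assign (rankHi X (extend b) t v 0) (by omega) (by omega) ?_ ?_)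
    · simp (disch := omega) only [eval_var, Function.update_of_ne, k5]
    refine ⟨rfl, fun y hy => ?_, ⟨?_, ?_, ?_, ?_, ?_⟩⟩ <;>
      simp (disch := omega) only [Function.update_of_ne, Function.update_self, k2, k3]
  · rintro s₃ ⟨k1, k2, k3⟩
    rw [← h4]
    have e : walkSet l r x v 0 = Set.Ico v (v + 2 ^ 0) := by rw [walkSet, pow_zero]
    rw [e] at h3 ⊢
    refine (run_pass E hInv ho ho' hbody hd hv.levels
      (by rw [k2 _ (by omega), h1 _ (by omega) (by omega), hr.e]) (by omega) (by omega) h5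
      k3 (hInv.stable _ _ _ h2 k1 fun y hy => k2 y (by omega)) h3).mono le_rfl ?_
    rintro s₄ ⟨k4, k5⟩
    refine ⟨k4, fun y hy hy' => ?_⟩
    rw [k5 y hy (by omega), k2 y hy', h1 y hy hy']

theorem run_stage (E : Setting W D a b κ K B base X idx C) {Inv : Finset (Fin N) → State → Prop}
    (hInv : IsAccumulator base B N K Inv) {body : Cmd d} {o j T : ℕ}
    (ho : base ≤ o) (ho' : o + 64 ≤ base + 32 * (d + 1))
    (hbody : BodySpec W D a b K base X Inv body (j + 1) (o + 32) T) (hd : j + 1 < d) :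
    BodySpec W D a b K base X Inv (stage κ o (j + 1) body) j o ((K + 1) * (2 * T + 1300)) := by
  rintro t u h l r S s rfl hv hr hS hdisj
  have hbase := E.hbase
  have hW := E.hW
  have hD := E.hD
  have hsize := E.size
  have hlN := hv.l_le
  have hrN := hv.r_le
  have hrw := hv.r_le'
  have hul := hv.u_le_l
  refine (Run.ite (T := 5 + ((K + 1) * (T + 600) + (16 + (K + 1) * (T + 600))))
    (fun hβ => ?_) (fun hβ => ?_)).mono ?_ fun _ => id
  · rw [Test.Holds, eval_var (by omega), eval_var (by omega), hr.l, hr.r] at hβ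
    refine (Run.seq (T₁ := 5) (Q₁ := fun s' => s'.out = s.out ∧ s'.mem (o + 6) = l ∧
      ∀ y, y < o + 6 → s'.mem y = s.mem y) ?_ (T₂ := (K + 1) * (T + 600) +
        (16 + (K + 1) * (T + 600))) ?_).mono (by omega) fun _ => id
    · refine (Run.of_wp ?_).mono (by simp [Cmd.cost, block]) fun _ => id
      refine wp_cons (wp_assign l (by omega) (by omega) ?_ ?_)
      · rw [eval_var (by omega), hr.l]
      refine ⟨rfl, ?_, fun y hy => ?_⟩ <;>
        simp (disch := omega) only [Function.update_of_ne, Function.update_self]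
    rintro s₁ ⟨h1, h2, h3⟩
    have hr₁ : NodeRegs s₁.mem o K t u h l r := by
      obtain ⟨k1, k2, k3, k4, k5, k6⟩ := hr
      constructor <;> rw [h3 _ (by omega)] <;> assumption
    have hS₁ : Inv S s₁ := hInv.stable _ _ _ hS h1 fun y hy => h3 y (by omega)
    -- For `r = l + 1` the second walk is skipped, since it would count the same position twice.
    have hsub : walkSet l r l u h ⊆ Set.Ico l r ∧ (l + 1 < r →
        walkSet l r l u h ∪ walkSet l r (r - 1) u h = Set.Ico l r ∧
        Disjoint (walkSet l r l u h) (walkSet l r (r - 1) u h)) ∧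
        (r = l + 1 → walkSet l r l u h = Set.Ico l r) := by
      rcases Nat.lt_or_ge (l + 1) r with h4 | h4
      · have := walkSet_union l r h4 u h hul hrw
        exact ⟨this.1 ▸ Set.subset_union_left, fun _ => this, fun h5 => by omega⟩
      · obtain rfl : r = l + 1 := by omega
        have := walkSet_left_single l u h hul (by omega)
        exact ⟨this.le, fun h5 => by omega, fun _ => this⟩
    obtain ⟨hsub1, hsub2, hsub3⟩ := hsub
    refine Run.seq (run_walk E hInv ho ho' hbody hd hv hr₁ h2 hul (by omega) (by omega) hS₁
      (hdisj.mono_right (slab_mono t hsub1))) ?_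
    rintro s₂ ⟨h4, h5⟩
    have hr₂ : NodeRegs s₂.mem o K t u h l r := by
      obtain ⟨k1, k2, k3, k4, k5, k6⟩ := hr₁
      constructor <;> rw [h5 _ (by omega) (by omega)] <;> assumption
    refine (Run.ite (T := 8 + (K + 1) * (T + 600)) (fun hβ' => ?_) (fun hβ' => ?_)).mono
      (by simp [Test.cost]; omega) fun _ => id
    · have hlr : l + 1 < r := by
        simpa (disch := omega) only [Test.Holds, eval_add, eval_var, eval_lit, hr₂.l, hr₂.r,
          Nat.mod_eq_of_lt] using hβ'
      obtain ⟨hun, hdis⟩ := hsub2 hlr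
      refine (Run.seq (T₁ := 8) (Q₁ := fun s' => s'.out = s₂.out ∧ s'.mem (o + 6) = r - 1 ∧
        ∀ y, y < o + 6 → s'.mem y = s₂.mem y) ?_ (T₂ := (K + 1) * (T + 600)) ?_)
      · refine (Run.of_wp ?_).mono (by simp [Cmd.cost, block]) fun _ => id
        refine wp_cons (wp_assign (r - 1) (by omega) (by omega) ?_ ?_)
        · simp (disch := omega) only [eval_sub, eval_var, eval_lit, hr₂.r, Nat.mod_eq_of_lt]
        refine ⟨rfl, ?_, fun y hy => ?_⟩ <;>
          simp (disch := omega) only [Function.update_of_ne, Function.update_self]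
      rintro s₃ ⟨h6, h7, h8⟩
      have hr₃ : NodeRegs s₃.mem o K t u h l r := by
        obtain ⟨k1, k2, k3, k4, k5, k6⟩ := hr₂
        constructor <;> rw [h8 _ (by omega)] <;> assumption
      refine (run_walk E hInv ho ho' hbody hd hv hr₃ h7 (by omega) (by omega) (by omega)
        (hInv.stable _ _ _ h4 h6 fun y hy => h8 y (by omega)) ?_).mono le_rfl ?_
      · rw [Finset.disjoint_union_left]
        exact ⟨hdisj.mono_right (slab_mono t (hun ▸ Set.subset_union_right)),
          slab_disjoint t hdis⟩
      · rintro s₄ ⟨h9, h10⟩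
        rw [Finset.union_assoc, ← slab_union, hun] at h9
        refine ⟨h9, fun y hy hy' => ?_⟩
        rw [h10 y hy (by omega), h8 y (by omega), h5 y hy (by omega), h3 y (by omega)]
    · have hlr : ¬ l + 1 < r := by
        simpa (disch := omega) only [Test.Holds, eval_add, eval_var, eval_lit, hr₂.l, hr₂.r,
          Nat.mod_eq_of_lt] using hβ'
      rw [hsub3 (by omega)] at h4
      refine (Run.skip ⟨h4, fun y hy hy' => ?_⟩).mono (by omega) fun _ => id
      rw [h5 y hy (by omega), h3 y (by omega)]
  · rw [Test.Holds, eval_var (by omega), eval_var (by omega), hr.l, hr.r] at hβ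
    rw [Set.Ico_eq_empty hβ, slab_empty, Finset.union_empty]
    exact (Run.skip ⟨hS, fun _ _ _ => rfl⟩).mono (by omega) fun _ => id
  · simp [Test.cost]
    nlinarith

end Specs

end ColorRange

namespace ColorRange

/-! ### Traversal of a range tree -/

section Programs

variable {d : ℕ}

/-- The last `k` stages of a traversal, followed by `leaf`. -/
def stages (κ base : ℕ) (leaf : Cmd d) : ℕ → Cmd d
  | 0 => leaf
  | k + 1 => stage κ (base + 32 * (d - 1 - (k + 1))) (d - 1 - (k + 1) + 1) (stages κ base leaf k)

/-- Run `leaf` on intervals of a range tree that make up the points in the query. -/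
def traverse (κ base : ℕ) (leaf : Cmd d) : Cmd d :=
  .seq (block [assign base (.lit 0), assign (base + 1) (.lit 0),
      assign (base + 2) (.word (.lit 2)), assign (base + 3) (var 2 - .lit 1)])
    (.seq (search base (base + 4) (testLow κ (.lit 0) base 0))
      (.seq (search base (base + 5) (testHigh κ (.lit 0) base 0)) (stages κ base leaf (d - 1))))

/-- Time bound for the last `k` stages. -/
def stageTime (K T : ℕ) : ℕ → ℕ
  | 0 => T
  | k + 1 => (K + 1) * (2 * stageTime K T k + 1300)

/-- Time bound for a traversal. -/
def traverseTime (d K T : ℕ) : ℕ := K * 140 + 100 + stageTime K T (d - 1)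

end Programs

/-- Shifting by 1300 absorbs the additive term, so each stage multiplies by at most `2 * (K + 1)`.
-/
theorem stageTime_le (K T k : ℕ) : stageTime K T k + 1300 ≤ (2 * (K + 1)) ^ k * (T + 1300) := by
  induction k with
  | zero => simp [stageTime]
  | succ k ih =>
    rw [stageTime, pow_succ]
    calc (K + 1) * (2 * stageTime K T k + 1300) + 1300
        ≤ 2 * (K + 1) * (stageTime K T k + 1300) := by nlinarith
      _ ≤ 2 * (K + 1) * ((2 * (K + 1)) ^ k * (T + 1300)) := by gcongr
      _ = _ := by ring

/-! ### Traversals of a range tree, with counting as the first use. -/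

section Specs

variable {d W : ℕ} {D : Store} {a b : Fin d → ℝ} {κ K N B base : ℕ} {X : Fin N → ℕ → ℝ}
  {idx C : Fin N → ℕ}

theorem run_stages (E : Setting W D a b κ K B base X idx C)
    {Inv : Finset (Fin N) → State → Prop} (hInv : IsAccumulator base B N K Inv) {leaf : Cmd d}
    {T : ℕ} (hleaf : BodySpec W D a b K base X Inv leaf (d - 1) (base + 32 * (d - 1)) T)
    (k : ℕ) (hk : k < d) :
    BodySpec W D a b K base X Inv (stages κ base leaf k) (d - 1 - k)
      (base + 32 * (d - 1 - k)) (stageTime K T k) := by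
  induction k with
  | zero => exact hleaf
  | succ k ih =>
    have h1 := ih (by omega)
    have e : d - 1 - k = d - 1 - (k + 1) + 1 := by omega
    rw [e] at h1
    exact run_stage E hInv (by omega) (by omega) h1 (by omega)

open Classical in
/-- The points of a tree in the box between `A` and `B`. -/
noncomputable def boxSet {N : ℕ} (X : Fin N → ℕ → ℝ) (d : ℕ) (A B : ℕ → ℝ) : Finset (Fin N) :=
  Finset.univ.filter fun k => ∀ j < d, A j ≤ X k j ∧ X k j ≤ B j

/-- Only coordinate 0 needs separate treatment: two searches in the root order produce the interval
on which `run_stages` takes over, starting from the empty accumulator. -/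
theorem run_traverse (E : Setting W D a b κ K B base X idx C) (h0 : 0 < d)
    (hpow : D.words.getD 2 0 = 2 ^ (K - 1))
    {Inv : Finset (Fin N) → State → Prop} (hInv : IsAccumulator base B N K Inv) {leaf : Cmd d}
    {T : ℕ} (hleaf : BodySpec W D a b K base X Inv leaf (d - 1) (base + 32 * (d - 1)) T)
    {s : State} (hS : Inv ∅ s) :
    Run W D a b (traverse κ base leaf) s (traverseTime d K T)
      (Inv (boxSet X d (extend a) (extend b))) := by
  have hbase := E.hbase
  have hW := E.hW
  have hD := E.hD
  have hsize := E.size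
  have hK := E.tree.pos
  have hN := E.tree.le
  have hpK : 2 ^ (K - 1) < 2 ^ K := Nat.pow_lt_pow_right (by omega) (by omega)
  have hKK : K < 2 ^ K := Nat.lt_two_pow_self
  obtain ⟨hm0, hm1, hm2⟩ := hInv.regs _ _ hS
  refine (Run.seq (T₁ := 20) (Q₁ := fun s' => s'.out = s.out ∧
    (∀ x, x < base → s'.mem x = s.mem x) ∧ s'.mem base = code K [] ∧ s'.mem (base + 1) = 0 ∧
    s'.mem (base + 2) = 2 ^ (K - 1) ∧ s'.mem (base + 3) = K - 1) ?_
    (T₂ := K * 140 + 80 + stageTime K T (d - 1)) ?_).mono (by unfold traverseTime; omega)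
    fun _ => id
  · refine (Run.of_wp ?_).mono (by simp [Cmd.cost, block, Expr.cost]) fun _ => id
    refine wp_cons (wp_assign 0 (by omega) (by omega) ?_ ?_)
    · rw [eval_lit, Nat.zero_mod]
    refine wp_cons (wp_assign 0 (by omega) (by omega) ?_ ?_)
    · rw [eval_lit, Nat.zero_mod]
    refine wp_cons (wp_assign (2 ^ (K - 1)) (by omega) (by omega) ?_ ?_)
    · rw [eval_word, eval_lit, Nat.mod_eq_of_lt (by omega), hpow]
    refine wp_cons (wp_assign (K - 1) (by omega) (by omega) ?_ ?_)
    · simp (disch := omega) only [eval_sub, eval_var, eval_lit, Function.update_of_ne, hm2,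
        Nat.mod_eq_of_lt]
    refine ⟨rfl, fun x hx => ?_, ?_, ?_, ?_, ?_⟩ <;>
      simp (disch := omega) only [Function.update_of_ne, Function.update_self, code]
  rintro s₁ ⟨h1, h2, h3, h4, h5, h6⟩
  refine (Run.seq (run_search (N := N) (u := 0) (w := 2 ^ (K - 1)) (k := K)
    (g := fun i => X (ord X [] i) 0 < extend a 0) (by omega)
    (by omega) (by omega) (by omega) (by omega) ?_ h4 h5 (Nat.zero_le _) (by omega) hpK ?_ ?_)
    (T₂ := K * 70 + 28 + stageTime K T (d - 1)) ?_).mono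
    (T' := K * 140 + 80 + stageTime K T (d - 1)) ?_ fun _ => id
  · rw [h2 _ (by omega), hm1]
  · intro i j _ h7 _ h9
    exact (Tuple.monotone_sort (fun i => X i 0) h7).trans_lt h9
  · intro m hm i _ _ h8
    have hx : (var (base + 13)).eval W D m = i := by rw [eval_var (by omega), h8]
    rw [testLow, Test.Holds, eval_lowKey h0, eval_cellKey E (t := []) ⟨by
      rw [hm _ (by omega) (by omega) (by omega), h2 _ (by omega), hm0],
      by rw [hm _ (by omega) (by omega) (by omega), h2 _ (by omega), hm1],
      by rw [hm _ (by omega) (by omega) (by omega), h2 _ (by omega), hm2]⟩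
      (by rw [eval_lit, Nat.zero_mod]; rfl) hx (by simp) h0 h0]
  · rintro s₂ ⟨h7, h8, h9⟩
    refine (Run.seq (run_search (N := N) (u := 0) (w := 2 ^ (K - 1)) (k := K)
      (g := fun i => X (ord X [] i) 0 ≤ extend b 0) (by omega)
      (by omega) (by omega) (by omega) (by omega) ?_ ?_ ?_ (Nat.zero_le _) (by omega) hpK ?_ ?_)
      (T₂ := stageTime K T (d - 1)) ?_).mono
      (T' := K * 70 + 28 + stageTime K T (d - 1)) ?_ fun _ => id
    · rw [h8 _ (by omega) (by omega) (by omega), h2 _ (by omega), hm1]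
    · rw [h8 _ (by omega) (by omega) (by omega), h4]
    · rw [h8 _ (by omega) (by omega) (by omega), h5]
    · intro i j _ h7 _ h9
      exact (Tuple.monotone_sort (fun i => X i 0) h7).trans h9
    · intro m hm i _ _ h10
      have hx : (var (base + 13)).eval W D m = i := by rw [eval_var (by omega), h10]
      have e : ∀ x < base, m x = s.mem x := fun x hx => by
        rw [hm _ (by omega) (by omega) (by omega), h8 _ (by omega) (by omega) (by omega), h2 _ hx]
      rw [testHigh, Test.Holds, Test.Holds, eval_highKey h0, eval_cellKey E (t := []) ⟨by
        rw [e _ (by omega), hm0], by rw [e _ (by omega), hm1], by rw [e _ (by omega), hm2]⟩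
        (by rw [eval_lit, Nat.zero_mod]; rfl) hx (by simp) h0 h0, not_lt]
    · rintro s₃ ⟨h10, h11, h12⟩
      rw [Nat.zero_add] at h9 h12
      set l := countIn (fun i => X (ord X [] i) 0 < extend a 0) 0 (2 ^ (K - 1))
      set r := countIn (fun i => X (ord X [] i) 0 ≤ extend b 0) 0 (2 ^ (K - 1))
      have hl : 0 + l ≤ min (0 + 2 ^ (K - 1)) N := countIn_le _ _ _ (Nat.zero_le _)
      have hr : 0 + r ≤ min (0 + 2 ^ (K - 1)) N := countIn_le _ _ _ (Nat.zero_le _)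
      have hbox : slab X d (extend a) (extend b) [] (Set.Ico l r) =
          boxSet X d (extend a) (extend b) := by
        ext k
        rw [mem_slab_root (K - 1) hN h0]
        simp [boxSet]
      have hst := run_stages E hInv hleaf (d - 1) (by omega) [] 0 (K - 1) l r ∅ s₃ (by simp)
        ⟨by simp, dvd_zero _, by omega, by omega, by omega, by omega, by omega, by omega⟩ ?_ ?_
        (Finset.disjoint_empty_left _)
      · rw [hbox, Finset.empty_union] at hst
        exact hst.mono le_rfl fun _ h => h.1
      · rw [Nat.sub_self, Nat.mul_zero, Nat.add_zero]
        constructor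
        · rw [h11 _ (by omega) (by omega) (by omega), h8 _ (by omega) (by omega) (by omega), h3]
        · rw [h11 _ (by omega) (by omega) (by omega), h8 _ (by omega) (by omega) (by omega), h4]
        · rw [h11 _ (by omega) (by omega) (by omega), h8 _ (by omega) (by omega) (by omega), h5]
        · rw [h11 _ (by omega) (by omega) (by omega), h8 _ (by omega) (by omega) (by omega), h6]
        · rw [h11 _ (by omega) (by omega) (by omega), h9]
        · rw [h12]
      · refine hInv.stable _ _ _ hS (by rw [h10, h7, h1]) fun x hx => ?_
        rw [h11 _ (by omega) (by omega) (by omega), h8 _ (by omega) (by omega) (by omega),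
          h2 _ hx]
    · have : (testHigh κ (.lit 0) base 0 : Test d).cost ≤ 42 := by
        simp [testHigh, Test.cost, KeyExpr.cost, cellKey, highKey, h0, fieldExpr, Expr.cost]
      nlinarith
  · have : (testLow κ (.lit 0) base 0 : Test d).cost ≤ 42 := by
      simp [testLow, Test.cost, KeyExpr.cost, cellKey, lowKey, h0, fieldExpr, Expr.cost]
    nlinarith

/-- On the deepest levels no coordinate is left to check, so the slab is just an interval of
positions. -/
theorem card_slab {t : List ℕ} {l r : ℕ} {A B : ℕ → ℝ} (hd : d ≤ t.length + 1)
    (g : Fin N → Prop) [DecidablePred g] :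
    ((slab X d A B t (Set.Ico l r)).filter g).card =
      countIn (fun i => g (ord X t i)) l (r - l) := by
  classical
  unfold countIn
  refine Finset.card_bij (fun k _ => (ord X t).symm k) ?_ ?_ ?_
  · intro k hk
    simp only [Finset.mem_filter, mem_slab, Set.mem_Ico] at hk
    simp only [Finset.mem_filter, Finset.mem_univ, true_and, Equiv.apply_symm_apply]
    exact ⟨hk.1.1.1, by omega, hk.2⟩
  · intro k _ k' _ h
    exact (ord X t).symm.injective h
  · intro i hi
    simp only [Finset.mem_filter, Finset.mem_univ, true_and] at hi
    refine ⟨ord X t i, ?_, by simp⟩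
    simp only [Finset.mem_filter, mem_slab, Set.mem_Ico, Equiv.symm_apply_apply]
    exact ⟨⟨⟨hi.1, by omega⟩, fun j h1 h2 => by omega⟩, hi.2.2⟩

theorem countIn_zero (g : Fin N → Prop) (u : ℕ) : countIn g u 0 = 0 := by
  classical
  refine Finset.card_eq_zero.2 (Finset.eq_empty_of_forall_notMem fun i hi => ?_)
  rw [Finset.mem_filter] at hi
  omega

theorem card_slab_all {t : List ℕ} {l r : ℕ} {A B : ℕ → ℝ} (hd : d ≤ t.length + 1)
    (hr : r ≤ N) : (slab X d A B t (Set.Ico l r)).card = r - l := by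
  have h1 := card_slab (X := X) (A := A) (B := B) (l := l) (r := r) hd (fun _ => True)
  rw [Finset.filter_true] at h1
  rw [h1]
  rcases Nat.lt_or_ge r l with h2 | h2
  · rw [Nat.sub_eq_zero_of_le h2.le]
    exact countIn_zero _ _
  · have := countIn_eq_of_iff (g := fun _ : Fin N => True) (u := l) (w := r - l) (x := r) h2
      (by omega) hr (fun i h3 h4 => by simp; omega)
    omega

/-! ### Counting -/

/-- Add the length of the interval to the register 5. -/
def countLeaf (o : ℕ) : Cmd d := assign 5 (var 5 + (var (o + 5) - var (o + 4)))

/-- The register 5 holds the number of points so far; everything else below `base` is as in the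
state `s₀`. -/
def CountInv (base : ℕ) (s₀ : State) (S : Finset (Fin N)) (s : State) : Prop :=
  s.out = s₀.out ∧ (∀ x < base, x ≠ 5 → s.mem x = s₀.mem x) ∧ s.mem 5 = S.card

theorem countInv_isAccumulator {s₀ : State} (hbase : 6 ≤ base) (hm : TreeRegs s₀.mem B N K) :
    IsAccumulator base B N K (CountInv (N := N) base s₀) := by
  constructor
  · rintro S s ⟨-, h2, -⟩
    exact ⟨by rw [h2 _ (by omega) (by omega), hm.1], by rw [h2 _ (by omega) (by omega), hm.2.1],
      by rw [h2 _ (by omega) (by omega), hm.2.2]⟩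
  · rintro S s s' ⟨h1, h2, h3⟩ h4 h5
    exact ⟨h4.trans h1, fun x hx hx' => (h5 x hx).trans (h2 x hx hx'),
      (h5 5 (by omega)).trans h3⟩

theorem countLeaf_spec (E : Setting W D a b κ K B base X idx C) (h0 : 0 < d) (hbase : 6 ≤ base)
    (s₀ : State) : BodySpec W D a b K base X (CountInv (N := N) base s₀)
      (countLeaf (base + 32 * (d - 1))) (d - 1) (base + 32 * (d - 1)) 10 := by
  rintro t u h l r S s ht hv hr ⟨h1, h2, h3⟩ hdisj
  have hW := E.hW
  have hD := E.hD
  have hsize := E.size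
  have hcard : (S ∪ slab X d (extend a) (extend b) t (Set.Ico l r)).card = S.card + (r - l) := by
    rw [Finset.card_union_of_disjoint hdisj, card_slab_all (by omega) hv.r_le]
  have hle : (S ∪ slab X d (extend a) (extend b) t (Set.Ico l r)).card ≤ N := by
    simpa using Finset.card_le_univ (S ∪ slab X d (extend a) (extend b) t (Set.Ico l r))
  refine (Run.of_wp ?_).mono (by simp [countLeaf]) fun _ => id
  refine wp_assign (S.card + (r - l)) (by omega) (by omega) ?_ ⟨⟨h1, fun x hx hx' => ?_, ?_⟩,
    fun x hx hx' => ?_⟩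
  · simp (disch := omega) only [eval_add, eval_sub, eval_var, hr.l, hr.r, h3, Nat.mod_eq_of_lt]
  · simp (disch := omega) only [Function.update_of_ne]
    exact h2 x hx hx'
  · simp only [Function.update_self, hcard]
  · simp (disch := omega) only [Function.update_of_ne]

end Specs

end ColorRange

namespace ColorRange

/-! ### The space-saving algorithm for frequent colors

Colors are stored in the `m` cells from 16 on, their weights in the `m` cells after them. -/

section Slots

/-- The colors of the slots are distinct, and the weights add up to `total`. -/
def SlotsOk (m : ℕ) (mem : ℕ → ℕ) (total : ℕ) : Prop :=
  (∀ i < m, ∀ j < m, mem (16 + i) = mem (16 + j) → i = j) ∧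
    ∑ j ∈ Finset.range m, mem (16 + m + j) = total

/-- The slots certify the bound `v` on the weight of the color `c`. -/
def Covers (m : ℕ) (mem : ℕ → ℕ) (c v : ℕ) : Prop :=
  ∀ j < m, (mem (16 + j) = c ∨ ∀ i < m, mem (16 + i) ≠ c) → v ≤ mem (16 + m + j)

/-- `j` is the slot in which weight for the color `c` is to be placed. -/
def IsTarget (m : ℕ) (mem : ℕ → ℕ) (c j : ℕ) : Prop :=
  j < m ∧ (mem (16 + j) = c ∨
    (∀ i < m, mem (16 + i) ≠ c) ∧ ∀ i < m, mem (16 + m + j) ≤ mem (16 + m + i))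

/-- The memory after the color `c` gains weight `x` in the slot `j`. -/
structure IsUpdate (m : ℕ) (mem mem' : ℕ → ℕ) (c x j : ℕ) : Prop where
  color : mem' (16 + j) = c
  weight : mem' (16 + m + j) = mem (16 + m + j) + x
  color_ne : ∀ i < m, i ≠ j → mem' (16 + i) = mem (16 + i)
  weight_ne : ∀ i < m, i ≠ j → mem' (16 + m + i) = mem (16 + m + i)

variable {m : ℕ} {mem mem' : ℕ → ℕ} {c x j total : ℕ}

/-- Replacing a color is harmless for distinctness because it happens only when `c` occupies no
slot. The inherited weight stays in place, so the sum grows by exactly `x`. -/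
theorem IsUpdate.slotsOk (h : IsUpdate m mem mem' c x j) (hj : IsTarget m mem c j)
    (hs : SlotsOk m mem total) : SlotsOk m mem' (total + x) := by
  obtain ⟨hjm, hj⟩ := hj
  constructor
  · intro i hi i' hi' he
    by_cases h1 : i = j <;> by_cases h2 : i' = j
    · omega
    · subst h1
      rw [h.color, h.color_ne i' hi' h2] at he
      rcases hj with hj | hj
      · exact hs.1 i hi i' hi' (hj.trans he)
      · exact (hj.1 i' hi' he.symm).elim
    · subst h2
      rw [h.color, h.color_ne i hi h1] at he
      rcases hj with hj | hj
      · exact hs.1 i hi i' hi' (he.trans hj.symm)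
      · exact (hj.1 i hi he).elim
    · rw [h.color_ne i hi h1, h.color_ne i' hi' h2] at he
      exact hs.1 i hi i' hi' he
  · have hmem : j ∈ Finset.range m := Finset.mem_range.2 hjm
    have h1 := hs.2
    rw [← Finset.add_sum_erase _ _ hmem] at h1
    rw [← Finset.add_sum_erase _ _ hmem, h.weight, Finset.sum_congr rfl fun i hi => ?_, ← h1]
    · ring
    · rw [Finset.mem_erase, Finset.mem_range] at hi
      exact h.weight_ne i hi.2 hi.1

/-- Weights never decrease, so the critical case is a color that has just been evicted: its
certificate has to pass to all slots. -/
theorem IsUpdate.covers (h : IsUpdate m mem mem' c x j) (hj : IsTarget m mem c j) {c' v : ℕ}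
    (hc : Covers m mem c' v) : Covers m mem' c' v := by
  obtain ⟨hjm, hj⟩ := hj
  have hle : ∀ i < m, mem (16 + m + i) ≤ mem' (16 + m + i) := by
    intro i hi
    by_cases h1 : i = j
    · subst h1; rw [h.weight]; omega
    · rw [h.weight_ne i hi h1]
  intro i hi hi'
  refine le_trans ?_ (hle i hi)
  by_cases hcc : c' = c
  · subst hcc
    rcases hi' with hi' | hi'
    · by_cases h1 : i = j
      · subst h1
        exact hc i hi (hj.imp id fun h => h.1)
      · rw [h.color_ne i hi h1] at hi'
        exact hc i hi (.inl hi')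
    · exact (hi' j hjm h.color).elim
  · rcases hi' with hi' | hi'
    · by_cases h1 : i = j
      · subst h1
        exact (hcc (hi'.symm.trans h.color)).elim
      · rw [h.color_ne i hi h1] at hi'
        exact hc i hi (.inl hi')
    -- If `c'` was evicted, its slot had least weight, so its bound holds for every slot.
    · by_cases h2 : mem (16 + j) = c'
      · rcases hj with hj | hj
        · exact (hcc (h2.symm.trans hj)).elim
        · exact (hc j hjm (.inl h2)).trans (hj.2 i hi)
      · refine hc i hi (.inr fun i' hi1 => ?_)
        by_cases h3 : i' = j
        · rwa [h3]
        · rw [← h.color_ne i' hi1 h3]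
          exact hi' i' hi1

/-- Afterwards `c` sits in slot `j` and nowhere else. Before, that slot weighed at least `v`, either
as the slot of `c` or because `c` was absent and every slot did. -/
theorem IsUpdate.covers_add (h : IsUpdate m mem mem' c x j) (hj : IsTarget m mem c j) {v : ℕ}
    (hs : SlotsOk m mem total) (hc : Covers m mem c v) : Covers m mem' c (v + x) := by
  intro i hi hi'
  have hij : i = j := by
    rcases hi' with hi' | hi'
    · exact (h.slotsOk hj hs).1 i hi j hj.1 (hi'.trans h.color.symm)
    · exact (hi' j hj.1 h.color).elim
  subst hij
  rw [h.weight]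
  have := hc i hi (hj.2.imp id fun h => h.1)
  omega

theorem Covers.congr {c v : ℕ} (h : ∀ x, 16 ≤ x → x < 16 + 2 * m → mem' x = mem x)
    (hc : Covers m mem c v) : Covers m mem' c v := by
  intro j hj hj'
  rw [h _ (by omega) (by omega)] at hj' ⊢
  refine hc j hj (hj'.imp id fun h1 i hi => ?_)
  rw [← h _ (by omega) (by omega)]
  exact h1 i hi

theorem SlotsOk.congr (h : ∀ x, 16 ≤ x → x < 16 + 2 * m → mem' x = mem x)
    (hs : SlotsOk m mem total) : SlotsOk m mem' total := by
  constructor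
  · intro i hi j hj
    rw [h _ (by omega) (by omega), h _ (by omega) (by omega)]
    exact hs.1 i hi j hj
  · rw [← hs.2]
    refine Finset.sum_congr rfl fun i hi => ?_
    rw [Finset.mem_range] at hi
    rw [h _ (by omega) (by omega)]

end Slots

section Update

variable {d : ℕ}

/-- Find a slot of least weight among the first `i`. -/
def findMin (m : ℕ) : ℕ → Cmd d
  | 0 => assign 7 (.lit 0)
  | i + 1 => .seq (findMin m i) (.ite (.lt (var (16 + m + i)) (.work (.lit (16 + m) + var 7)))
      (assign 7 (.lit i)) .skip)

/-- Find a slot with the color in the register 8 among the first `i`. -/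
def findMatch : ℕ → Cmd d
  | 0 => .skip
  | i + 1 => .seq (findMatch i)
      (.ite (.conj (.neg (.lt (var (16 + i)) (var 8))) (.neg (.lt (var 8) (var (16 + i)))))
        (assign 7 (.lit i)) .skip)

/-- Add the weight in the register 9 to the color in the register 8. -/
def update (m : ℕ) : Cmd d :=
  .seq (findMin m m) (.seq (findMatch m) (block [.store (.lit 16 + var 7) (var 8),
    .store (.lit (16 + m) + var 7) (.work (.lit (16 + m) + var 7) + var 9)]))

variable {W : ℕ} {D : Store} {a b : Fin d → ℝ} {m : ℕ}

theorem wp_findMin (hW : 16 + 2 * m < 2 ^ W) (hD : 16 + 2 * m ≤ D.workCells) (hm : 0 < m)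
    (i : ℕ) (hi : i ≤ m) (s : State) :
    wp W D a b (findMin m i) (fun s' => s'.out = s.out ∧ (∀ x ≠ 7, s'.mem x = s.mem x) ∧
      s'.mem 7 < m ∧ ∀ j < i, s.mem (16 + m + s'.mem 7) ≤ s.mem (16 + m + j)) s := by
  induction i with
  | zero =>
    refine wp_assign 0 (by omega) (by omega) (by rw [eval_lit, Nat.zero_mod])
      ⟨rfl, fun x hx => Function.update_of_ne hx _ _, ?_, fun j hj => by omega⟩
    simpa only [Function.update_self] using hm
  | succ i ih =>
    refine (ih (by omega)).mono ?_
    rintro s₁ ⟨h1, h2, h3, h4⟩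
    have hc : (Test.lt (var (16 + m + i)) (.work (.lit (16 + m) + var 7)) : Test d).Holds
        W D a b s₁.mem ↔ s.mem (16 + m + i) < s.mem (16 + m + s₁.mem 7) := by
      rw [← h2 (16 + m + i) (by omega), ← h2 (16 + m + s₁.mem 7) (by omega)]
      simp (disch := omega) only [Test.Holds, eval_work, eval_add, eval_lit, eval_var,
        Nat.mod_eq_of_lt]
    refine ⟨fun h => ?_, fun h => ?_⟩ <;> rw [hc] at h
    · refine wp_assign i (by omega) (by omega) (by rw [eval_lit, Nat.mod_eq_of_lt (by omega)])
        ⟨h1, fun x hx => ?_, ?_, fun j hj => ?_⟩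
      · exact (Function.update_of_ne hx _ _).trans (h2 x hx)
      · simp only [Function.update_self]
        omega
      · simp only [Function.update_self]
        rcases Nat.lt_or_ge j i with h5 | h5
        · exact h.le.trans (h4 j h5)
        · obtain rfl : j = i := by omega
          exact le_rfl
    · refine ⟨h1, h2, h3, fun j hj => ?_⟩
      rcases Nat.lt_or_ge j i with h5 | h5
      · exact h4 j h5
      · obtain rfl : j = i := by omega
        exact not_lt.1 h

theorem wp_findMatch (hW : 16 + 2 * m < 2 ^ W) (hD : 16 + 2 * m ≤ D.workCells)
    (i : ℕ) (hi : i ≤ m) (s : State) :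
    wp W D a b (findMatch i) (fun s' => s'.out = s.out ∧ (∀ x ≠ 7, s'.mem x = s.mem x) ∧
      ((s'.mem 7 < m ∧ s.mem (16 + s'.mem 7) = s.mem 8) ∨
        s'.mem 7 = s.mem 7 ∧ ∀ j < i, s.mem (16 + j) ≠ s.mem 8)) s := by
  induction i with
  | zero => exact ⟨rfl, fun _ _ => rfl, .inr ⟨rfl, fun j hj => by omega⟩⟩
  | succ i ih =>
    refine (ih (by omega)).mono ?_
    rintro s₁ ⟨h1, h2, h3⟩
    have hc : (Test.conj (.neg (.lt (var (16 + i)) (var 8)))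
        (.neg (.lt (var 8) (var (16 + i)))) : Test d).Holds W D a b s₁.mem ↔
          s.mem (16 + i) = s.mem 8 := by
      rw [← h2 (16 + i) (by omega), ← h2 8 (by omega)]
      simp (disch := omega) only [Test.Holds, eval_var]
      omega
    refine ⟨fun h => ?_, fun h => ?_⟩ <;> rw [hc] at h
    · refine wp_assign i (by omega) (by omega) (by rw [eval_lit, Nat.mod_eq_of_lt (by omega)])
        ⟨h1, fun x hx => ?_, ?_⟩
      · exact (Function.update_of_ne hx _ _).trans (h2 x hx)
      · simp only [Function.update_self]
        exact .inl ⟨by omega, h⟩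
    · refine ⟨h1, h2, h3.imp id fun h4 => ⟨h4.1, fun j hj => ?_⟩⟩
      rcases Nat.lt_or_ge j i with h5 | h5
      · exact h4.2 j h5
      · obtain rfl : j = i := by omega
        exact h

/-- The minimum is computed first and overridden by a matching slot, if there is one; the outcome is
an `IsTarget` in both cases. -/
theorem wp_update (hW : 16 + 2 * m < 2 ^ W) (hD : 16 + 2 * m ≤ D.workCells) (hm : 0 < m)
    (s : State) (hov : ∀ j < m, s.mem (16 + m + j) + s.mem 9 < 2 ^ W) :
    wp W D a b (update m) (fun s' => s'.out = s.out ∧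
      (∀ x, x ≠ 7 → (x < 16 ∨ 16 + 2 * m ≤ x) → s'.mem x = s.mem x) ∧
      ∃ j, IsTarget m s.mem (s.mem 8) j ∧ IsUpdate m s.mem s'.mem (s.mem 8) (s.mem 9) j) s := by
  refine (wp_findMin hW hD hm m le_rfl s).mono ?_
  rintro s₁ ⟨h1, h2, h3, h4⟩
  refine (wp_findMatch hW hD m le_rfl s₁).mono ?_
  rintro s₂ ⟨g1, g2, g3⟩
  have hmem : ∀ x ≠ 7, s₂.mem x = s.mem x := fun x hx => (g2 x hx).trans (h2 x hx)
  have hj : s₂.mem 7 < m := by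
    rcases g3 with g3 | g3
    · exact g3.1
    · rw [g3.1]; exact h3
  have htarget : IsTarget m s.mem (s.mem 8) (s₂.mem 7) := by
    refine ⟨hj, ?_⟩
    rcases g3 with g3 | g3
    · rw [h2 _ (by omega), h2 _ (by omega)] at g3
      exact .inl g3.2
    · rw [g3.1]
      refine .inr ⟨fun i hi => ?_, h4⟩
      rw [← h2 _ (by omega), ← h2 8 (by omega)]
      exact g3.2 i hi
  generalize hjj : s₂.mem 7 = j at *
  have hov' := hov j hj
  have e1 : (Expr.lit 16 + var 7).eval W D s₂.mem = 16 + j := by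
    simp (disch := omega) only [eval_add, eval_lit, eval_var, hjj, Nat.mod_eq_of_lt]
  have e2 : (var 8).eval W D s₂.mem = s.mem 8 := by
    rw [eval_var (by omega), hmem _ (by omega)]
  refine wp_cons ⟨by rw [e1]; omega, wp_cons ?_⟩
  rw [e1, e2]
  have e3 : (Expr.lit (16 + m) + var 7).eval W D
      (Function.update s₂.mem (16 + j) (s.mem 8)) = 16 + m + j := by
    simp (disch := omega) only [eval_add, eval_lit, eval_var, Function.update_of_ne, hjj,
      Nat.mod_eq_of_lt]
  have e4 : (Expr.work (.lit (16 + m) + var 7) + var 9).eval W D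
      (Function.update s₂.mem (16 + j) (s.mem 8)) = s.mem (16 + m + j) + s.mem 9 := by
    rw [eval_add, eval_work, e3]
    simp (disch := omega) only [eval_var, Function.update_of_ne, hmem, Nat.mod_eq_of_lt]
  refine ⟨by rw [e3]; omega, ?_⟩
  rw [e3, e4]
  refine ⟨g1.trans h1, fun x hx hx' => ?_, j, htarget, ⟨?_, ?_, fun i hi hij => ?_,
    fun i hi hij => ?_⟩⟩
  all_goals simp (disch := omega) only [Function.update_of_ne, Function.update_self, hmem]

end Update

end ColorRange

namespace ColorRange

/-! ### Candidates for dominating colors -/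

section Programs

variable {d : ℕ}

/-- Give the weight in the register 9 to the `i`-th color that is frequent in the window whose
start is in the cell `z`. -/
def probe (κ m o z i : ℕ) : Cmd d :=
  .seq (assign 8 (fieldExpr κ (var o) (var 11 * .lit κ + .lit i + .lit 4) (var z))) (update m)

/-- Give weight to the first `i` frequent colors of both windows. -/
def probes (κ m o : ℕ) : ℕ → Cmd d
  | 0 => .skip
  | i + 1 => .seq (probes κ m o i) (.seq (probe κ m o (o + 4) i) (probe κ m o 10 i))

/-- Give weight to the frequent colors of two windows that cover the interval. -/
def heavyLeaf (κ m o : ℕ) : Cmd d :=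
  .ite (.lt (var (o + 4)) (var (o + 5)))
    (.seq (block [assign 9 (var (o + 5) - var (o + 4)),
      assign 11 (fieldExpr κ (var o) (.lit 2) (var 9)),
      assign 10 (var (o + 5) - fieldExpr κ (var o) (.lit 3) (var 9))])
    (probes κ m o κ)) .skip

end Programs

/-! ### Frequent colors of dyadic windows. -/

section Windows

variable {N : ℕ} {κ : ℕ} {X : Fin N → ℕ → ℝ} {C : Fin N → ℕ} {t : List ℕ}

theorem sum_windowCount_le (x w : ℕ) (F : Finset ℕ) :
    ∑ c ∈ F, windowCount X C t x w c ≤ w := by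
  classical
  have h1 : ∑ c ∈ F, windowCount X C t x w c ≤ (Finset.univ.filter fun i : Fin N =>
      x ≤ i ∧ (i : ℕ) < x + w).card := by
    unfold windowCount countIn
    rw [← Finset.card_biUnion]
    · refine Finset.card_le_card fun i hi => ?_
      simp only [Finset.mem_biUnion, Finset.mem_filter, Finset.mem_univ, true_and] at hi ⊢
      obtain ⟨c, -, h1, h2, -⟩ := hi
      exact ⟨h1, h2⟩
    · intro c _ c' _ hcc
      refine Finset.disjoint_left.2 fun i h1 h2 => hcc ?_
      simp only [Finset.mem_filter] at h1 h2
      exact h1.2.2.2.symm.trans h2.2.2.2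
  refine h1.trans ?_
  have : (Finset.univ.filter fun i : Fin N => x ≤ i ∧ (i : ℕ) < x + w).card ≤
      (Finset.Ico x (x + w)).card := by
    refine Finset.card_le_card_of_injOn (fun i => (i : ℕ)) ?_ ?_
    · intro i hi
      simpa using hi
    · intro i _ j _ h
      exact Fin.ext h
  simpa using this

/-- Counts of different colors in a window of length `2 ^ g` sum to at most `2 ^ g`, and each listed
color uses a `1/κ` share. -/
theorem card_heavyColors_le (g x : ℕ) : (heavyColors κ X C t g x).card ≤ κ := by
  have h1 : (heavyColors κ X C t g x).card * 2 ^ g ≤ κ * 2 ^ g := by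
    calc (heavyColors κ X C t g x).card * 2 ^ g = ∑ c ∈ heavyColors κ X C t g x, 2 ^ g := by simp
      _ ≤ ∑ c ∈ heavyColors κ X C t g x, κ * windowCount X C t x (2 ^ g) c := by
        refine Finset.sum_le_sum fun c hc => ?_
        rw [heavyColors, Finset.mem_filter] at hc
        exact hc.2
      _ = κ * ∑ c ∈ heavyColors κ X C t g x, windowCount X C t x (2 ^ g) c := by
        rw [Finset.mul_sum]
      _ ≤ κ * 2 ^ g := by gcongr; exact sum_windowCount_le _ _ _
  exact Nat.le_of_mul_le_mul_right h1 (by positivity)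

/-- The `i`-th frequent color of a window. -/
noncomputable def heavyColor (κ : ℕ) (X : Fin N → ℕ → ℝ) (C : Fin N → ℕ) (t : List ℕ)
    (g x i : ℕ) : ℕ :=
  (heavyColors κ X C t g x).toList.getD i 0

theorem exists_heavyColor {g x c : ℕ} (hc : 2 ^ g ≤ κ * windowCount X C t x (2 ^ g) c) :
    ∃ i < κ, heavyColor κ X C t g x i = c := by
  classical
  have hmem : c ∈ (heavyColors κ X C t g x).toList := by
    rw [Finset.mem_toList, heavyColors, Finset.mem_filter]
    refine ⟨?_, hc⟩
    by_contra hne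
    have : windowCount X C t x (2 ^ g) c = 0 := by
      unfold windowCount countIn
      refine Finset.card_eq_zero.2 (Finset.eq_empty_of_forall_notMem fun i hi => ?_)
      simp only [Finset.mem_filter] at hi
      exact hne (Finset.mem_image.2 ⟨_, Finset.mem_univ _, hi.2.2.2⟩)
    rw [this] at hc
    have := Nat.two_pow_pos g
    omega
  obtain ⟨i, hi, rfl⟩ := List.getElem_of_mem hmem
  refine ⟨i, ?_, ?_⟩
  · rw [Finset.length_toList] at hi
    exact hi.trans_le (card_heavyColors_le g x)
  · rw [heavyColor, List.getD_eq_getElem _ _ hi]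

theorem fieldVal_heavy {idx : Fin N → ℕ} {g x i : ℕ} (hi : i < κ) :
    fieldVal κ X idx C t (g * κ + i + 4) x = heavyColor κ X C t g x i := by
  have h1 : (g * κ + i) / κ = g := by
    rw [mul_comm, Nat.mul_add_div (by omega), Nat.div_eq_of_lt hi, Nat.add_zero]
  have h2 : (g * κ + i) % κ = i := by
    rw [mul_comm, Nat.mul_add_mod, Nat.mod_eq_of_lt hi]
  change (heavyColors κ X C t ((g * κ + i) / κ) x).toList.getD ((g * κ + i) % κ) 0 = _
  rw [h1, h2, heavyColor]

/-- The windows flush with the two ends may overlap; for an upper bound, covering the interval is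
enough. -/
theorem windowCount_le_add {l r w c : ℕ} (hw : r - l ≤ 2 * w) (hlr : l ≤ r) :
    windowCount X C t l (r - l) c ≤
      windowCount X C t l w c + windowCount X C t (r - w) w c := by
  classical
  unfold windowCount countIn
  refine le_trans (Finset.card_le_card fun i hi => ?_) (Finset.card_union_le _ _)
  simp only [Finset.mem_filter, Finset.mem_univ, true_and, Finset.mem_union] at hi ⊢
  rcases Nat.lt_or_ge i (l + w) with h1 | h1
  · exact .inl ⟨hi.1, h1, hi.2.2⟩
  · exact .inr ⟨by omega, by omega, hi.2.2⟩

end Windows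

/-! ### Correctness of candidate generation. -/

section Specs

variable {d W : ℕ} {D : Store} {a b : Fin d → ℝ} {κ K N B m : ℕ} {X : Fin N → ℕ → ℝ}
  {idx C : Fin N → ℕ}

/-- The effect of giving the weight `y` to the color `c`. -/
def Gains (m : ℕ) (mem mem' : ℕ → ℕ) (cs : Set ℕ) (v : ℕ) : Prop :=
  ∀ c w, Covers m mem c w → Covers m mem' c w ∧ (c ∈ cs → Covers m mem' c (w + v))

theorem wp_probe (E : Setting W D a b κ K B (16 + 2 * m) X idx C) (h0 : 0 < d) (hm : 0 < m)
    {o z i x y g total : ℕ} {t : List ℕ} {s : State} (hoW : o < 2 ^ W) (hz : z < 2 ^ W)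
    (hreg : TreeRegs s.mem B N K) (he : s.mem o = code K t) (hx : s.mem z = x)
    (hy : s.mem 9 = y) (hg : s.mem 11 = g) (hlev : ∀ y ∈ t, y < K) (ht : t.length < d)
    (hxN : x ≤ N) (hgK : g < K) (hi : i < κ) (hs : SlotsOk m s.mem total)
    (htot : total + y < 2 ^ W) :
    wp W D a b (probe κ m o z i) (fun s' => s'.out = s.out ∧
      (∀ x, x ≠ 7 → x ≠ 8 → (x < 16 ∨ 16 + 2 * m ≤ x) → s'.mem x = s.mem x) ∧
      SlotsOk m s'.mem (total + y) ∧ Gains m s.mem s'.mem {heavyColor κ X C t g x i} y) s := by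
  have hW := E.hW
  have hD := E.hD
  have hκ := E.hκ
  have hb := E.tree.bound
  have hgκ : g * κ + κ ≤ κ * K := by nlinarith
  have hF : 1 * (4 + κ * K) * 1 ≤ (K + 1) ^ (d - 1) * (4 + κ * K) * (N + 1) := by
    gcongr
    · exact Nat.one_le_pow _ _ (by omega)
    · omega
  change wp W D a b (assign 8 _) (wp W D a b (update m) _) s
  refine wp_assign (heavyColor κ X C t g x i) (by omega) (by omega) ?_ ?_
  · rw [← fieldVal_heavy (idx := idx) hi]
    refine eval_field E.tree hreg E.hκ ?_ ?_ ?_ hlev ht (by omega) hxN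
    · rw [eval_var hoW, he]
    · simp (disch := omega) only [eval_add, eval_mul, eval_lit, eval_var, hg, Nat.mod_eq_of_lt]
    · rw [eval_var hz, hx]
  set c := heavyColor κ X C t g x i
  have hcong : ∀ x, 16 ≤ x → x < 16 + 2 * m →
      Function.update s.mem 8 c x = s.mem x := fun x h1 _ =>
    Function.update_of_ne (by omega) _ _
  have hs₁ : SlotsOk m (Function.update s.mem 8 c) total := hs.congr hcong
  refine (wp_update (by omega) (by omega) hm _ ?_).mono ?_
  · intro j hj
    have h1 : Function.update s.mem 8 c 9 = y := by
      rw [Function.update_of_ne (by omega), hy]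
    -- A single weight is at most the total, which excludes overflow when `y` is added.
    have h2 := Finset.single_le_sum
      (f := fun j => Function.update s.mem 8 c (16 + m + j))
      (fun _ _ => Nat.zero_le _) (Finset.mem_range.2 hj)
    rw [hs₁.2] at h2
    simp only [h1]
    omega
  · rintro s' ⟨h1, h2, j, h3, h4⟩
    simp only [Function.update_self, Function.update_of_ne (show 9 ≠ 8 by omega), hy] at h3 h4
    refine ⟨h1, fun x h5 h6 h7 => ?_, h4.slotsOk h3 hs₁, fun c' w hc => ?_⟩
    · rw [h2 x h5 h7]
      exact Function.update_of_ne h6 _ _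
    · refine ⟨h4.covers h3 (hc.congr hcong), ?_⟩
      rintro rfl
      exact h4.covers_add h3 hs₁ (hc.congr hcong)

/-- Exactly two gains of `y` occur per index, even when a color is listed twice or the list has
ended and the default color 0 is read. Surplus weight only affects the total; a certificate is
claimed to rise by just one `y`. -/
theorem wp_probes (E : Setting W D a b κ K B (16 + 2 * m) X idx C) (h0 : 0 < d) (hm : 0 < m)
    {o x x' y g total : ℕ} {t : List ℕ} {s : State} (ho : 16 + 2 * m ≤ o)
    (hoW : o + 32 ≤ 2 ^ W)
    (hreg : TreeRegs s.mem B N K) (he : s.mem o = code K t) (hx : s.mem (o + 4) = x)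
    (hx' : s.mem 10 = x')
    (hy : s.mem 9 = y) (hg : s.mem 11 = g) (hlev : ∀ y ∈ t, y < K) (ht : t.length < d)
    (hxN : x ≤ N) (hxN' : x' ≤ N) (hgK : g < K) (hs : SlotsOk m s.mem total)
    (htot : total + 2 * κ * y < 2 ^ W) (i : ℕ) (hi : i ≤ κ) :
    wp W D a b (probes κ m o i) (fun s' => s'.out = s.out ∧
      (∀ x, x ≠ 7 → x ≠ 8 → (x < 16 ∨ 16 + 2 * m ≤ x) → s'.mem x = s.mem x) ∧
      SlotsOk m s'.mem (total + 2 * i * y) ∧ Gains m s.mem s'.mem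
        {c | ∃ i' < i, heavyColor κ X C t g x i' = c ∨ heavyColor κ X C t g x' i' = c} y) s := by
  have hW := E.hW
  induction i with
  | zero =>
    refine ⟨rfl, fun _ _ _ _ => rfl, by simpa using hs, fun c w hc => ⟨hc, ?_⟩⟩
    rintro ⟨i', hi', -⟩
    omega
  | succ i ih =>
    have hmul : 2 * (i + 1) * y ≤ 2 * κ * y := by gcongr
    have hexp : 2 * (i + 1) * y = 2 * i * y + y + y := by ring
    refine (ih (by omega)).mono ?_
    rintro s₁ ⟨h1, h2, h3, h4⟩
    have e : ∀ z, (z < 7 ∨ z = 9 ∨ z = 10 ∨ z = 11 ∨ o ≤ z) → s₁.mem z = s.mem z :=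
      fun z hz => h2 z (by omega) (by omega) (by omega)
    refine (wp_probe E h0 hm (x := x) (y := y) (g := g) (t := t) (by omega) (by omega)
      ⟨by rw [e _ (by omega), hreg.1], by rw [e _ (by omega), hreg.2.1],
        by rw [e _ (by omega), hreg.2.2]⟩
      (by rw [e _ (by omega), he]) (by rw [e _ (by omega), hx]) (by rw [e _ (by omega), hy])
      (by rw [e _ (by omega), hg]) hlev ht hxN hgK (by omega) h3 (by omega)).mono ?_
    rintro s₂ ⟨g1, g2, g3, g4⟩
    have e' : ∀ z, (z < 7 ∨ z = 9 ∨ z = 10 ∨ z = 11 ∨ o ≤ z) → s₂.mem z = s.mem z :=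
      fun z hz => by rw [g2 z (by omega) (by omega) (by omega), e z hz]
    refine (wp_probe E h0 hm (x := x') (y := y) (g := g) (t := t) (by omega) (by omega)
      ⟨by rw [e' _ (by omega), hreg.1], by rw [e' _ (by omega), hreg.2.1],
        by rw [e' _ (by omega), hreg.2.2]⟩
      (by rw [e' _ (by omega), he]) (by rw [e' _ (by omega), hx']) (by rw [e' _ (by omega), hy])
      (by rw [e' _ (by omega), hg]) hlev ht hxN' hgK (by omega) g3 (by omega)).mono ?_
    rintro s₃ ⟨k1, k2, k3, k4⟩
    refine ⟨by rw [k1, g1, h1], fun x h5 h6 h7 => by rw [k2 x h5 h6 h7, g2 x h5 h6 h7,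
      h2 x h5 h6 h7], ?_, fun c w hc => ?_⟩
    · rw [hexp, ← Nat.add_assoc, ← Nat.add_assoc]
      exact k3
    · obtain ⟨c1, c1'⟩ := h4 c w hc
      obtain ⟨c2, c2'⟩ := g4 c w c1
      obtain ⟨c3, c3'⟩ := k4 c w c2
      refine ⟨c3, ?_⟩
      rintro ⟨i', hi', hc'⟩
      rcases Nat.lt_or_ge i' i with h5 | h5
      · exact (k4 c _ (g4 c _ (c1' ⟨i', h5, hc'⟩)).1).1
      · obtain rfl : i' = i := by omega
        rcases hc' with hc' | hc'
        · exact (k4 c _ (c2' hc'.symm)).1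
        · exact c3' hc'.symm

/-- The slots record the frequent colors of the points so far; otherwise the memory below them
is as in the state `s₀`, except for the registers from 7 to 11. -/
def HeavyInv (κ m : ℕ) (C : Fin N → ℕ) (s₀ : State) (S : Finset (Fin N)) (s : State) : Prop :=
  s.out = s₀.out ∧ (∀ x < 16, x < 7 ∨ 11 < x → s.mem x = s₀.mem x) ∧
    SlotsOk m s.mem (2 * κ * S.card) ∧
    ∀ c, ∃ v, Covers m s.mem c v ∧ κ * (S.filter fun k => C k = c).card ≤ κ * v + 2 * S.card

theorem heavyInv_isAccumulator {s₀ : State} (hm : TreeRegs s₀.mem B N K) :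
    IsAccumulator (16 + 2 * m) B N K (HeavyInv (N := N) κ m C s₀) := by
  constructor
  · rintro S s ⟨-, h2, -⟩
    exact ⟨by rw [h2 _ (by omega) (by omega), hm.1], by rw [h2 _ (by omega) (by omega), hm.2.1],
      by rw [h2 _ (by omega) (by omega), hm.2.2]⟩
  · rintro S s s' ⟨h1, h2, h3, h4⟩ h5 h6
    refine ⟨h5.trans h1, fun x hx hx' => (h6 x (by omega)).trans (h2 x hx hx'),
      h3.congr fun x _ hx => h6 x hx, fun c => ?_⟩
    obtain ⟨v, hv, hv'⟩ := h4 c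
    exact ⟨v, hv.congr fun x _ hx => h6 x hx, hv'⟩

/-- A listed color is credited with the full length `y`, at least its count. An unlisted one is
credited with nothing and loses at most `2y/κ`, which the growth of `2 * S.card` in the invariant
pays for. -/
theorem heavyLeaf_spec (E : Setting W D a b κ K B (16 + 2 * m) X idx C) (h0 : 0 < d)
    (hm : 0 < m) (hsize : 2 * κ * N < 2 ^ W) (s₀ : State) (hreg : TreeRegs s₀.mem B N K) :
    BodySpec W D a b K (16 + 2 * m) X (HeavyInv (N := N) κ m C s₀)
      (heavyLeaf κ m (16 + 2 * m + 32 * (d - 1))) (d - 1) (16 + 2 * m + 32 * (d - 1))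
      (heavyLeaf κ m (16 + 2 * m + 32 * (d - 1)) : Cmd d).cost := by
  rintro t u h l r S s ht hv hr hS hdisj
  have hW := E.hW
  have hD := E.hD
  have hsz := E.size
  have hlN := hv.l_le
  have hrN := hv.r_le
  obtain ⟨hm0, hm1, hm2⟩ := (heavyInv_isAccumulator hreg).regs _ _ hS
  set o := 16 + 2 * m + 32 * (d - 1) with hoo
  set Z := slab X d (extend a) (extend b) t (Set.Ico l r) with hZ
  have hcardZ : Z.card = r - l := card_slab_all (by omega) hv.r_le
  have hcard : (S ∪ Z).card = S.card + (r - l) := by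
    rw [Finset.card_union_of_disjoint hdisj, hcardZ]
  have hle : (S ∪ Z).card ≤ N := by simpa using Finset.card_le_univ (S ∪ Z)
  refine Run.of_wp ?_
  have hc : (Test.lt (var (o + 4)) (var (o + 5)) : Test d).Holds W D a b s.mem ↔ l < r := by
    simp (disch := omega) only [Test.Holds, eval_var, hr.l, hr.r]
  refine ⟨fun hβ => ?_, fun hβ => ?_⟩ <;> rw [hc] at hβ
  · set y := r - l with hy
    set g := Nat.log 2 y with hg
    have hg1 : 2 ^ g ≤ y := Nat.pow_log_le_self 2 (by omega)
    have hg2 : y < 2 ^ (g + 1) := Nat.lt_pow_succ_log_self (by omega) y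
    have hgK : g < K := by
      have h1 := E.tree.le
      have h2 := E.tree.pos
      have : 2 ^ g ≤ 2 ^ (K - 1) := by omega
      have := (Nat.pow_le_pow_iff_right (by omega)).1 this
      omega
    have hfield : ∀ mem f, mem 0 = B → mem 1 = N → mem 2 = K → mem o = code K t →
        mem 9 = y → f < 4 → (fieldExpr κ (var o) (.lit f) (var 9)).eval W D mem =
          fieldVal κ X idx C t f y := by
      intro mem f e0 e1 e2 e3 e4 e5
      have := E.hκ
      refine eval_field E.tree ⟨e0, e1, e2⟩ E.hκ ?_ ?_ ?_ hv.levels (by omega) (by omega)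
        (by omega)
      · rw [eval_var (by omega), e3]
      · rw [eval_lit, Nat.mod_eq_of_lt (by omega)]
      · rw [eval_var (by omega), e4]
    refine wp_cons (wp_assign y (by omega) (by omega) ?_ ?_)
    · simp (disch := omega) only [eval_sub, eval_var, hr.l, hr.r, hy]
    refine wp_cons (wp_assign g (by omega) (by omega) ?_ ?_)
    · rw [hfield]
      · rfl
      any_goals omega
      all_goals simp (disch := omega) only [Function.update_of_ne, Function.update_self, hm0, hm1,
        hm2, hr.e]
    refine wp_cons (wp_assign (r - 2 ^ g) (by omega) (by omega) ?_ ?_)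
    · rw [eval_sub, hfield]
      · simp (disch := omega) only [eval_var, Function.update_of_ne, hr.r]
        rfl
      any_goals omega
      all_goals simp (disch := omega) only [Function.update_of_ne, Function.update_self, hm0, hm1,
        hm2, hr.e]
    obtain ⟨hS1, hS2, hS3, hS4⟩ := hS
    have hbound : 2 * κ * S.card + 2 * κ * y ≤ 2 * κ * N := by
      rw [← Nat.mul_add]
      gcongr
      omega
    have hcong : ∀ x, 16 ≤ x → Function.update (Function.update (Function.update s.mem 9 y) 11 g)
        10 (r - 2 ^ g) x = s.mem x := fun x hx => by
      simp (disch := omega) only [Function.update_of_ne]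
    refine (wp_probes E h0 hm (total := 2 * κ * S.card) (x := l) (x' := r - 2 ^ g) (y := y)
      (g := g) (t := t) (by omega) (by omega) ⟨?_, ?_, ?_⟩ ?_ ?_ ?_ ?_ ?_ hv.levels (by omega) hlN
      (by omega) hgK (hS3.congr fun x hx _ => hcong x hx) (by omega) κ le_rfl).mono ?_
    any_goals simp (disch := omega) only [Function.update_of_ne, Function.update_self, hm0, hm1,
      hm2, hr.e, hr.l]
    rintro s' ⟨h1, h2, h3, h4⟩
    refine ⟨⟨h1.trans hS1, fun x hx hx' => ?_, ?_, fun c => ?_⟩, fun x hx hx' => ?_⟩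
    · rw [h2 x (by omega) (by omega) (by omega), ← hS2 x hx hx']
      simp (disch := omega) only [Function.update_of_ne]
    · rw [hcard, Nat.mul_add]
      exact h3
    · obtain ⟨v, hv1, hv2⟩ := hS4 c
      obtain ⟨c1, c2⟩ := h4 c v (hv1.congr fun x hx _ => hcong x hx)
      have hcnt : ((S ∪ Z).filter fun k => C k = c).card =
          (S.filter fun k => C k = c).card + (Z.filter fun k => C k = c).card := by
        rw [Finset.filter_union, Finset.card_union_of_disjoint]
        exact Finset.disjoint_filter_filter hdisj
      have hZc : (Z.filter fun k => C k = c).card = windowCount X C t l y c :=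
        card_slab (by omega) _
      have hZle : (Z.filter fun k => C k = c).card ≤ y := by
        rw [← hcardZ]
        exact Finset.card_filter_le _ _
      rw [hcnt, hcard, Nat.mul_add]
      by_cases hheavy : ∃ i' < κ, heavyColor κ X C t g l i' = c ∨
          heavyColor κ X C t g (r - 2 ^ g) i' = c
      · refine ⟨v + y, c2 hheavy, ?_⟩
        have := Nat.mul_le_mul_left κ hZle
        rw [Nat.mul_add]
        omega
      · refine ⟨v, c1, ?_⟩
        -- Otherwise `c` would be among the colors listed for the window.
        have w1 : κ * windowCount X C t l (2 ^ g) c < 2 ^ g := by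
          by_contra hcon
          obtain ⟨i', hi', he⟩ := exists_heavyColor (not_lt.1 hcon)
          exact hheavy ⟨i', hi', .inl he⟩
        have w2 : κ * windowCount X C t (r - 2 ^ g) (2 ^ g) c < 2 ^ g := by
          by_contra hcon
          obtain ⟨i', hi', he⟩ := exists_heavyColor (not_lt.1 hcon)
          exact hheavy ⟨i', hi', .inr he⟩
        -- Two windows suffice since `y < 2 ^ (g + 1)`; the loss is then at most `2 * 2 ^ g ≤ 2 *
        -- y`.
        have w3 := windowCount_le_add (X := X) (C := C) (t := t) (l := l) (r := r) (c := c)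
          (w := 2 ^ g) (by rw [pow_succ] at hg2; omega) hβ.le
        rw [← hy, ← hZc] at w3
        have w4 := Nat.mul_le_mul_left κ w3
        rw [Nat.mul_add] at w4
        omega
    · rw [h2 x (by omega) (by omega) (by omega)]
      simp (disch := omega) only [Function.update_of_ne]
  · rw [hZ, Set.Ico_eq_empty hβ, slab_empty, Finset.union_empty]
    exact ⟨hS, fun _ _ _ => rfl⟩

/-- A color with many points is among the colors of the slots. -/
theorem HeavyInv.exists_slot {s₀ s : State} {S : Finset (Fin N)} (h : HeavyInv κ m C s₀ S s)
    {τ : ℝ} (hκ : 4 ≤ τ * κ) (hmκ : κ ^ 2 < m) (hS : S.Nonempty) {c : ℕ}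
    (hc : τ * S.card ≤ (S.filter fun k => C k = c).card) : ∃ j < m, s.mem (16 + j) = c := by
  obtain ⟨-, -, h3, h4⟩ := h
  by_contra! hne
  obtain ⟨v, hv1, hv2⟩ := h4 c
  have hpos : 0 < S.card := hS.card_pos
  -- A color without a slot has its bound certified by every slot, and the slots sum to the total
  -- weight.
  have h5 : m * v ≤ 2 * κ * S.card := by
    rw [← h3.2]
    have := Finset.card_nsmul_le_sum (Finset.range m) (fun j => s.mem (16 + m + j)) v
      fun j hj => hv1 j (Finset.mem_range.1 hj) (.inr hne)
    simpa using this
  have h6 : 2 * S.card ≤ κ * v := by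
    have h7 : ((κ * (S.filter fun k => C k = c).card : ℕ) : ℝ) ≤ ((κ * v + 2 * S.card : ℕ) : ℝ) :=
      Nat.cast_le.2 hv2
    have h8 : (κ : ℝ) * (τ * S.card) ≤ κ * (S.filter fun k => C k = c).card := by gcongr
    push_cast at h7
    have h9 : (4 : ℝ) * S.card ≤ τ * κ * S.card := by gcongr
    have : (2 : ℝ) * S.card ≤ κ * v := by nlinarith
    exact_mod_cast this
  -- Combining the two bounds on `v` forces `m ≤ κ ^ 2`, against the choice of `m`.
  have h7 : m * (2 * S.card) ≤ κ ^ 2 * (2 * S.card) := by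
    calc m * (2 * S.card) ≤ m * (κ * v) := by gcongr
      _ = κ * (m * v) := by ring
      _ ≤ κ * (2 * κ * S.card) := by gcongr
      _ = _ := by ring
  have := Nat.le_of_mul_le_mul_right h7 (by omega)
  omega

end Specs

end ColorRange

namespace ColorRange

/-! ### The query program -/

section Programs

variable {d : ℕ}

/-- Select the tree with the number given by `e`. -/
def setTree (e : Expr) : Cmd d :=
  block [assign 0 (.word (e * .lit 4 + .lit 4)), assign 1 (.word (e * .lit 4 + .lit 5)),
    assign 2 (.word (.lit 1))]

/-- Count the points of the query in the tree with the number given by `e`. -/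
def countTree (κ base : ℕ) (e : Expr) : Cmd d :=
  .seq (.seq (setTree e) (assign 5 (.lit 0)))
    (traverse κ base (countLeaf (base + 32 * (d - 1))))

/-- Initialize the first `i` slots. -/
def initSlots (m : ℕ) : ℕ → Cmd d
  | 0 => .skip
  | i + 1 => .seq (initSlots m i) (block [assign (16 + i) (.lit i), assign (16 + m + i) (.lit 0)])

/-- Report the color in the slot `j` if it dominates the query. -/
def report (κ m j : ℕ) : Cmd d :=
  .ite (.lt (var (16 + j)) (.word (.lit 0)))
    (.seq (countTree κ (16 + 2 * m) (var (16 + j)))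
      (.ite (.lt (var 5) (.word (var 6 * .lit 4 + .lit 6))) .skip
        (.emit (.word (var (16 + j) * .lit 4 + .lit 7))))) .skip

/-- Report the dominating colors in the first `j` slots. -/
def reports (κ m : ℕ) : ℕ → Cmd d
  | 0 => .skip
  | j + 1 => .seq (reports κ m j) (report κ m j)

/-- The query program. -/
def queryProg (d κ m : ℕ) : Cmd d :=
  .seq (countTree κ (16 + 2 * m) (.word (.lit 0)))
    (.seq (block [assign 6 (var 5)]) (.ite (.lt (.lit 0) (var 6))
      (.seq (initSlots m m)
        (.seq (traverse κ (16 + 2 * m) (heavyLeaf κ m (16 + 2 * m + 32 * (d - 1))))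
          (reports κ m m))) .skip))

/-- Time bound for the query program. -/
def queryTime (d κ m K : ℕ) : ℕ :=
  (traverseTime d K 10 + 100) * (m + 2) + (initSlots m m : Cmd d).cost +
    traverseTime d K (heavyLeaf κ m (16 + 2 * m + 32 * (d - 1)) : Cmd d).cost

end Programs

/-! ### Correctness of the query program on a store with the required layout. -/

section Layout

variable {d n : ℕ}

/-- The points of the color class `c`; all points if `c` is not an index. -/
def colorClass (ρ : Fin n → Fin n) (c : ℕ) : Finset (Fin n) :=
  if c < n then Finset.univ.filter fun i => (ρ i : ℕ) = c else Finset.univ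

/-- Coordinates of the points of a finite set. -/
noncomputable def subCoord (P : Fin n → Fin d → ℝ) (F : Finset (Fin n)) (k : Fin F.card) (j : ℕ) :
    ℝ :=
  extend (P (F.orderEmbOfFin rfl k)) j

/-- The data structure `D` holds the range trees of all points and of the color classes. -/
structure Layout (W : ℕ) (D : Store) (κ K m : ℕ) (τ : ℝ) (P : Fin n → Fin d → ℝ) (col : Fin n → ℕ)
    (ρ : Fin n → Fin n) (Bs : ℕ → ℕ) : Prop where
  setting : ∀ (a b : Fin d → ℝ), ∀ c ≤ n, Setting W D a b κ K (Bs c) (16 + 2 * m)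
    (subCoord P (colorClass ρ c)) (fun k => ((colorClass ρ c).orderEmbOfFin rfl k : ℕ))
    (fun k => (ρ ((colorClass ρ c).orderEmbOfFin rfl k) : ℕ))
  word_zero : D.words.getD 0 0 = n
  word_one : D.words.getD 1 0 = K
  word_two : D.words.getD 2 0 = 2 ^ (K - 1)
  base : ∀ c ≤ n, D.words.getD (c * 4 + 4) 0 = Bs c
  card : ∀ c ≤ n, D.words.getD (c * 4 + 5) 0 = (colorClass ρ c).card
  threshold : ∀ c ≤ n, D.words.getD (c * 4 + 6) 0 = ⌈τ * c⌉₊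
  color : ∀ c : Fin n, D.words.getD (c * 4 + 7) 0 = col c
  size : 4 * n + 2 * κ * n + 8 < 2 ^ W

theorem colorClass_self (ρ : Fin n → Fin n) : colorClass ρ n = Finset.univ := by
  simp [colorClass]

theorem mem_colorClass {ρ : Fin n → Fin n} {c : ℕ} (hc : c < n) {i : Fin n} :
    i ∈ colorClass ρ c ↔ (ρ i : ℕ) = c := by
  simp [colorClass, hc]

theorem mem_pointsIn {P : Fin n → Fin d → ℝ} {a b : Fin d → ℝ} {i : Fin n} :
    i ∈ pointsIn P a b ↔ ∀ j < d, extend a j ≤ extend (P i) j ∧ extend (P i) j ≤ extend b j := by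
  simp only [pointsIn, Finset.mem_filter, Finset.mem_univ, true_and, Set.mem_Icc, Pi.le_def,
    extend]
  constructor
  · rintro ⟨h1, h2⟩ j hj
    simp only [hj, dif_pos]
    exact ⟨h1 _, h2 _⟩
  · intro h
    refine ⟨fun j => ?_, fun j => ?_⟩ <;> have := h j j.2 <;> simp only [j.2, dif_pos] at this
    · exact this.1
    · exact this.2

/-- Trees number the points of `F` from 0 on; the increasing enumeration of `F` carries counts back
to the original points. -/
theorem card_boxSet (P : Fin n → Fin d → ℝ) (a b : Fin d → ℝ) (F : Finset (Fin n))
    (g : Fin n → Prop) [DecidablePred g] :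
    ((boxSet (subCoord P F) d (extend a) (extend b)).filter
      fun k => g (F.orderEmbOfFin rfl k)).card =
      ((pointsIn P a b).filter fun i => i ∈ F ∧ g i).card := by
  classical
  refine Finset.card_bij (fun k _ => F.orderEmbOfFin rfl k) ?_ ?_ ?_
  · intro k hk
    simp only [Finset.mem_filter, boxSet, Finset.mem_univ, true_and, mem_pointsIn] at hk ⊢
    exact ⟨hk.1, Finset.orderEmbOfFin_mem _ _ _, hk.2⟩
  · intro k _ k' _ h
    exact (F.orderEmbOfFin rfl).injective h
  · intro i hi
    simp only [Finset.mem_filter, mem_pointsIn] at hi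
    have : i ∈ Set.range (F.orderEmbOfFin rfl) := by
      rw [Finset.range_orderEmbOfFin]
      exact hi.2.1
    obtain ⟨k, rfl⟩ := this
    refine ⟨k, ?_, rfl⟩
    simp only [Finset.mem_filter, boxSet, Finset.mem_univ, true_and]
    exact ⟨hi.1, hi.2.2⟩

theorem card_boxSet_all (P : Fin n → Fin d → ℝ) (a b : Fin d → ℝ) (F : Finset (Fin n)) :
    (boxSet (subCoord P F) d (extend a) (extend b)).card =
      ((pointsIn P a b).filter fun i => i ∈ F).card := by
  have := card_boxSet P a b F fun _ => True
  simpa using this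

variable {W : ℕ} {D : Store} {κ K m : ℕ} {τ : ℝ} {P : Fin n → Fin d → ℝ} {col : Fin n → ℕ}
  {ρ : Fin n → Fin n} {Bs : ℕ → ℕ} {a b : Fin d → ℝ}

/-- Number of points of the class `c` in the query. -/
noncomputable def classCount (P : Fin n → Fin d → ℝ) (ρ : Fin n → Fin n) (a b : Fin d → ℝ)
    (c : ℕ) : ℕ :=
  ((pointsIn P a b).filter fun i => i ∈ colorClass ρ c).card

/-- The expression `e` is evaluated again after the first tree register has been overwritten, so its
value must not depend on the registers up to 2. -/
theorem run_countTree (L : Layout W D κ K m τ P col ρ Bs) (h0 : 0 < d) {e : Expr} {c : ℕ}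
    {s : State} (hc : c ≤ n) (hecost : e.cost ≤ 2)
    (he : ∀ mem : ℕ → ℕ, (∀ x, 2 < x → mem x = s.mem x) → e.eval W D mem = c) :
    Run W D a b (countTree κ (16 + 2 * m) e) s (traverseTime d K 10 + 40) fun s' =>
      s'.out = s.out ∧ (∀ x, 5 < x → x < 16 + 2 * m → s'.mem x = s.mem x) ∧
        s'.mem 5 = classCount P ρ a b c ∧ TreeRegs s'.mem (Bs c) (colorClass ρ c).card K := by
  have E := L.setting a b c hc
  have hW := E.hW
  have hD := E.hD
  have hs := L.size
  have hpre : wp W D a b (.seq (setTree e) (assign 5 (.lit 0))) (fun s' =>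
      s'.out = s.out ∧ (∀ x, 5 < x → x < 16 + 2 * m → s'.mem x = s.mem x) ∧ s'.mem 5 = 0 ∧
      TreeRegs s'.mem (Bs c) (colorClass ρ c).card K) s := by
    unfold setTree
    refine wp_cons ?_
    refine wp_assign (W := W) (D := D) (Bs c) (by omega) (by omega) ?_ ?_
    · rw [← L.base c hc, eval_word]
      simp (disch := omega) only [eval_add, eval_mul, eval_lit, he s.mem fun _ _ => rfl,
        Nat.mod_eq_of_lt]
    refine wp_cons (wp_assign (colorClass ρ c).card (by omega) (by omega) ?_ ?_)
    · rw [← L.card c hc, eval_word]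
      have := he (Function.update s.mem 0 (Bs c)) fun x hx => by
        simp (disch := omega) only [Function.update_of_ne]
      simp (disch := omega) only [eval_add, eval_mul, eval_lit, this, Nat.mod_eq_of_lt]
    refine wp_cons (wp_assign K (by omega) (by omega) ?_ ?_)
    · rw [eval_word, eval_lit, Nat.mod_eq_of_lt (by omega), L.word_one]
    have hskip : ∀ Q s, wp W D a b (.skip : Cmd d) Q s = Q s := fun _ _ => rfl
    rw [block, hskip]
    refine wp_assign 0 (by omega)
      (by omega) (by rw [eval_lit, Nat.zero_mod]) ?_
    refine ⟨rfl, fun x hx hx' => ?_, ?_, ?_, ?_, ?_⟩ <;>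
      simp (disch := omega) only [Function.update_of_ne, Function.update_self]
  refine (Run.seq (Run.of_wp hpre) (T₂ := traverseTime d K 10) ?_).mono ?_ fun _ => id
  · rintro s₁ ⟨h1, h2, h3, h4⟩
    refine (run_traverse E h0 L.word_two (countInv_isAccumulator (by omega) h4)
      (countLeaf_spec E h0 (by omega) s₁) ⟨rfl, fun _ _ _ => rfl, by simp [h3]⟩).mono le_rfl ?_
    rintro s₂ ⟨g1, g2, g3⟩
    refine ⟨g1.trans h1, fun x hx hx' => (g2 x hx' (by omega)).trans (h2 x hx hx'), ?_, ?_⟩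
    · rw [g3, card_boxSet_all, classCount]
    · exact ⟨by rw [g2 _ (by omega) (by omega), h4.1], by rw [g2 _ (by omega) (by omega), h4.2.1],
        by rw [g2 _ (by omega) (by omega), h4.2.2]⟩
  · simp [Cmd.cost, setTree, block, Expr.cost]
    omega

theorem wp_initSlots (hW : 16 + 2 * m < 2 ^ W) (hD : 16 + 2 * m ≤ D.workCells)
    (i : ℕ) (hi : i ≤ m) (s : State) :
    wp W D a b (initSlots m i) (fun s' => s'.out = s.out ∧
      (∀ x < 16, s'.mem x = s.mem x) ∧ ∀ j < i, s'.mem (16 + j) = j ∧ s'.mem (16 + m + j) = 0)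
      s := by
  induction i with
  | zero => exact ⟨rfl, fun _ _ => rfl, fun j hj => by omega⟩
  | succ i ih =>
    refine (ih (by omega)).mono ?_
    rintro s₁ ⟨h1, h2, h3⟩
    refine wp_cons (wp_assign i (by omega) (by omega)
      (by rw [eval_lit, Nat.mod_eq_of_lt (by omega)])
      (wp_cons (wp_assign 0 (by omega) (by omega) (by rw [eval_lit, Nat.zero_mod]) ?_)))
    refine ⟨h1, fun x hx => ?_, fun j hj => ?_⟩
    · simp (disch := omega) only [Function.update_of_ne]
      exact h2 x hx
    · rcases Nat.lt_or_ge j i with h4 | h4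
      · simp (disch := omega) only [Function.update_of_ne]
        exact h3 j h4
      · obtain rfl : j = i := by omega
        simp (disch := omega) only [Function.update_of_ne, Function.update_self, and_self]

/-- The slot with color index `q` is to be reported as the color `c`. -/
def Reported (τ : ℝ) (P : Fin n → Fin d → ℝ) (col : Fin n → ℕ) (ρ : Fin n → Fin n)
    (a b : Fin d → ℝ) (q c : ℕ) : Prop :=
  ∃ h : q < n, ⌈τ * classCount P ρ a b n⌉₊ ≤ classCount P ρ a b q ∧ col ⟨q, h⟩ = c

theorem classCount_le (c : ℕ) : classCount P ρ a b c ≤ n := by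
  refine (Finset.card_le_univ _).trans ?_
  simp

/-- Counting leaves the slots intact, so the candidates can be checked one after another.
Injectivity of reported slots gives an output without repetition. -/
theorem run_reports (L : Layout W D κ K m τ P col ρ Bs) (h0 : 0 < d) {s : State}
    (hN : s.mem 6 = classCount P ρ a b n)
    (hinj : ∀ i < m, ∀ j < m, ∀ c, Reported τ P col ρ a b (s.mem (16 + i)) c →
      Reported τ P col ρ a b (s.mem (16 + j)) c → i = j)
    (hout : s.out = []) (j : ℕ) (hj : j ≤ m) :
    Run W D a b (reports κ m j) s (1 + j * (traverseTime d K 10 + 100)) fun s' =>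
      (∀ x, 5 < x → x < 16 + 2 * m → s'.mem x = s.mem x) ∧ s'.out.Nodup ∧
        ∀ c, c ∈ s'.out ↔ ∃ i < j, Reported τ P col ρ a b (s.mem (16 + i)) c := by
  have E := L.setting a b n le_rfl
  have hW := E.hW
  have hsize := L.size
  induction j with
  | zero =>
    refine (Run.skip ?_).mono (by omega) fun _ => id
    simp [hout]
  | succ j ih =>
    refine (Run.seq (ih (by omega)) (T₂ := traverseTime d K 10 + 100) ?_).mono
      (by rw [add_one_mul]; omega) fun _ => id
    rintro s₁ ⟨h1, h2, h3⟩
    generalize hq : s.mem (16 + j) = q at *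
    have hq1 : s₁.mem (16 + j) = q := by rw [h1 _ (by omega) (by omega), hq]
    -- Initial slot values can be `n` or larger. Without this guard the tree number `n` would mean
    -- the set of all points.
    have hc : (Test.lt (var (16 + j)) (.word (.lit 0)) : Test d).Holds W D a b s₁.mem ↔
        q < n := by
      rw [Test.Holds, eval_word, eval_lit, Nat.zero_mod, L.word_zero, eval_var (by omega), hq1]
    have hiff : ∀ c, (∃ i < j + 1, Reported τ P col ρ a b (s.mem (16 + i)) c) ↔
        (∃ i < j, Reported τ P col ρ a b (s.mem (16 + i)) c) ∨ Reported τ P col ρ a b q c := by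
      intro c
      constructor
      · rintro ⟨i, hi, h⟩
        rcases Nat.lt_or_ge i j with h4 | h4
        · exact .inl ⟨i, h4, h⟩
        · obtain rfl : i = j := by omega
          exact .inr (hq ▸ h)
      · rintro (⟨i, hi, h⟩ | h)
        · exact ⟨i, by omega, h⟩
        · exact ⟨j, by omega, hq.symm ▸ h⟩
    refine (Run.ite (T := traverseTime d K 10 + 40 + 30) (fun hβ => ?_) (fun hβ => ?_)).mono
      (by simp [Test.cost, Expr.cost]; omega) fun _ => id
    · rw [hc] at hβ
      refine Run.seq (run_countTree L h0 hβ.le le_rfl fun mem hmem => by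
        rw [eval_var (by omega), hmem _ (by omega), hq1]) ?_
      rintro s₂ ⟨g1, g2, g3, -⟩
      have g4 : s₂.mem 6 = classCount P ρ a b n := by
        rw [g2 _ (by omega) (by omega), h1 _ (by omega) (by omega), hN]
      have hNn := classCount_le (P := P) (ρ := ρ) (a := a) (b := b) n
      have hc' : (Test.lt (var 5) (.word (var 6 * .lit 4 + .lit 6)) : Test d).Holds W D a b
          s₂.mem ↔ classCount P ρ a b q < ⌈τ * classCount P ρ a b n⌉₊ := by
        rw [Test.Holds, eval_word, ← L.threshold _ hNn, eval_var (by omega), g3]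
        simp (disch := omega) only [eval_add, eval_mul, eval_lit, eval_var, g4,
          Nat.mod_eq_of_lt]
      have hmem : ∀ x, 5 < x → x < 16 + 2 * m → s₂.mem x = s.mem x := fun x hx hx' => by
        rw [g2 x hx hx', h1 x hx hx']
      refine (Run.of_wp ?_).mono (by simp [Cmd.cost, Test.cost, Expr.cost]) fun _ => id
      refine ⟨fun hβ' => ?_, fun hβ' => ?_⟩
      · rw [hc'] at hβ'
        refine ⟨hmem, by rw [g1]; exact h2, fun c => ?_⟩
        rw [hiff, g1, h3 c, or_iff_left]
        rintro ⟨-, h, -⟩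
        omega
      · rw [hc', not_lt] at hβ'
        have hrep : ∀ c, Reported τ P col ρ a b q c ↔ c = col ⟨q, hβ⟩ :=
          fun c => ⟨fun h => h.2.2.symm, fun h => ⟨hβ, hβ', h.symm⟩⟩
        have hemit : (Expr.word (var (16 + j) * .lit 4 + .lit 7)).eval W D s₂.mem =
            col ⟨q, hβ⟩ := by
          rw [← L.color, eval_word]
          have g5 : s₂.mem (16 + j) = q := by rw [hmem _ (by omega) (by omega), hq]
          simp (disch := omega) only [eval_add, eval_mul, eval_lit, eval_var, g5,
            Nat.mod_eq_of_lt]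
        refine ⟨hmem, ?_, fun c => ?_⟩
        · simp only [hemit, g1]
          refine List.nodup_cons.2 ⟨fun hmem' => ?_, h2⟩
          obtain ⟨i, hi, h⟩ := (h3 _).1 hmem'
          have := hinj i (by omega) j (by omega) _ h (by rw [hq, hrep])
          omega
        · simp only [hemit, g1, List.mem_cons]
          rw [hiff, h3, hrep, or_comm]
    · rw [hc] at hβ
      refine (Run.skip ⟨h1, h2, fun c => ?_⟩).mono (by omega) fun _ => id
      rw [hiff, h3 c, or_iff_left]
      exact fun h => hβ h.1

theorem card_pointsIn_eq (ρ : Fin n → Fin n) :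
    (pointsIn P a b).card = classCount P ρ a b n := by
  simp [classCount, colorClass_self]

theorem card_colorIn_eq (hρ : ∀ i, col (ρ i) = col i) (hρ' : ∀ i j, col i = col j → ρ i = ρ j)
    (i : Fin n) : (colorIn P col a b (col i)).card = classCount P ρ a b (ρ i) := by
  classical
  rw [colorIn, classCount]
  congr 1
  ext k
  simp only [Finset.mem_filter, mem_colorClass (ρ i).2, Fin.val_inj]
  refine and_congr_right fun _ => ⟨fun h => hρ' _ _ h, fun h => ?_⟩
  rw [← hρ k, h, hρ]

/-- An index that represents no color has an empty class, whereas the threshold is positive because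
`τ > 0` and the box is nonempty. Leftover initial slots are thus never reported. -/
theorem reported_iff (hτ : 0 < τ) (hρ : ∀ i, col (ρ i) = col i)
    (hρ' : ∀ i j, col i = col j → ρ i = ρ j) (hN : 0 < classCount P ρ a b n) {q c : ℕ} :
    Reported τ P col ρ a b q c ↔ Dominates τ P col a b c ∧ ∃ i, (ρ i : ℕ) = q ∧ col i = c := by
  have hcard := card_pointsIn_eq (P := P) (a := a) (b := b) ρ
  constructor
  · rintro ⟨hq, h1, h2⟩
    have hpos : 0 < classCount P ρ a b q := by
      refine lt_of_lt_of_le ?_ h1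
      rw [Nat.ceil_pos]
      have : (0 : ℝ) < classCount P ρ a b n := Nat.cast_pos.2 hN
      positivity
    obtain ⟨i, hi⟩ := Finset.card_pos.1 hpos
    rw [Finset.mem_filter, mem_colorClass hq] at hi
    have hci : col i = c := by
      rw [← h2, ← hρ i]
      exact congrArg col (Fin.ext hi.2)
    refine ⟨⟨Finset.card_pos.1 (hcard ▸ hN), ?_⟩, i, hi.2, hci⟩
    rw [hcard, ← hci, card_colorIn_eq hρ hρ', hi.2]
    exact Nat.ceil_le.1 h1
  · rintro ⟨⟨-, h⟩, i, rfl, rfl⟩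
    rw [hcard, card_colorIn_eq hρ hρ'] at h
    exact ⟨(ρ i).2, Nat.ceil_le.2 h, hρ i⟩

theorem answersQueries (L : Layout W D κ K m τ P col ρ Bs) (h0 : 0 < d) (hτ : 0 < τ)
    (hκ : 4 ≤ τ * κ) (hmκ : κ ^ 2 < m) (hρ : ∀ i, col (ρ i) = col i)
    (hρ' : ∀ i j, col i = col j → ρ i = ρ j) :
    AnswersQueries (queryProg d κ m) W D τ P col (queryTime d κ m K) := by
  intro a b mem _
  suffices h : Run W D a b (queryProg d κ m) ⟨mem, []⟩ (queryTime d κ m K) fun s =>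
      s.out.Nodup ∧ ∀ c, c ∈ s.out ↔ Dominates τ P col a b c by
    exact h
  have E := L.setting a b n le_rfl
  have hW := E.hW
  have hD := E.hD
  have hsize := L.size
  have hm : 0 < m := by omega
  set N₀ := classCount P ρ a b n with hN₀
  have hcard : (pointsIn P a b).card = N₀ := card_pointsIn_eq ρ
  refine (Run.seq (run_countTree L h0 le_rfl le_rfl fun mem _ => ?_) (T₂ := 12 +
    ((initSlots m m : Cmd d).cost +
    (traverseTime d K (heavyLeaf κ m (16 + 2 * m + 32 * (d - 1)) : Cmd d).cost +
      (1 + m * (traverseTime d K 10 + 100))))) ?_).mono ?_ fun _ => id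
  · rw [eval_word, eval_lit, Nat.zero_mod, L.word_zero]
  · rintro s₁ ⟨h1, -, h2, h3⟩
    refine (Run.seq (T₁ := 5) (Q₁ := fun s' => s'.out = [] ∧ s'.mem 6 = N₀ ∧
      TreeRegs s'.mem (Bs n) (colorClass ρ n).card K) ?_
      (T₂ := 5 + ((initSlots m m : Cmd d).cost +
      (traverseTime d K (heavyLeaf κ m (16 + 2 * m + 32 * (d - 1)) : Cmd d).cost +
        (1 + m * (traverseTime d K 10 + 100))))) ?_).mono (by omega) fun _ => id
    · refine (Run.of_wp ?_).mono (by simp [Cmd.cost, block]) fun _ => id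
      refine wp_cons (wp_assign N₀ (by omega) (by omega) (by rw [eval_var (by omega), h2])
        ⟨h1, ?_, ?_, ?_, ?_⟩)
      · simp only [Function.update_self]
      all_goals simp (disch := omega) only [Function.update_of_ne, h3.1, h3.2.1, h3.2.2]
    rintro s₂ ⟨g1, g2, g3⟩
    refine (Run.ite (T := (initSlots m m : Cmd d).cost +
      (traverseTime d K (heavyLeaf κ m (16 + 2 * m + 32 * (d - 1)) : Cmd d).cost +
        (1 + m * (traverseTime d K 10 + 100)))) (fun hβ => ?_) (fun hβ => ?_)).mono
      (by simp only [Test.cost, cost_lit, cost_var]; omega) fun _ => id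
    · rw [Test.Holds, eval_lit, Nat.zero_mod, eval_var (by omega), g2] at hβ
      refine Run.seq (Run.of_wp (wp_initSlots (W := W) (D := D) (a := a) (b := b) (by omega)
        (by omega) m le_rfl s₂)) ?_
      rintro s₃ ⟨k1, k2, k3⟩
      have hreg : TreeRegs s₃.mem (Bs n) (colorClass ρ n).card K :=
        ⟨by rw [k2 _ (by omega), g3.1], by rw [k2 _ (by omega), g3.2.1],
          by rw [k2 _ (by omega), g3.2.2]⟩
      have hcn : (colorClass ρ n).card = n := by simp [colorClass_self]
      refine Run.seq (run_traverse E h0 L.word_two (heavyInv_isAccumulator hreg)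
        (heavyLeaf_spec E h0 hm (by rw [hcn]; omega) s₃ hreg) ?_) ?_
      -- Slot `i` starts with color `i` and weight 0: distinct colors, total 0, and the bound 0 for
      -- each color.
      · refine ⟨rfl, fun _ _ _ => rfl, ⟨fun i hi j hj h => ?_, ?_⟩, fun c => ⟨0, ?_, by simp⟩⟩
        · rw [(k3 i hi).1, (k3 j hj).1] at h
          exact h
        · rw [Finset.card_empty, Nat.mul_zero]
          exact Finset.sum_eq_zero fun i hi => (k3 i (Finset.mem_range.1 hi)).2
        · exact fun _ _ _ => Nat.zero_le _
      · intro s₄ hheavy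
        have hslots := hheavy.2.2.1
        have hslot : ∀ c, Dominates τ P col a b c → ∃ i, col i = c ∧
            ∃ j < m, s₄.mem (16 + j) = ρ i := by
          rintro c ⟨-, hc⟩
          have hpos : 0 < (colorIn P col a b c).card := by
            have h4 : (0 : ℝ) < N₀ := Nat.cast_pos.2 hβ
            rw [hcard] at hc
            exact_mod_cast lt_of_lt_of_le (mul_pos hτ h4) hc
          obtain ⟨i, hi⟩ := Finset.card_pos.1 hpos
          rw [colorIn, Finset.mem_filter] at hi
          obtain rfl := hi.2
          refine ⟨i, rfl, hheavy.exists_slot hκ hmκ ?_ ?_⟩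
          · rw [← Finset.card_pos, card_boxSet_all]
            exact hβ
          · rw [card_boxSet_all]
            have h5 := card_boxSet P a b (colorClass ρ n) fun k => (ρ k : ℕ) = ρ i
            rw [h5]
            rw [hcard, card_colorIn_eq hρ hρ'] at hc
            refine hc.trans (le_of_eq ?_)
            rw [classCount]
            congr 2
            ext k
            simp only [Finset.mem_filter, mem_colorClass (ρ i).2, colorClass_self,
              Finset.mem_univ, true_and]
        refine (run_reports L h0 ?_ ?_ ?_ m le_rfl).mono le_rfl ?_
        · rw [hheavy.2.1 _ (by omega) (by omega), k2 _ (by omega), g2]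
        · intro i hi j hj c hri hrj
          rw [reported_iff hτ hρ hρ' hβ] at hri hrj
          obtain ⟨-, i', hi', hci⟩ := hri
          obtain ⟨-, j', hj', hcj⟩ := hrj
          refine hslots.1 i hi j hj ?_
          rw [← hi', ← hj', hρ' i' j' (hci.trans hcj.symm)]
        · rw [hheavy.1, k1, g1]
        · rintro s₅ ⟨-, n1, n2⟩
          refine ⟨n1, fun c => ?_⟩
          rw [n2]
          constructor
          · rintro ⟨i, -, h⟩
            exact ((reported_iff hτ hρ hρ' hβ).1 h).1
          · intro h
            obtain ⟨i, hci, j, hj, hji⟩ := hslot c h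
            exact ⟨j, hj, (reported_iff hτ hρ hρ' hβ).2 ⟨h, i, hji.symm, hci⟩⟩
    · rw [Test.Holds, eval_lit, Nat.zero_mod, eval_var (by omega), g2] at hβ
      refine (Run.skip ⟨by rw [g1]; exact List.nodup_nil, fun c => ?_⟩).mono (by omega) fun _ => id
      rw [g1]
      refine ⟨fun h => by simp at h, fun h => ?_⟩
      have := Finset.card_pos.2 h.1
      omega
  · unfold queryTime
    nlinarith

end Layout

end ColorRange

namespace ColorRange

/-! ### Construction of the data structure -/

section Lists

/-- Decoding of node codes. -/
def decode (K : ℕ) : ℕ → List ℕ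
  | 0 => []
  | e + 1 => e % K :: decode K (e / K)
decreasing_by exact Nat.lt_succ_of_le (Nat.div_le_self e K)

/-- The added 1 distinguishes a height 0 from the end of the list, so lists of different lengths get
different codes. -/
theorem decode_code {K : ℕ} {t : List ℕ} (ht : ∀ h ∈ t, h < K) : decode K (code K t) = t := by
  induction t with
  | nil => rw [code, decode]
  | cons h t ih =>
    have h1 := ht h List.mem_cons_self
    rw [code, decode, Nat.mul_add_mod_of_lt h1, Nat.mul_comm, Nat.mul_add_div (by omega),
      Nat.div_eq_of_lt h1, Nat.add_zero, ih fun x hx => ht x (List.mem_cons_of_mem _ hx)]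

variable {α : Type*}

theorem length_flatMap_range (f : ℕ → List α) (n : ℕ) :
    ((List.range n).flatMap f).length = ∑ i ∈ Finset.range n, (f i).length := by
  induction n with
  | zero => simp
  | succ n ih => simp [List.range_succ, List.flatMap_append, ih, Finset.sum_range_succ]

theorem getD_flatMap_range (f : ℕ → List α) {n c y : ℕ} (hc : c < n) (hy : y < (f c).length)
    (x : α) :
    ((List.range n).flatMap f).getD (∑ i ∈ Finset.range c, (f i).length + y) x =
      (f c).getD y x := by
  induction n with
  | zero => omega
  | succ n ih =>
    rw [List.range_succ, List.flatMap_append]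
    rcases Nat.lt_or_ge c n with h | h
    · rw [List.getD_append _ _ _ _ ?_, ih h]
      rw [length_flatMap_range]
      calc _ < ∑ i ∈ Finset.range (c + 1), (f i).length := by
            rw [Finset.sum_range_succ]; omega
        _ ≤ _ := Finset.sum_le_sum_of_subset (Finset.range_subset_range.2 h)
    · obtain rfl : c = n := by omega
      rw [List.getD_append_right _ _ _ _ (by rw [length_flatMap_range]; omega),
        length_flatMap_range, Nat.add_sub_cancel_left]
      simp

end Lists

/-! ### The table of a single tree. -/

section Tree

variable {N : ℕ}

/-- The word table of a range tree in dimension `d`. -/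
noncomputable def treeTable (d κ K : ℕ) (X : Fin N → ℕ → ℝ) (idx C : Fin N → ℕ) : List ℕ :=
  (List.range ((K + 1) ^ (d - 1) * (4 + κ * K) * (N + 1))).map fun i =>
    fieldVal κ X idx C (decode K (i / (N + 1) / (4 + κ * K))) (i / (N + 1) % (4 + κ * K))
      (i % (N + 1))

variable {d κ K : ℕ} {X : Fin N → ℕ → ℝ} {idx C : Fin N → ℕ}

theorem length_treeTable :
    (treeTable d κ K X idx C).length = (K + 1) ^ (d - 1) * (4 + κ * K) * (N + 1) := by
  simp [treeTable]

theorem field_index_lt {t : List ℕ} {f x : ℕ} (ht : ∀ h ∈ t, h < K) (hd : t.length < d)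
    (hf : f < 4 + κ * K) (hx : x ≤ N) :
    (code K t * (4 + κ * K) + f) * (N + 1) + x < (K + 1) ^ (d - 1) * (4 + κ * K) * (N + 1) := by
  have h1 := code_lt ht (Nat.le_sub_one_of_lt hd)
  have h2 : code K t * (4 + κ * K) + f + 1 ≤ (K + 1) ^ (d - 1) * (4 + κ * K) := by
    calc _ ≤ (code K t + 1) * (4 + κ * K) := by rw [add_one_mul]; omega
      _ ≤ _ := Nat.mul_le_mul_right _ h1
  have h3 := Nat.mul_le_mul_right (N + 1) h2
  rw [add_one_mul] at h3
  omega

theorem getD_treeTable {t : List ℕ} {f x : ℕ} (ht : ∀ h ∈ t, h < K) (hd : t.length < d)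
    (hf : f < 4 + κ * K) (hx : x ≤ N) :
    (treeTable d κ K X idx C).getD ((code K t * (4 + κ * K) + f) * (N + 1) + x) 0 =
      fieldVal κ X idx C t f x := by
  have h1 := field_index_lt ht hd hf hx
  have h2 : ((code K t * (4 + κ * K) + f) * (N + 1) + x) / (N + 1) =
      code K t * (4 + κ * K) + f := by
    rw [Nat.mul_comm, Nat.mul_add_div (by omega), Nat.div_eq_of_lt (by omega), Nat.add_zero]
  have h3 : (code K t * (4 + κ * K) + f) / (4 + κ * K) = code K t := by
    rw [Nat.mul_comm, Nat.mul_add_div (by omega), Nat.div_eq_of_lt hf, Nat.add_zero]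
  rw [List.getD_eq_getElem _ _ (by rwa [length_treeTable])]
  simp only [treeTable, List.getElem_map, List.getElem_range, h2, h3, decode_code ht,
    Nat.mul_add_mod_of_lt hf, Nat.mul_add_mod_of_lt (Nat.lt_succ_of_le hx)]

/-- Positivity of `M` is needed at `x = 0`, where the field `2 ^ Nat.log 2 x` equals 1. -/
theorem fieldVal_le {M : ℕ} (hM : 0 < M) (hN : N ≤ M) (hidx : ∀ k, idx k ≤ M) (hC : ∀ k, C k ≤ M)
    (t : List ℕ) (f : ℕ) {x : ℕ} (hx : x ≤ M) : fieldVal κ X idx C t f x ≤ M := by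
  match f with
  | 0 =>
    rw [fieldVal]
    split
    · exact hidx _
    · omega
  | 1 =>
    match t with
    | [] => exact Nat.zero_le _
    | h :: t => exact (leftRank_le _ _ _).trans hN
  | 2 => exact (Nat.log_le_self 2 x).trans hx
  | 3 =>
    rcases Nat.eq_zero_or_pos x with rfl | h
    · simpa [fieldVal] using Nat.succ_le_of_lt hM
    · exact (Nat.pow_log_le_self 2 h.ne').trans hx
  | f + 4 =>
    rw [fieldVal]
    rcases Nat.lt_or_ge (f % κ) (heavyColors κ X C t (f / κ) x).toList.length with h | h
    · rw [List.getD_eq_getElem _ _ h]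
      have := List.getElem_mem h
      simp only [Finset.mem_toList, heavyColors, Finset.mem_filter, Finset.mem_image] at this
      obtain ⟨⟨k, -, hk⟩, -⟩ := this
      exact hk ▸ hC k
    · rw [List.getD_eq_default _ _ h]
      exact Nat.zero_le _

theorem le_of_mem_treeTable {M v : ℕ} (hM : 0 < M) (hN : N ≤ M) (hidx : ∀ k, idx k ≤ M)
    (hC : ∀ k, C k ≤ M) (hv : v ∈ treeTable d κ K X idx C) : v ≤ M := by
  rw [treeTable, List.mem_map] at hv
  obtain ⟨i, -, rfl⟩ := hv
  exact fieldVal_le hM hN hidx hC _ _ ((Nat.le_of_lt_succ (Nat.mod_lt _ N.succ_pos)).trans hN)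

end Tree

end ColorRange

namespace ColorRange

/-! ### The store for all points and all color classes. -/

section Construction

variable {d n : ℕ} (κ K m : ℕ) (τ : ℝ) (P : Fin n → Fin d → ℝ) (col : Fin n → ℕ)
  (ρ : Fin n → Fin n)

/-- The table of the range tree of a color class. -/
noncomputable def classTable (c : ℕ) : List ℕ :=
  treeTable d κ K (subCoord P (colorClass ρ c))
    (fun k => ((colorClass ρ c).orderEmbOfFin rfl k : ℕ))
    (fun k => (ρ ((colorClass ρ c).orderEmbOfFin rfl k) : ℕ))

/-- The address of the range tree of a color class. -/
noncomputable def classBase (c : ℕ) : ℕ :=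
  (n + 2) * 4 + ∑ i ∈ Finset.range c, (classTable κ K P ρ i).length

/-- The directory of the range trees. -/
noncomputable def record : ℕ → List ℕ
  | 0 => [n, K, 2 ^ (K - 1), 0]
  | c + 1 => [classBase κ K P ρ c, (colorClass ρ c).card, ⌈τ * c⌉₊,
      if h : c < n then col ⟨c, h⟩ else 0]

/-- The data structure. -/
noncomputable def store : Store where
  words := (List.range (n + 2)).flatMap (record κ K τ P col ρ) ++
    (List.range (n + 1)).flatMap (classTable κ K P ρ)
  coords := (List.range n).flatMap fun i =>
    (List.range d).map fun j => if h : i < n then extend (P ⟨i, h⟩) j else 0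
  workCells := 16 + 2 * m + 32 * (d + 1)

/-- The number of cells of the data structure. -/
def storeSize (d κ m n K : ℕ) : ℕ :=
  (n + 2) * 4 + (K + 1) ^ (d - 1) * (4 + κ * K) * (3 * n + 1) + n * d +
    (16 + 2 * m + 32 * (d + 1))

variable {κ K m τ P col ρ}

theorem length_record (c : ℕ) : (record κ K τ P col ρ c).length = 4 := by
  cases c <;> simp [record]

theorem sum_length_record (c : ℕ) :
    ∑ i ∈ Finset.range c, (record κ K τ P col ρ i).length = c * 4 := by
  simp [length_record]

theorem card_colorClass_le (c : ℕ) : (colorClass ρ c).card ≤ n := by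
  simpa using Finset.card_le_univ (colorClass ρ c)

theorem sum_card_colorClass : ∑ c ∈ Finset.range n, (colorClass ρ c).card = n := by
  have h := Finset.card_eq_sum_card_fiberwise (s := (Finset.univ : Finset (Fin n)))
    (t := Finset.range n) (f := fun i => (ρ i : ℕ)) fun i _ => by simp
  rw [Finset.card_univ, Fintype.card_fin] at h
  refine Eq.trans ?_ h.symm
  refine Finset.sum_congr rfl fun c hc => ?_
  rw [colorClass, if_pos (Finset.mem_range.1 hc)]

/-- The classes partition the points, so they contribute `n + n` positions, one extra for each of
`n` tables; the tree of all points adds `n + 1`. -/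
theorem sum_length_classTable :
    ∑ c ∈ Finset.range (n + 1), (classTable κ K P ρ c).length =
      (K + 1) ^ (d - 1) * (4 + κ * K) * (3 * n + 1) := by
  simp only [classTable, length_treeTable]
  rw [← Finset.mul_sum, Finset.sum_range_succ, Finset.sum_add_distrib, sum_card_colorClass,
    colorClass_self]
  simp only [Finset.sum_const, Finset.card_range, smul_eq_mul, Finset.card_univ, Fintype.card_fin]
  congr 1
  omega

theorem space_store : (store κ K m τ P col ρ).space = storeSize d κ m n K := by
  simp only [Store.space, store, List.length_append, length_flatMap_range, sum_length_record,
    sum_length_classTable, List.length_map, List.length_range, Finset.sum_const,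
    Finset.card_range, smul_eq_mul, storeSize]

theorem getD_record {c r : ℕ} (hc : c < n + 2) (hr : r < 4) :
    (store κ K m τ P col ρ).words.getD (c * 4 + r) 0 = (record κ K τ P col ρ c).getD r 0 := by
  have h := getD_flatMap_range (record κ K τ P col ρ) hc (y := r) (by rwa [length_record]) 0
  rw [sum_length_record] at h
  rw [← h, store, List.getD_append]
  rw [length_flatMap_range, sum_length_record]
  omega

theorem getD_class {c y : ℕ} (hc : c ≤ n) (hy : y < (classTable κ K P ρ c).length) :
    (store κ K m τ P col ρ).words.getD (classBase κ K P ρ c + y) 0 =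
      (classTable κ K P ρ c).getD y 0 := by
  rw [← getD_flatMap_range (classTable κ K P ρ) (Nat.lt_succ_of_le hc) hy, store, classBase,
    List.getD_append_right]
  all_goals rw [length_flatMap_range, sum_length_record]
  · congr 1
    omega
  · omega

theorem getD_coords (i : Fin n) {j : ℕ} (hj : j < d) :
    (store κ K m τ P col ρ).coords.getD (i * d + j) 0 = extend (P i) j := by
  have h := getD_flatMap_range (fun i : ℕ => (List.range d).map fun j =>
    if h : i < n then extend (P ⟨i, h⟩) j else 0) i.2 (y := j) (by simpa) 0
  simp only [List.length_map, List.length_range, Finset.sum_const, Finset.card_range,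
    smul_eq_mul] at h
  rw [store, h, List.getD_eq_getElem _ _ (by simpa)]
  simp

theorem classBase_add_length_le {c : ℕ} (hc : c ≤ n) :
    classBase κ K P ρ c + (classTable κ K P ρ c).length ≤ storeSize d κ m n K := by
  rw [classBase, add_assoc, ← Finset.sum_range_succ]
  have h : ∑ i ∈ Finset.range (c + 1), (classTable κ K P ρ i).length ≤
      ∑ i ∈ Finset.range (n + 1), (classTable κ K P ρ i).length :=
    Finset.sum_le_sum_of_subset (Finset.range_subset_range.2 (by omega))
  rw [sum_length_classTable] at h
  rw [storeSize]
  omega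

theorem layout_store {W : ℕ} (hK : 0 < K) (hn : n ≤ 2 ^ (K - 1))
    (hW : storeSize d κ m n K + 4 * n + 4 * 2 ^ K + 2 * κ * n + κ + 9 < 2 ^ W) :
    Layout W (store κ K m τ P col ρ) κ K m τ P col ρ (classBase κ K P ρ) := by
  have hsize : n * d + (16 + 2 * m + 32 * (d + 1)) ≤ storeSize d κ m n K := by
    rw [storeSize]; omega
  have hrec := fun c r => getD_record (κ := κ) (K := K) (m := m) (τ := τ) (P := P) (col := col)
    (ρ := ρ) (c := c) (r := r)
  refine ⟨fun a b c hc => ⟨⟨?_, ?_, ?_, hK, ?_, ?_⟩, ?_, ?_, ?_, ?_, le_rfl, ?_⟩, ?_, ?_, ?_, ?_, ?_,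
    ?_, ?_, ?_⟩
  · intro t f x ht hd hf hx
    rw [getD_class hc, classTable, getD_treeTable ht hd hf hx]
    rw [classTable, length_treeTable]
    exact field_index_lt ht hd hf hx
  · have := classBase_add_length_le (κ := κ) (K := K) (m := m) (P := P) (ρ := ρ) hc
    rw [classTable, length_treeTable] at this
    omega
  · intro k j hj
    refine ⟨?_, getD_coords _ hj⟩
    have h1 := ((colorClass ρ c).orderEmbOfFin rfl k).2
    have h2 := Nat.mul_le_mul_right d (Nat.succ_le_of_lt h1)
    rw [Nat.succ_mul] at h2
    omega
  · exact (card_colorClass_le c).trans hn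
  · have := card_colorClass_le (ρ := ρ) c
    omega
  · omega
  · omega
  · omega
  · omega
  · have := card_colorClass_le (ρ := ρ) c
    omega
  · simpa [record] using hrec 0 0 (by omega) (by omega)
  · simpa [record] using hrec 0 1 (by omega) (by omega)
  · simpa [record] using hrec 0 2 (by omega) (by omega)
  · intro c hc
    rw [show c * 4 + 4 = (c + 1) * 4 + 0 by omega, hrec _ _ (by omega) (by omega)]
    rfl
  · intro c hc
    rw [show c * 4 + 5 = (c + 1) * 4 + 1 by omega, hrec _ _ (by omega) (by omega)]
    rfl
  · intro c hc
    rw [show c * 4 + 6 = (c + 1) * 4 + 2 by omega, hrec _ _ (by omega) (by omega)]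
    rfl
  · intro c
    rw [show (c : ℕ) * 4 + 7 = (c + 1) * 4 + 3 by omega, hrec _ _ (by omega) (by omega)]
    simp [record]
  · omega

theorem lt_of_mem_words {W : ℕ} (hτ : τ ≤ 1) (hcol : ∀ i, col i < 2 ^ W)
    (hW : storeSize d κ m n K + 4 * n + 4 * 2 ^ K + 2 * κ * n + κ + 9 < 2 ^ W) :
    ∀ v ∈ (store κ K m τ P col ρ).words, v < 2 ^ W := by
  intro v hv
  have h2K : 2 ^ (K - 1) ≤ 2 ^ K := Nat.pow_le_pow_right (by omega) (by omega)
  have hKK : K < 2 ^ K := Nat.lt_two_pow_self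
  simp only [store, List.mem_append, List.mem_flatMap, List.mem_range] at hv
  rcases hv with ⟨c, hc, hv⟩ | ⟨c, hc, hv⟩
  · cases c with
    | zero =>
      simp only [record, List.mem_cons, List.not_mem_nil, or_false] at hv
      omega
    | succ c =>
      simp only [record, List.mem_cons, List.not_mem_nil, or_false] at hv
      have h1 := classBase_add_length_le (κ := κ) (K := K) (m := m) (P := P) (ρ := ρ)
        (show c ≤ n by omega)
      have h3 := card_colorClass_le (ρ := ρ) c
      have h4 : ⌈τ * c⌉₊ ≤ c := Nat.ceil_le.2 (mul_le_of_le_one_left (Nat.cast_nonneg c) hτ)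
      rcases hv with rfl | rfl | rfl | rfl
      · omega
      · omega
      · omega
      · split
        · exact hcol _
        · exact Nat.two_pow_pos W
  -- The bound `n + 1` instead of `n` covers the case `n = 0`.
  · have : v ≤ n + 1 := le_of_mem_treeTable (Nat.succ_pos n)
      ((card_colorClass_le c).trans (Nat.le_succ n)) (fun k => (Fin.is_lt _).le.trans (Nat.le_succ n))
      (fun k => (Fin.is_lt _).le.trans (Nat.le_succ n)) hv
    omega

end Construction

/-- Colors may be as large as the words permit. Representing a color by the index of a point makes
it a valid table index. -/
theorem exists_representative {n : ℕ} (col : Fin n → ℕ) :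
    ∃ ρ : Fin n → Fin n, (∀ i, col (ρ i) = col i) ∧ ∀ i j, col i = col j → ρ i = ρ j := by
  rcases isEmpty_or_nonempty (Fin n) with h | h
  · exact ⟨id, fun i => isEmptyElim i, fun i => isEmptyElim i⟩
  · exact ⟨fun i => Function.invFun col (col i), fun i => Function.invFun_eq ⟨i, rfl⟩,
      fun i j hij => congrArg (Function.invFun col) hij⟩

theorem exists_word_bound (d κ m : ℕ) : ∃ k : ℕ, 0 < k ∧ ∀ n w : ℕ, 0 < w → n ≤ 2 ^ w →
    storeSize d κ m n (Nat.clog 2 n + 1) + 4 * n + 4 * 2 ^ (Nat.clog 2 n + 1) + 2 * κ * n + κ + 9 <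
      2 ^ (k * w) := by
  -- With `M = 2 ^ w`, each summand is at most its coefficient here times `M ^ (d + 2)`, and `A < 2
  -- ^ A ≤ M ^ A`.
  set A := 12 + 2 ^ d * (4 + κ) * 4 + d + (16 + 2 * m + 32 * (d + 1)) + 4 + 8 + 2 * κ + κ + 9
    with hA
  refine ⟨A + (d + 2), by omega, fun n w hw hn => ?_⟩
  obtain ⟨M, hM⟩ : ∃ M, M = 2 ^ w := ⟨_, rfl⟩
  have hM2 : 2 ≤ M := hM ▸ (Nat.pow_le_pow_right (by omega) hw : 2 ^ 1 ≤ 2 ^ w)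
  have hclog : Nat.clog 2 n ≤ w := Nat.clog_le_of_le_pow hn
  have hwM : w < M := hM ▸ Nat.lt_two_pow_self
  rw [← hM] at hn
  have h2K : 2 ^ (Nat.clog 2 n + 1) ≤ 2 * M := by
    rw [pow_succ, mul_comm, hM]
    exact Nat.mul_le_mul_left 2 (Nat.pow_le_pow_right (by omega) hclog)
  obtain ⟨K, hK⟩ : ∃ K, K = Nat.clog 2 n + 1 := ⟨_, rfl⟩
  rw [← hK] at h2K ⊢
  have hKM : K ≤ M := by omega
  have h1 : M ≤ M ^ (d + 2) := Nat.le_self_pow (by omega) M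
  have h1' : 1 ≤ M ^ (d + 2) := Nat.one_le_pow _ _ (by omega)
  have h2 : (K + 1) ^ (d - 1) * (4 + κ * K) * (3 * n + 1) ≤
      2 ^ d * (4 + κ) * 4 * M ^ (d + 2) := by
    calc _ ≤ (2 * M) ^ d * ((4 + κ) * M) * (4 * M) := by
          gcongr
          · omega
          · omega
          · omega
          · rw [add_mul]
            exact Nat.add_le_add (by omega) (Nat.mul_le_mul_left κ hKM)
          · omega
      _ = _ := by rw [mul_pow]; ring
  have h3 : n * d ≤ d * M ^ (d + 2) := by
    rw [mul_comm]; exact Nat.mul_le_mul_left d (hn.trans h1)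
  have h4 : 2 * κ * n ≤ 2 * κ * M ^ (d + 2) := Nat.mul_le_mul_left _ (hn.trans h1)
  have h5 : ∀ c : ℕ, c ≤ c * M ^ (d + 2) := fun c => Nat.le_mul_of_pos_right c h1'
  have h6 : A * M ^ (d + 2) < 2 ^ ((A + (d + 2)) * w) := by
    rw [Nat.mul_comm _ w, pow_mul, ← hM, pow_add M A (d + 2)]
    refine Nat.mul_lt_mul_of_pos_right ?_ h1'
    exact (Nat.lt_two_pow_self).trans_le (Nat.pow_le_pow_left hM2 _)
  refine lt_of_le_of_lt ?_ h6
  have h7 := h5 (16 + 2 * m + 32 * (d + 1))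
  have h8 := h5 κ
  rw [storeSize, hA]
  simp only [add_mul] at h2 h7 ⊢
  omega

end ColorRange

namespace ColorRange

/-! ### Asymptotic bounds -/

theorem clog_add_two_le {n : ℕ} (hn : 2 ≤ n) : ((Nat.clog 2 n + 1 + 1 : ℕ) : ℝ) ≤ 8 * Real.log n := by
  have h1 : Nat.clog 2 n ≤ Nat.log 2 n + 1 :=
    Nat.clog_le_of_le_pow (Nat.lt_pow_succ_log_self (by omega) n).le
  have h2 : ((2 ^ Nat.log 2 n : ℕ) : ℝ) ≤ n := Nat.cast_le.2 (Nat.pow_log_le_self 2 (by omega))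
  have h3 := Real.log_le_log (by positivity) h2
  have h4 : Real.log 2 ≤ Real.log n := Real.log_le_log (by norm_num) (by exact_mod_cast hn)
  have h5 := Real.log_two_gt_d9
  rw [Nat.cast_pow, Real.log_pow, Nat.cast_ofNat] at h3
  have h6 : ((Nat.clog 2 n : ℕ) : ℝ) ≤ Nat.log 2 n + 1 := by exact_mod_cast h1
  have h7 : (0 : ℝ) ≤ Nat.log 2 n := Nat.cast_nonneg _
  push_cast
  nlinarith

/-- The last factor `K + 1` comes from the window lengths: each height list stores `κ` colors for
each of `K` lengths. -/
theorem storeSize_le (d κ m : ℕ) (hd : 0 < d) : ∃ A : ℕ, ∀ n K : ℕ, 0 < n →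
    storeSize d κ m n K ≤ A * (n * (K + 1) ^ d) := by
  refine ⟨12 + (4 + κ) * 4 + d + (16 + 2 * m + 32 * (d + 1)), fun n K hn => ?_⟩
  have h0 : 1 ≤ (K + 1) ^ d := Nat.one_le_pow _ _ (by omega)
  have h1 : n ≤ n * (K + 1) ^ d := Nat.le_mul_of_pos_right n h0
  have h2 : (K + 1) ^ (d - 1) * (4 + κ * K) * (3 * n + 1) ≤
      (4 + κ) * 4 * (n * (K + 1) ^ d) := by
    calc _ ≤ (K + 1) ^ (d - 1) * ((4 + κ) * (K + 1)) * (4 * n) := by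
          gcongr
          · nlinarith
          · omega
      _ = (4 + κ) * 4 * (n * ((K + 1) ^ (d - 1) * (K + 1))) := by ring
      _ = _ := by rw [← pow_succ, Nat.sub_add_cancel hd]
  have h3 : n * d ≤ d * (n * (K + 1) ^ d) := by
    rw [mul_comm]; exact Nat.mul_le_mul_left d h1
  have h4 : 16 + 2 * m + 32 * (d + 1) ≤ (16 + 2 * m + 32 * (d + 1)) * (n * (K + 1) ^ d) :=
    Nat.le_mul_of_pos_right _ (by omega)
  rw [storeSize]
  simp only [add_mul _ _ (n * (K + 1) ^ d)] at h2 h4 ⊢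
  omega

theorem traverseTime_le {d : ℕ} (hd : 2 ≤ d) (K T : ℕ) :
    traverseTime d K T ≤ (140 + 2 ^ (d - 1) * (T + 1300)) * (K + 1) ^ (d - 1) := by
  have h1 := stageTime_le K T (d - 1)
  have h2 : K + 1 ≤ (K + 1) ^ (d - 1) := Nat.le_self_pow (by omega) _
  rw [mul_pow] at h1
  rw [traverseTime, add_mul]
  have : 2 ^ (d - 1) * (K + 1) ^ (d - 1) * (T + 1300) =
      2 ^ (d - 1) * (T + 1300) * (K + 1) ^ (d - 1) := by ring
  omega

theorem queryTime_le (d κ m : ℕ) (hd : 2 ≤ d) : ∃ A : ℕ, ∀ K : ℕ,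
    queryTime d κ m K ≤ A * (K + 1) ^ (d - 1) := by
  refine ⟨(140 + 2 ^ (d - 1) * (10 + 1300) + 100) * (m + 2) + (initSlots m m : Cmd d).cost +
    (140 + 2 ^ (d - 1) * ((heavyLeaf κ m (16 + 2 * m + 32 * (d - 1)) : Cmd d).cost + 1300)),
    fun K => ?_⟩
  have h0 : 1 ≤ (K + 1) ^ (d - 1) := Nat.one_le_pow _ _ (by omega)
  rw [queryTime, add_mul _ _ ((K + 1) ^ (d - 1)), add_mul _ _ ((K + 1) ^ (d - 1))]
  refine Nat.add_le_add (Nat.add_le_add ?_ (Nat.le_mul_of_pos_right _ h0)) (traverseTime_le hd _ _)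
  rw [mul_right_comm]
  refine Nat.mul_le_mul_right _ ?_
  rw [add_mul _ 100]
  exact Nat.add_le_add (traverseTime_le hd _ _) (Nat.le_mul_of_pos_right _ h0)

theorem storeSize_isBigO (d κ m : ℕ) (hd : 0 < d) :
    (fun n : ℕ => (storeSize d κ m n (Nat.clog 2 n + 1) : ℝ)) =O[atTop]
      fun n : ℕ => (n : ℝ) * Real.log n ^ d := by
  obtain ⟨A, hA⟩ := storeSize_le d κ m hd
  refine IsBigO.of_bound (A * 8 ^ d) ?_
  filter_upwards [eventually_ge_atTop 2] with n hn
  have h1 : (storeSize d κ m n (Nat.clog 2 n + 1) : ℝ) ≤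
      A * (n * ((Nat.clog 2 n + 1 + 1 : ℕ) : ℝ) ^ d) := by exact_mod_cast hA n _ (by omega)
  have h2 := pow_le_pow_left₀ (Nat.cast_nonneg _) (clog_add_two_le hn) d
  have h3 : 0 ≤ Real.log n := Real.log_natCast_nonneg n
  rw [Real.norm_of_nonneg (Nat.cast_nonneg _), Real.norm_of_nonneg (by positivity)]
  refine h1.trans ?_
  calc (A : ℝ) * (n * ((Nat.clog 2 n + 1 + 1 : ℕ) : ℝ) ^ d) ≤ A * (n * (8 * Real.log n) ^ d) := by
        gcongr
    _ = _ := by rw [mul_pow]; ring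

theorem queryTime_isBigO (d κ m : ℕ) (hd : 2 ≤ d) :
    (fun n : ℕ => (queryTime d κ m (Nat.clog 2 n + 1) : ℝ)) =O[atTop]
      fun n : ℕ => Real.log n ^ (d - 1) * Real.log (Real.log n) ^ 2 := by
  obtain ⟨A, hA⟩ := queryTime_le d κ m hd
  refine IsBigO.of_bound (A * 8 ^ (d - 1)) ?_
  have hlog : Tendsto (fun n : ℕ => Real.log (Real.log n)) atTop atTop :=
    Real.tendsto_log_atTop.comp (Real.tendsto_log_atTop.comp tendsto_natCast_atTop_atTop)
  filter_upwards [eventually_ge_atTop 2, hlog.eventually_ge_atTop 1] with n hn hn'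
  have h1 : (queryTime d κ m (Nat.clog 2 n + 1) : ℝ) ≤
      A * ((Nat.clog 2 n + 1 + 1 : ℕ) : ℝ) ^ (d - 1) := by exact_mod_cast hA _
  have h2 := pow_le_pow_left₀ (Nat.cast_nonneg _) (clog_add_two_le hn) (d - 1)
  have h3 : 0 ≤ Real.log n := Real.log_natCast_nonneg n
  rw [Real.norm_of_nonneg (Nat.cast_nonneg _), Real.norm_of_nonneg (by positivity)]
  refine h1.trans ?_
  calc (A : ℝ) * ((Nat.clog 2 n + 1 + 1 : ℕ) : ℝ) ^ (d - 1) ≤ A * (8 * Real.log n) ^ (d - 1) := by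
        gcongr
    _ = A * 8 ^ (d - 1) * (Real.log n ^ (d - 1) * 1) := by rw [mul_pow]; ring
    _ ≤ _ := by
      gcongr
      -- Here the factor `(log log n)²`, eventually at least 1, is simply inserted.
      exact one_le_pow₀ hn'

end ColorRange

theorem theorem4 (d : ℕ) (hd : 2 ≤ d) (τ : ℝ) (hτ0 : 0 < τ) (hτ1 : τ ≤ 1) :
    ∃ (prog : ColorRange.Cmd d) (k : ℕ) (S T : ℕ → ℕ),
      (fun n : ℕ => (S n : ℝ)) =O[atTop] (fun n : ℕ => (n : ℝ) * Real.log n ^ d) ∧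
      (fun n : ℕ => (T n : ℝ)) =O[atTop]
        (fun n : ℕ => Real.log n ^ (d - 1) * Real.log (Real.log n) ^ 2) ∧
      ∀ (n w : ℕ) (P : Fin n → Fin d → ℝ) (col : Fin n → ℕ),
        0 < w → n ≤ 2 ^ w → (∀ i, col i < 2 ^ w) →
        ∃ D : ColorRange.Store,
          (∀ v ∈ D.words, v < 2 ^ (k * w)) ∧ D.space ≤ S n ∧
          ColorRange.AnswersQueries prog (k * w) D τ P col (T n) := by
  -- Of the resulting share `κτ ≥ 4`, at most 2 is lost to unlisted colors, and the remaining 2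
  -- yields `2|S| ≤ κ * v`.
  set κ := ⌈4 / τ⌉₊ with hκ
  -- The least number of slots that exceeds `κ ^ 2`.
  set m := κ ^ 2 + 1
  have hκ4 : 4 ≤ τ * κ := by
    have := Nat.le_ceil (4 / τ)
    rwa [div_le_iff₀' hτ0] at this
  obtain ⟨k, hk, hbound⟩ := ColorRange.exists_word_bound d κ m
  refine ⟨ColorRange.queryProg d κ m, k,
    fun n => ColorRange.storeSize d κ m n (Nat.clog 2 n + 1),
    fun n => ColorRange.queryTime d κ m (Nat.clog 2 n + 1),
    ColorRange.storeSize_isBigO d κ m (by omega), ColorRange.queryTime_isBigO d κ m hd, ?_⟩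
  intro n w P col hw hn hcol
  obtain ⟨ρ, hρ, hρ'⟩ := ColorRange.exists_representative col
  have hW := hbound n w hw hn
  refine ⟨ColorRange.store κ (Nat.clog 2 n + 1) m τ P col ρ,
    ColorRange.lt_of_mem_words hτ1 (fun i => (hcol i).trans_le
      (Nat.pow_le_pow_right (by omega) (Nat.le_mul_of_pos_left w hk))) hW,
    ColorRange.space_store.le, ?_⟩
  exact ColorRange.answersQueries (ColorRange.layout_store (Nat.succ_pos _)
    (Nat.le_pow_clog (by omega) n) hW) (by omega) hτ0 hκ4 (Nat.lt_succ_self _) hρ hρ'
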